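/- Let $n\ge 0$. The $0$-Hecke algebra $H_n(0)$ is the $\mathbb C$-algebra generated by $\pi_1,\dots,\pi_{n-1}$ with relations $\pi_i^2=\pi_i$, $\pi_i\pi_{i+1}\pi_i=\pi_{i+1}\pi_i\pi_{i+1}$, and $\pi_i\pi_j=\pi_j\pi_i$ for $|i-j|\ge 2$. Let $\alpha=(\alpha_1,\dots,\alpha_\ell)$ be a composition of $n$. A generalized composition $\boldsymbol\alpha=\alpha^{1}\oplus\cdots\oplus\alpha^{k}$ of $n$ is a formal sum of nonempty compositions of total size $n$; empty summands are dropped, and a composition is regarded as a generalized composition with one summand (none if $n=0$). $[\boldsymbol\alpha]$ is the set of compositions $\alpha^{1}\,\square\cdots\square\,\alpha^{k}$, where each $\square$ is concatenation or near concatenation $(a_1,\dots,a_r)\odot(b_1,\dots,b_s)=(a_1,\dots,a_r+b_1,\dots,b_s)$. The ribbon diagram of a composition is the connected skew diagram without $2\times2$ squares whose $i$th column from the left has as many boxes as the $i$th part (so the bottom box of a column is in the row of the top box of the column before); in the ribbon diagram of $\boldsymbol\alpha$ the diagrams of the summands are placed one after the other, each strictly northeast of the previous one. $\mathrm{SRT}(\boldsymbol\alpha)$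 is the set of fillings of this diagram by $1,\dots,n$, each used once, that increase from left to right in rows and from top to bottom in columns. $\mathbf P_{\boldsymbol\alpha}$ is the $H_n(0)$-module with $\mathbb C$-basis $\mathrm{SRT}(\boldsymbol\alpha)$ on which $\pi_i T=T$ if $i$ is strictly above $i+1$ in $T$, $\pi_iT=0$ if they are in the same row, and otherwise $\pi_iT=s_i\cdot T$ ($i$ and $i+1$ swapped). $\mathrm{SIT}(\alpha)$ is the set of fillings, by $1,\dots,n$ each used once, of the left-justified diagram with rows of lengths $\alpha_1,\dots,\alpha_\ell$ (from the top) that increase from left to right in rows and from top to bottom in the first column. $\mathcal V_\alpha$ is the $H_n(0)$-module with basis $\mathrm{SIT}(\alpha)$ on which $\pi_i\mathcal T=\mathcal T$ if $i$ is not strictly above $i+1$ in $\mathcal T$, $\pi_i\mathcal T=0$ if $i$ and $i+1$ are both in the first column, and $\pi_i\mathcal T=s_i\cdot\mathcal T$ otherwise. For a composition $\beta$ of $n$, $\mathbf F_\beta$ is the one-dimensional module on which $\pi_i$ acts by $0$ if $i\in\{\beta_1,\beta_1+\beta_2,\dots,\beta_1+\cdots+\beta_{\ell(\beta)-1}\}$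 and by $1$ otherwise. Let $\Phi:\mathbf P_\alpha\to\mathcal V_\alpha$ be the linear map that sends $T\in\mathrm{SRT}(\alpha)$ to the filling whose $p$th row is the $p$th column of $T$ (read from the top) if this is in $\mathrm{SIT}(\alpha)$, and to $0$ otherwise. Let $\mathcal I(\alpha)=\{1\le i\le\ell-1:\alpha_{i+1}\ne1\}$ and, for $i\in\mathcal I(\alpha)$, $$\boldsymbol\alpha^{(i)}=(\alpha_1,\dots,\alpha_{i-1},\alpha_i+1,\alpha_{i+1}-1)\oplus(\alpha_{i+2},\dots,\alpha_\ell).$$ For $\tau\in\mathrm{SRT}(\boldsymbol\alpha^{(i)})$ let $L(\tau)$ be the filling of the ribbon diagram of $\alpha$, with columns increasing from top to bottom, whose columns have the same entries as those of $\tau$ except that the top entry of column $i$ of $\tau$ is moved to column $i+1$. Let $\partial_1^{(i)}:\mathbf P_{\boldsymbol\alpha^{(i)}}\to\mathbf P_\alpha$ be the linear map with $\partial_1^{(i)}(\tau)=L(\tau)$ if $L(\tau)\in\mathrm{SRT}(\alpha)$ and $\partial_1^{(i)}(\tau)=0$ otherwise, and let $$\partial_1=\sum_{i\in\mathcal I(\alpha)}\partial_1^{(i)}:\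 \bigoplus_{i\in\mathcal I(\alpha)}\mathbf P_{\boldsymbol\alpha^{(i)}}\to\mathbf P_\alpha .$$ A surjective homomorphism $f:A\to B$ of finitely generated modules is an essential epimorphism if every homomorphism $g:X\to A$ with $f\circ g$ surjective is surjective; it is a projective cover of $B$ if moreover $A$ is projective. **Theorem.** The maps $\Phi$ and $\partial_1$ are $H_n(0)$-homomorphisms. Put $\Omega(\mathcal V_\alpha)=\ker\Phi$. (a) $\operatorname{Im}(\partial_1)=\Omega(\mathcal V_\alpha)$, and $\partial_1:\bigoplus_{i\in\mathcal I(\alpha)}\mathbf P_{\boldsymbol\alpha^{(i)}}\to\Omega(\mathcal V_\alpha)$ is a projective cover of $\Omega(\mathcal V_\alpha)$. Moreover $\Phi$ is a projective cover of $\mathcal V_\alpha$, so that $$\bigoplus_{i\in\mathcal I(\alpha)}\mathbf P_{\boldsymbol\alpha^{(i)}}\xrightarrow{\ \partial_1\ }\mathbf P_\alpha\xrightarrow{\ \Phi\ }\mathcal V_\alpha\to0$$ is exact and a minimal projective presentation of $\mathcal V_\alpha$. (b) Let $\mathcal J(\alpha)=\bigcup_{i\in\mathcal I(\alpha)}[\boldsymbol\alpha^{(i)}]$.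 For every composition $\beta$ of $n$, there is an isomorphism of complex vector spaces $\operatorname{Ext}^1_{H_n(0)}(\mathcal V_\alpha,\mathbf F_\beta)\cong\mathbb C$ if $\beta\in\mathcal J(\alpha)$, and $\operatorname{Ext}^1_{H_n(0)}(\mathcal V_\alpha,\mathbf F_\beta)=0$ otherwise. -/

import Mathlib

open scoped DirectSum

noncomputable section

namespace ZeroHecke

/-! ### The 0-Hecke algebra -/

/-- The defining relations of the 0-Hecke algebra on `n - 1` generators. The index `i : Fin (n - 1)`
stands for the generator written `π_{i+1}`. -/
inductive Rel (n : ℕ) : FreeAlgebra ℂ (Fin (n - 1)) → FreeAlgebra ℂ (Fin (n - 1)) → Prop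
  | idem (i : Fin (n - 1)) :
      Rel n (FreeAlgebra.ι ℂ i * FreeAlgebra.ι ℂ i) (FreeAlgebra.ι ℂ i)
  | braid (i j : Fin (n - 1)) (h : (j : ℕ) = i + 1) :
      Rel n (FreeAlgebra.ι ℂ i * FreeAlgebra.ι ℂ j * FreeAlgebra.ι ℂ i)
        (FreeAlgebra.ι ℂ j * FreeAlgebra.ι ℂ i * FreeAlgebra.ι ℂ j)
  | comm (i j : Fin (n - 1)) (h : (i : ℕ) + 2 ≤ j) :
      Rel n (FreeAlgebra.ι ℂ i * FreeAlgebra.ι ℂ j) (FreeAlgebra.ι ℂ j * FreeAlgebra.ι ℂ i)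

/-- The 0-Hecke algebra `H_n(0)` over `ℂ`. -/
def H (n : ℕ) : Type := RingQuot (Rel n)

instance (n : ℕ) : Ring (H n) := inferInstanceAs (Ring (RingQuot (Rel n)))

instance (n : ℕ) : Algebra ℂ (H n) := inferInstanceAs (Algebra ℂ (RingQuot (Rel n)))

/-- The generator `π_{i+1}` of `H_n(0)`. -/
def gen {n : ℕ} (i : Fin (n - 1)) : H n := RingQuot.mkAlgHom ℂ (Rel n) (FreeAlgebra.ι ℂ i)

/-- Endomorphisms satisfying the defining relations give a representation of `H_n(0)`. -/
def rep {n : ℕ} {M : Type} [AddCommGroup M] [Module ℂ M] (A : Fin (n - 1) → Module.End ℂ M)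
    (idem : ∀ i, A i * A i = A i)
    (braid : ∀ i j : Fin (n - 1), (j : ℕ) = i + 1 → A i * A j * A i = A j * A i * A j)
    (comm : ∀ i j : Fin (n - 1), (i : ℕ) + 2 ≤ j → A i * A j = A j * A i) :
    H n →ₐ[ℂ] Module.End ℂ M :=
  RingQuot.liftAlgHom ℂ ⟨FreeAlgebra.lift ℂ A, by
    intro x y h
    cases h with
    | idem i => simpa using idem i
    | braid i j h => simpa using braid i j h
    | comm i j h => simpa using comm i j h⟩

theorem rep_gen {n : ℕ} {M : Type} [AddCommGroup M] [Module ℂ M]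
    (A : Fin (n - 1) → Module.End ℂ M) (idem braid comm) (i : Fin (n - 1)) :
    rep A idem braid comm (gen i) = A i :=
  (RingQuot.liftAlgHom_mkAlgHom_apply ℂ _ _ _).trans (FreeAlgebra.lift_ι_apply _ _)

/-! ### Verification of the relations for actions on tableaux

An operator of the kind used below looks only at the boxes `x`, `y` that contain `i` and `i + 1`,
and either swaps the two entries, or kills the tableau, or fixes it. -/

/-- The effect on the boxes of two consecutive entries. -/
def step {C : Type} (sw kill : C → C → Prop) (x y : C) : Option (C × C) :=
  open Classical in
  if sw x y then some (y, x) else if kill x y then none else some (x, y)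

/-- `step` on the first two of three boxes. -/
def stepL {C : Type} (sw kill : C → C → Prop) (w : C × C × C) : Option (C × C × C) :=
  (step sw kill w.1 w.2.1).map fun p => (p.1, p.2, w.2.2)

/-- `step` on the last two of three boxes. -/
def stepR {C : Type} (sw kill : C → C → Prop) (w : C × C × C) : Option (C × C × C) :=
  (step sw kill w.2.1 w.2.2).map fun p => (w.1, p.1, p.2)

theorem braid_ribbon {C : Type} (r : C → ℕ) (w : C × C × C) :
    ((stepL (fun x y => r x < r y) (fun x y => r x = r y) w).bind
      (stepR (fun x y => r x < r y) (fun x y => r x = r y))).bind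
      (stepL (fun x y => r x < r y) (fun x y => r x = r y)) =
    ((stepR (fun x y => r x < r y) (fun x y => r x = r y) w).bind
      (stepL (fun x y => r x < r y) (fun x y => r x = r y))).bind
      (stepR (fun x y => r x < r y) (fun x y => r x = r y)) := by
  obtain ⟨x, y, z⟩ := w
  rcases lt_trichotomy (r x) (r y) with h1 | h1 | h1 <;>
  rcases lt_trichotomy (r y) (r z) with h2 | h2 | h2 <;>
  rcases lt_trichotomy (r x) (r z) with h3 | h3 | h3 <;>
  first
  | (exfalso; omega)
  | (have a1 := h1.not_gt
     have a2 := h2.not_gt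
     have a3 := h3.not_gt
     first
     | simp [stepL, stepR, step, h1, h2, h3, a1, a2, a3, h1.ne', h2.ne', h3.ne']
     | simp [stepL, stepR, step, *, Nat.ne_of_gt])

theorem braid_imm {C : Type} (r : C → ℕ) (c : C → Prop) (w : C × C × C) :
    ((stepL (fun x y => r x < r y ∧ ¬ (c x ∧ c y)) (fun x y => r x < r y ∧ c x ∧ c y) w).bind
      (stepR (fun x y => r x < r y ∧ ¬ (c x ∧ c y)) (fun x y => r x < r y ∧ c x ∧ c y))).bind
      (stepL (fun x y => r x < r y ∧ ¬ (c x ∧ c y)) (fun x y => r x < r y ∧ c x ∧ c y)) =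
    ((stepR (fun x y => r x < r y ∧ ¬ (c x ∧ c y)) (fun x y => r x < r y ∧ c x ∧ c y) w).bind
      (stepL (fun x y => r x < r y ∧ ¬ (c x ∧ c y)) (fun x y => r x < r y ∧ c x ∧ c y))).bind
      (stepR (fun x y => r x < r y ∧ ¬ (c x ∧ c y)) (fun x y => r x < r y ∧ c x ∧ c y)) := by
  obtain ⟨x, y, z⟩ := w
  by_cases h1 : r x < r y <;> by_cases h2 : r y < r z <;> by_cases h3 : r x < r z <;>
  by_cases h4 : r y < r x <;> by_cases h5 : r z < r y <;> by_cases h6 : r z < r x <;>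
  first
  | (exfalso; omega)
  | (by_cases c1 : c x <;> by_cases c2 : c y <;> by_cases c3 : c z <;>
      simp [stepL, stepR, step, h1, h2, h3, h4, h5, c1, c2, c3])

/-- Data of an action by operators that swap, kill or fix. -/
structure Moves (n : ℕ) (S C : Type) where
  pos : S → ℕ → C
  sw : C → C → Prop
  kill : C → C → Prop
  s : ℕ → S → S
  A : ℕ → (S →₀ ℂ) →ₗ[ℂ] (S →₀ ℂ)
  inj : ∀ T T', (∀ j, 1 ≤ j → j ≤ n → pos T j = pos T' j) → T = T'
  hs : ∀ i T, 1 ≤ i → i < n → sw (pos T i) (pos T (i + 1)) →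
    ∀ j, 1 ≤ j → j ≤ n → pos (s i T) j = pos T (Equiv.swap i (i + 1) j)
  hsw : ∀ i T, 1 ≤ i → i < n → sw (pos T i) (pos T (i + 1)) →
    A i (Finsupp.single T 1) = Finsupp.single (s i T) 1
  hkill : ∀ i T, 1 ≤ i → i < n → ¬ sw (pos T i) (pos T (i + 1)) →
    kill (pos T i) (pos T (i + 1)) → A i (Finsupp.single T 1) = 0
  hfix : ∀ i T, 1 ≤ i → i < n → ¬ sw (pos T i) (pos T (i + 1)) →
    ¬ kill (pos T i) (pos T (i + 1)) → A i (Finsupp.single T 1) = Finsupp.single T 1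
  asymm : ∀ x y, sw x y → ¬ sw y x ∧ ¬ kill y x
  braid : ∀ w, ((stepL sw kill w).bind (stepR sw kill)).bind (stepL sw kill) =
    ((stepR sw kill w).bind (stepL sw kill)).bind (stepR sw kill)

namespace Moves

variable {n : ℕ} {S C : Type} (m : Moves n S C)

theorem idem (i : ℕ) (h1 : 1 ≤ i) (h2 : i < n) : m.A i * m.A i = m.A i := by
  refine Finsupp.lhom_ext' fun T => LinearMap.ext_ring ?_
  simp only [LinearMap.comp_apply, Finsupp.lsingle_apply, Module.End.mul_apply]
  by_cases h : m.sw (m.pos T i) (m.pos T (i + 1))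
  · rw [m.hsw i T h1 h2 h]
    have e1 := m.hs i T h1 h2 h i h1 h2.le
    have e2 := m.hs i T h1 h2 h (i + 1) (by omega) h2
    rw [Equiv.swap_apply_left] at e1
    rw [Equiv.swap_apply_right] at e2
    have := m.asymm _ _ h
    exact m.hfix i _ h1 h2 (by rw [e1, e2]; exact this.1) (by rw [e1, e2]; exact this.2)
  · by_cases h' : m.kill (m.pos T i) (m.pos T (i + 1))
    · rw [m.hkill i T h1 h2 h h', map_zero]
    · rw [m.hfix i T h1 h2 h h', m.hfix i T h1 h2 h h']

theorem comm (i j : ℕ) (h1 : 1 ≤ i) (hij : i + 2 ≤ j) (h2 : j < n) :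
    m.A i * m.A j = m.A j * m.A i := by
  have h1' : 1 ≤ j := by omega
  have h2' : i < n := by omega
  refine Finsupp.lhom_ext' fun T => LinearMap.ext_ring ?_
  simp only [LinearMap.comp_apply, Finsupp.lsingle_apply, Module.End.mul_apply]
  have a1 : m.sw (m.pos T i) (m.pos T (i + 1)) →
      m.pos (m.s i T) j = m.pos T j ∧ m.pos (m.s i T) (j + 1) = m.pos T (j + 1) := by
    intro h
    rw [m.hs i T h1 h2' h j h1' h2.le, m.hs i T h1 h2' h (j + 1) (by omega) h2,
      Equiv.swap_apply_of_ne_of_ne (by omega) (by omega),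
      Equiv.swap_apply_of_ne_of_ne (by omega) (by omega)]
    exact ⟨rfl, rfl⟩
  have a2 : m.sw (m.pos T j) (m.pos T (j + 1)) →
      m.pos (m.s j T) i = m.pos T i ∧ m.pos (m.s j T) (i + 1) = m.pos T (i + 1) := by
    intro h
    rw [m.hs j T h1' h2 h i h1 h2'.le, m.hs j T h1' h2 h (i + 1) (by omega) h2',
      Equiv.swap_apply_of_ne_of_ne (by omega) (by omega),
      Equiv.swap_apply_of_ne_of_ne (by omega) (by omega)]
    exact ⟨rfl, rfl⟩
  by_cases hi : m.sw (m.pos T i) (m.pos T (i + 1)) <;>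
    by_cases hj : m.sw (m.pos T j) (m.pos T (j + 1))
  · obtain ⟨b1, b1'⟩ := a1 hi
    obtain ⟨b2, b2'⟩ := a2 hj
    have hi' : m.sw (m.pos (m.s j T) i) (m.pos (m.s j T) (i + 1)) := by rwa [b2, b2']
    have hj' : m.sw (m.pos (m.s i T) j) (m.pos (m.s i T) (j + 1)) := by rwa [b1, b1']
    rw [m.hsw i T h1 h2' hi, m.hsw j T h1' h2 hj, m.hsw i _ h1 h2' hi', m.hsw j _ h1' h2 hj']
    congr 1
    apply m.inj
    intro k hk hk'
    have r1 : 1 ≤ Equiv.swap i (i + 1) k ∧ Equiv.swap i (i + 1) k ≤ n := by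
      rw [Equiv.swap_apply_def]; split_ifs <;> omega
    have r2 : 1 ≤ Equiv.swap j (j + 1) k ∧ Equiv.swap j (j + 1) k ≤ n := by
      rw [Equiv.swap_apply_def]; split_ifs <;> omega
    rw [m.hs i _ h1 h2' hi' k hk hk', m.hs j _ h1' h2 hj' k hk hk',
      m.hs i T h1 h2' hi _ r2.1 r2.2, m.hs j T h1' h2 hj _ r1.1 r1.2]
    congr 1
    simp only [Equiv.swap_apply_def]
    split_ifs <;> omega
  · obtain ⟨b1, b1'⟩ := a1 hi
    rw [m.hsw i T h1 h2' hi]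
    by_cases kj : m.kill (m.pos T j) (m.pos T (j + 1))
    · rw [m.hkill j T h1' h2 hj kj, m.hkill j _ h1' h2 (by rwa [b1, b1']) (by rwa [b1, b1']),
        map_zero]
    · rw [m.hfix j T h1' h2 hj kj, m.hfix j _ h1' h2 (by rwa [b1, b1']) (by rwa [b1, b1']),
        m.hsw i T h1 h2' hi]
  · obtain ⟨b2, b2'⟩ := a2 hj
    rw [m.hsw j T h1' h2 hj]
    by_cases ki : m.kill (m.pos T i) (m.pos T (i + 1))
    · rw [m.hkill i T h1 h2' hi ki, m.hkill i _ h1 h2' (by rwa [b2, b2']) (by rwa [b2, b2']),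
        map_zero]
    · rw [m.hfix i T h1 h2' hi ki, m.hfix i _ h1 h2' (by rwa [b2, b2']) (by rwa [b2, b2']),
        m.hsw j T h1' h2 hj]
  · by_cases ki : m.kill (m.pos T i) (m.pos T (i + 1)) <;>
      by_cases kj : m.kill (m.pos T j) (m.pos T (j + 1))
    · rw [m.hkill i T h1 h2' hi ki, m.hkill j T h1' h2 hj kj, map_zero, map_zero]
    · rw [m.hkill i T h1 h2' hi ki, m.hfix j T h1' h2 hj kj, m.hkill i T h1 h2' hi ki, map_zero]
    · rw [m.hfix i T h1 h2' hi ki, m.hkill j T h1' h2 hj kj, map_zero]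
    · rw [m.hfix i T h1 h2' hi ki, m.hfix j T h1' h2 hj kj, m.hfix i T h1 h2' hi ki]

/-- The vector `v` is described by the boxes `o` of the entries `i`, `i + 1`, `i + 2`, all other
entries being placed as in `T₀`. -/
def Tracks (T₀ : S) (i : ℕ) (o : Option (C × C × C)) (v : S →₀ ℂ) : Prop :=
  match o with
  | none => v = 0
  | some w => ∃ T, v = Finsupp.single T 1 ∧ m.pos T i = w.1 ∧ m.pos T (i + 1) = w.2.1 ∧
      m.pos T (i + 2) = w.2.2 ∧
      ∀ j, 1 ≤ j → j ≤ n → j ≠ i → j ≠ i + 1 → j ≠ i + 2 → m.pos T j = m.pos T₀ j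

theorem Tracks.unique {T₀ : S} {i : ℕ} {o : Option (C × C × C)} {v v' : S →₀ ℂ}
    (h : m.Tracks T₀ i o v) (h' : m.Tracks T₀ i o v') : v = v' := by
  cases o with
  | none => exact Eq.trans h (Eq.symm h')
  | some w =>
    obtain ⟨T, rfl, a1, a2, a3, a4⟩ := h
    obtain ⟨T', rfl, b1, b2, b3, b4⟩ := h'
    congr 1
    apply m.inj
    intro j hj hj'
    by_cases c1 : j = i
    · rw [c1, a1, b1]
    by_cases c2 : j = i + 1
    · rw [c2, a2, b2]
    by_cases c3 : j = i + 2
    · rw [c3, a3, b3]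
    rw [a4 j hj hj' c1 c2 c3, b4 j hj hj' c1 c2 c3]

theorem Tracks.left {T₀ : S} {i : ℕ} {o : Option (C × C × C)} {v : S →₀ ℂ} (h1 : 1 ≤ i)
    (h2 : i + 1 < n) (h : m.Tracks T₀ i o v) :
    m.Tracks T₀ i (o.bind (stepL m.sw m.kill)) (m.A i v) := by
  have h2' : i < n := by omega
  cases o with
  | none => cases h; exact map_zero _
  | some w =>
    obtain ⟨x, y, z⟩ := w
    obtain ⟨T, rfl, rfl, rfl, rfl, a4⟩ := h
    by_cases c : m.sw (m.pos T i) (m.pos T (i + 1))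
    · rw [m.hsw i T h1 h2' c]
      simp only [Option.bind_some, stepL, step, c, if_true, Option.map_some]
      refine ⟨_, rfl, ?_, ?_, ?_, ?_⟩
      · rw [m.hs i T h1 h2' c _ (by omega) (by omega), Equiv.swap_apply_left]
      · rw [m.hs i T h1 h2' c _ (by omega) (by omega), Equiv.swap_apply_right]
      · rw [m.hs i T h1 h2' c _ (by omega) (by omega),
          Equiv.swap_apply_of_ne_of_ne (by omega) (by omega)]
      · intro j hj hj' d1 d2 d3
        rw [m.hs i T h1 h2' c _ hj hj', Equiv.swap_apply_of_ne_of_ne d1 d2, a4 j hj hj' d1 d2 d3]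
    · by_cases d : m.kill (m.pos T i) (m.pos T (i + 1))
      · rw [m.hkill i T h1 h2' c d]
        simp [stepL, step, c, d, Tracks]
      · rw [m.hfix i T h1 h2' c d]
        simp only [Option.bind_some, stepL, step, c, d, if_false, Option.map_some]
        exact ⟨_, rfl, rfl, rfl, rfl, a4⟩

theorem Tracks.right {T₀ : S} {i : ℕ} {o : Option (C × C × C)} {v : S →₀ ℂ} (h1 : 1 ≤ i)
    (h2 : i + 1 < n) (h : m.Tracks T₀ i o v) :
    m.Tracks T₀ i (o.bind (stepR m.sw m.kill)) (m.A (i + 1) v) := by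
  have h1' : 1 ≤ i + 1 := by omega
  cases o with
  | none => cases h; exact map_zero _
  | some w =>
    obtain ⟨x, y, z⟩ := w
    obtain ⟨T, rfl, rfl, rfl, rfl, a4⟩ := h
    by_cases c : m.sw (m.pos T (i + 1)) (m.pos T (i + 2))
    · rw [m.hsw (i + 1) T h1' h2 c]
      simp only [Option.bind_some, stepR, step, c, if_true, Option.map_some]
      refine ⟨_, rfl, ?_, ?_, ?_, ?_⟩
      · rw [m.hs (i + 1) T h1' h2 c _ (by omega) (by omega),
          Equiv.swap_apply_of_ne_of_ne (by omega) (by omega)]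
      · rw [m.hs (i + 1) T h1' h2 c _ (by omega) (by omega), Equiv.swap_apply_left]
      · rw [m.hs (i + 1) T h1' h2 c _ (by omega) (by omega)]
        exact congrArg _ (Equiv.swap_apply_right _ _)
      · intro j hj hj' d1 d2 d3
        rw [m.hs (i + 1) T h1' h2 c _ hj hj', Equiv.swap_apply_of_ne_of_ne d2 d3,
          a4 j hj hj' d1 d2 d3]
    · by_cases d : m.kill (m.pos T (i + 1)) (m.pos T (i + 2))
      · rw [m.hkill (i + 1) T h1' h2 c d]
        simp [stepR, step, c, d, Tracks]
      · rw [m.hfix (i + 1) T h1' h2 c d]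
        simp only [Option.bind_some, stepR, step, c, d, if_false, Option.map_some]
        exact ⟨_, rfl, rfl, rfl, rfl, a4⟩

theorem braid_rel (i : ℕ) (h1 : 1 ≤ i) (h2 : i + 1 < n) :
    m.A i * m.A (i + 1) * m.A i = m.A (i + 1) * m.A i * m.A (i + 1) := by
  refine Finsupp.lhom_ext' fun T => LinearMap.ext_ring ?_
  simp only [LinearMap.comp_apply, Finsupp.lsingle_apply, Module.End.mul_apply]
  have h0 : m.Tracks T i (some (m.pos T i, m.pos T (i + 1), m.pos T (i + 2)))
      (Finsupp.single T 1) := ⟨T, rfl, rfl, rfl, rfl, fun _ _ _ _ _ _ => rfl⟩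
  have l := Tracks.left m h1 h2 (Tracks.right m h1 h2 (Tracks.left m h1 h2 h0))
  have r := Tracks.right m h1 h2 (Tracks.left m h1 h2 (Tracks.right m h1 h2 h0))
  simp only [Option.bind_some] at l r
  rw [m.braid] at l
  exact Tracks.unique m l r

/-- The resulting representation; `π_i` acts by the `i`-th operator. -/
def toRep : H n →ₐ[ℂ] Module.End ℂ (S →₀ ℂ) :=
  rep (fun i : Fin (n - 1) => m.A (i + 1))
    (fun i => m.idem _ (by omega) (by omega))
    (fun i j h => by
      have := m.braid_rel (i + 1) (by omega) (by omega)
      simpa only [h] using this)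
    (fun i j h => m.comm _ _ (by omega) (by omega) (by omega))

end Moves

/-! ### Compositions, generalized compositions and their diagrams

Rows, columns and parts are numbered from `0`; the entries of tableaux are `1, …, n`. -/

/-- A generalized composition of `n`: a formal sum of nonempty compositions of total size `n`. -/
structure GenComp (n : ℕ) where
  comps : List (List ℕ)
  nonempty : ∀ c ∈ comps, c ≠ []
  parts_pos : ∀ a ∈ comps.flatten, 0 < a
  sum_eq : comps.flatten.sum = n

/-- All parts of a generalized composition, from left to right. -/
def GenComp.parts {n : ℕ} (a : GenComp n) : List ℕ := a.comps.flatten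

/-- The formal sum of a list of lists of positive integers; empty summands are dropped. -/
def GenComp.ofLists {n : ℕ} (l : List (List ℕ)) (hpos : ∀ a ∈ l.flatten, 0 < a)
    (hsum : l.flatten.sum = n) : GenComp n where
  comps := l.filter fun c => !c.isEmpty
  nonempty := by
    intro c hc
    have := (List.mem_filter.1 hc).2
    intro h
    simp [h] at this
  parts_pos := by rwa [List.flatten_filter_not_isEmpty]
  sum_eq := by rwa [List.flatten_filter_not_isEmpty]

/-- A composition as a generalized composition with at most one summand. -/
def GenComp.single {n : ℕ} (α : Composition n) : GenComp n :=
  GenComp.ofLists [α.blocks] (by simpa using fun a ha => α.blocks_pos ha) (by simp)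

/-- Near concatenation. -/
def near (c d : List ℕ) : List ℕ := c.dropLast ++ (c.getLastD 0 + d.headD 0) :: d.tail

/-- All the lists `c₁ □ c₂ □ ⋯ □ c_m`, where each `□` is concatenation or near concatenation. -/
def joins : List (List ℕ) → Set (List ℕ)
  | [] => {[]}
  | [c] => {c}
  | c :: d :: l => {e | ∃ f ∈ joins (d :: l), e = c ++ f ∨ e = near c f}

/-- The set `[𝛂]` of compositions of `n` attached to the generalized composition `𝛂`. -/
def GenComp.bracket {n : ℕ} (a : GenComp n) : Set (Composition n) := {β | β.blocks ∈ joins a.comps}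

/-- The boxes `(p, q)` with `q < c_p`. Read as (row, column), this is the composition diagram
of `c`; read as (column, place in the column counted from the top), it is the set of boxes of the
ribbon diagram with column lengths `c`. -/
def boxes (c : List ℕ) : Set (ℕ × ℕ) := {x | x.2 < c.getD x.1 0}

/-- The number of connected components of the ribbon diagram that lie to the left of the
component of column `p`. -/
def GenComp.compIndex {n : ℕ} (a : GenComp n) (p : ℕ) : ℕ :=
  ((Finset.range a.comps.length).filter fun k => (a.comps.take (k + 1)).flatten.length ≤ p).card

/-- The row of a box of the generalized ribbon diagram, counted from the bottom. The box `(p, q)`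
is the one in column `p` with `q` boxes of this column above it. In a connected component the
bottom box of a column is in the row of the top box of the preceding column; the
first column of a new component starts one row above everything to its left. -/
def GenComp.height {n : ℕ} (a : GenComp n) (x : ℕ × ℕ) : ℕ :=
  (∑ r ∈ Finset.range x.1, (a.parts.getD r 0 - 1)) + a.compIndex x.1 +
    (a.parts.getD x.1 0 - 1 - x.2)

/-! ### Tableaux -/

/-- `T` is a filling of the set of boxes `D` by the distinct entries `1, …, n` (and takes the
dummy value `0` outside `D`). -/
structure IsFilling (n : ℕ) (D : Set (ℕ × ℕ)) (T : ℕ × ℕ → ℕ) : Prop where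
  zero : ∀ x, x ∉ D → T x = 0
  bij : Set.BijOn T D (Set.Icc 1 n)

/-- Swapping the entries `i` and `i + 1`. -/
def swapEntries (i : ℕ) (T : ℕ × ℕ → ℕ) : ℕ × ℕ → ℕ := fun x => Equiv.swap i (i + 1) (T x)

/-- Standard ribbon tableaux of shape `𝛂`: entries increase from left to right in rows and from
top to bottom in columns. -/
structure IsSRT {n : ℕ} (a : GenComp n) (T : ℕ × ℕ → ℕ) : Prop where
  filling : IsFilling n (boxes a.parts) T
  row : ∀ x ∈ boxes a.parts, ∀ y ∈ boxes a.parts, a.height x = a.height y → x.1 < y.1 → T x < T y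
  col : ∀ x ∈ boxes a.parts, ∀ y ∈ boxes a.parts, x.1 = y.1 → x.2 < y.2 → T x < T y

/-- Standard immaculate tableaux of shape `α`: entries increase from left to right in rows and
from top to bottom in the first column. -/
structure IsSIT {n : ℕ} (α : Composition n) (T : ℕ × ℕ → ℕ) : Prop where
  filling : IsFilling n (boxes α.blocks) T
  row : ∀ x ∈ boxes α.blocks, ∀ y ∈ boxes α.blocks, x.1 = y.1 → x.2 < y.2 → T x < T y
  col : ∀ x ∈ boxes α.blocks, ∀ y ∈ boxes α.blocks, x.2 = 0 → y.2 = 0 → x.1 < y.1 → T x < T y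

/-- The set of standard ribbon tableaux of shape `𝛂`. -/
@[ext]
structure SRT {n : ℕ} (a : GenComp n) : Type where
  entry : ℕ × ℕ → ℕ
  isSRT : IsSRT a entry

/-- The set of standard immaculate tableaux of shape `α`. -/
@[ext]
structure SIT {n : ℕ} (α : Composition n) : Type where
  entry : ℕ × ℕ → ℕ
  isSIT : IsSIT α entry

/-- The basis vector of a filling if it is a standard ribbon tableau, and `0` otherwise. -/
def SRT.vec {n : ℕ} (a : GenComp n) (T : ℕ × ℕ → ℕ) : SRT a →₀ ℂ :=
  open Classical in if h : IsSRT a T then Finsupp.single ⟨T, h⟩ 1 else 0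

/-- The basis vector of a filling if it is a standard immaculate tableau, and `0` otherwise. -/
def SIT.vec {n : ℕ} (α : Composition n) (T : ℕ × ℕ → ℕ) : SIT α →₀ ℂ :=
  open Classical in if h : IsSIT α T then Finsupp.single ⟨T, h⟩ 1 else 0

/-! ### The action on standard ribbon tableaux -/

/-- `i` is a descent of `T`: it appears weakly below `i + 1`. -/
def SRT.IsDes {n : ℕ} {a : GenComp n} (T : SRT a) (i : ℕ) : Prop :=
  ∃ x ∈ boxes a.parts, ∃ y ∈ boxes a.parts, T.entry x = i ∧ T.entry y = i + 1 ∧ a.height x ≤ a.height y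

/-- `i` and `i + 1` are in the same row of `T`. -/
def SRT.SameRow {n : ℕ} {a : GenComp n} (T : SRT a) (i : ℕ) : Prop :=
  ∃ x ∈ boxes a.parts, ∃ y ∈ boxes a.parts, T.entry x = i ∧ T.entry y = i + 1 ∧ a.height x = a.height y

/-- The vector `π_i · T`. In the last case `s_i · T` is again a standard ribbon tableau, see
`SRT.swap_isSRT`. -/
def SRT.act {n : ℕ} {a : GenComp n} (i : ℕ) (T : SRT a) : SRT a →₀ ℂ :=
  open Classical in
  if ¬ T.IsDes i then Finsupp.single T 1
  else if T.SameRow i then 0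
  else SRT.vec a (swapEntries i T.entry)

/-- The action of `π_i` on the span of the standard ribbon tableaux. -/
def SRT.op {n : ℕ} (a : GenComp n) (i : ℕ) : (SRT a →₀ ℂ) →ₗ[ℂ] (SRT a →₀ ℂ) :=
  Finsupp.linearCombination ℂ (SRT.act i)

/-! ### The action on standard immaculate tableaux -/

/-- `i` is a descent of `T`: it appears strictly above `i + 1`. -/
def SIT.IsDes {n : ℕ} {α : Composition n} (T : SIT α) (i : ℕ) : Prop :=
  ∃ x ∈ boxes α.blocks, ∃ y ∈ boxes α.blocks, T.entry x = i ∧ T.entry y = i + 1 ∧ x.1 < y.1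

/-- `i` and `i + 1` are in the first column of `T`. -/
def SIT.FirstCol {n : ℕ} {α : Composition n} (T : SIT α) (i : ℕ) : Prop :=
  ∃ x ∈ boxes α.blocks, ∃ y ∈ boxes α.blocks, T.entry x = i ∧ T.entry y = i + 1 ∧ x.2 = 0 ∧ y.2 = 0

/-- The vector `π_i · T`. In the last case `s_i · T` is again a standard immaculate tableau, see
`SIT.swap_isSIT`. -/
def SIT.act {n : ℕ} {α : Composition n} (i : ℕ) (T : SIT α) : SIT α →₀ ℂ :=
  open Classical in
  if ¬ T.IsDes i then Finsupp.single T 1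
  else if T.FirstCol i then 0
  else SIT.vec α (swapEntries i T.entry)

/-- The action of `π_i` on the span of the standard immaculate tableaux. -/
def SIT.op {n : ℕ} (α : Composition n) (i : ℕ) : (SIT α →₀ ℂ) →ₗ[ℂ] (SIT α →₀ ℂ) :=
  Finsupp.linearCombination ℂ (SIT.act i)

/-! ### These are actions of the 0-Hecke algebra -/

theorem IsFilling.swap {n : ℕ} {D : Set (ℕ × ℕ)} {T : ℕ × ℕ → ℕ} (h : IsFilling n D T) {i : ℕ}
    (h1 : 1 ≤ i) (h2 : i < n) : IsFilling n D (swapEntries i T) := by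
  constructor
  · intro x hx
    simp only [swapEntries, h.zero x hx]
    exact Equiv.swap_apply_of_ne_of_ne (by omega) (by omega)
  · have : Set.BijOn (Equiv.swap i (i + 1)) (Set.Icc 1 n) (Set.Icc 1 n) := by
      refine ⟨?_, (Equiv.injective _).injOn, ?_⟩
      · intro k hk
        simp only [Set.mem_Icc] at hk ⊢
        rw [Equiv.swap_apply_def]; split_ifs <;> omega
      · intro k hk
        refine ⟨Equiv.swap i (i + 1) k, ?_, Equiv.swap_apply_self _ _ _⟩
        simp only [Set.mem_Icc] at hk ⊢
        rw [Equiv.swap_apply_def]; split_ifs <;> omega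
    exact this.comp h.bij

theorem IsFilling.exists_box {n : ℕ} {D : Set (ℕ × ℕ)} {T : ℕ × ℕ → ℕ} (h : IsFilling n D T)
    {i : ℕ} (h1 : 1 ≤ i) (h2 : i ≤ n) : ∃ x, x ∈ D ∧ T x = i := by
  obtain ⟨x, hx, hx'⟩ := h.bij.surjOn (show i ∈ Set.Icc 1 n from ⟨h1, h2⟩)
  exact ⟨x, hx, hx'⟩

/-- The box containing the entry `i`. -/
def boxOf (D : Set (ℕ × ℕ)) (T : ℕ × ℕ → ℕ) (i : ℕ) : ℕ × ℕ := Function.invFunOn T D i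

theorem IsFilling.boxOf_spec {n : ℕ} {D : Set (ℕ × ℕ)} {T : ℕ × ℕ → ℕ} (h : IsFilling n D T)
    {i : ℕ} (h1 : 1 ≤ i) (h2 : i ≤ n) : boxOf D T i ∈ D ∧ T (boxOf D T i) = i :=
  Function.invFunOn_pos (h.exists_box h1 h2)

theorem IsFilling.boxOf_eq {n : ℕ} {D : Set (ℕ × ℕ)} {T : ℕ × ℕ → ℕ} (h : IsFilling n D T)
    {i : ℕ} (h1 : 1 ≤ i) (h2 : i ≤ n) {x : ℕ × ℕ} (hx : x ∈ D) (hT : T x = i) :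
    x = boxOf D T i :=
  h.bij.injOn hx (h.boxOf_spec h1 h2).1 (by rw [hT, (h.boxOf_spec h1 h2).2])

theorem IsFilling.boxOf_swap {n : ℕ} {D : Set (ℕ × ℕ)} {T : ℕ × ℕ → ℕ} (h : IsFilling n D T)
    {i : ℕ} (h1 : 1 ≤ i) (h2 : i < n) {j : ℕ} (hj : 1 ≤ j) (hj' : j ≤ n) :
    boxOf D (swapEntries i T) j = boxOf D T (Equiv.swap i (i + 1) j) := by
  have r : 1 ≤ Equiv.swap i (i + 1) j ∧ Equiv.swap i (i + 1) j ≤ n := by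
    rw [Equiv.swap_apply_def]; split_ifs <;> omega
  have e := h.boxOf_spec r.1 r.2
  refine ((h.swap h1 h2).boxOf_eq hj hj' e.1 ?_).symm
  simp only [swapEntries, e.2, Equiv.swap_apply_self]

theorem IsFilling.ext {n : ℕ} {D : Set (ℕ × ℕ)} {T T' : ℕ × ℕ → ℕ} (h : IsFilling n D T)
    (h' : IsFilling n D T') (e : ∀ j, 1 ≤ j → j ≤ n → boxOf D T j = boxOf D T' j) : T = T' := by
  funext x
  by_cases hx : x ∈ D
  · have r := h.bij.mapsTo hx
    have e1 := h.boxOf_eq r.1 r.2 hx rfl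
    have e2 := h'.boxOf_spec r.1 r.2
    rw [← e _ r.1 r.2, ← e1] at e2
    exact e2.2.symm
  · rw [h.zero x hx, h'.zero x hx]

theorem swap_lt {i a b : ℕ} (h : a < b) (hab : ¬ (a = i ∧ b = i + 1)) :
    Equiv.swap i (i + 1) a < Equiv.swap i (i + 1) b := by
  simp only [Equiv.swap_apply_def]; split_ifs <;> omega

theorem SRT.height_lt {n : ℕ} {a : GenComp n} {x y : ℕ × ℕ}
    (hy : y ∈ boxes a.parts) (h1 : x.1 = y.1) (h2 : x.2 < y.2) :
    a.height y < a.height x := by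
  have hy' : y.2 < a.parts.getD y.1 0 := hy
  simp only [GenComp.height, h1]
  omega

theorem SRT.swap_isSRT {n : ℕ} {a : GenComp n} (T : SRT a) {i : ℕ} (h1 : 1 ≤ i) (h2 : i < n)
    {x y : ℕ × ℕ} (hx : x ∈ boxes a.parts) (hy : y ∈ boxes a.parts) (hTx : T.entry x = i)
    (hTy : T.entry y = i + 1) (hlt : a.height x < a.height y) : IsSRT a (swapEntries i T.entry) := by
  refine ⟨T.2.filling.swap h1 h2, ?_, ?_⟩
  · intro u hu v hv huv huv'
    refine swap_lt (T.2.row u hu v hv huv huv') ?_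
    rintro ⟨e1, e2⟩
    have c1 := T.2.filling.bij.injOn hu hx (e1.trans hTx.symm)
    have c2 := T.2.filling.bij.injOn hv hy (e2.trans hTy.symm)
    subst c1 c2
    omega
  · intro u hu v hv huv huv'
    refine swap_lt (T.2.col u hu v hv huv huv') ?_
    rintro ⟨e1, e2⟩
    have c1 := T.2.filling.bij.injOn hu hx (e1.trans hTx.symm)
    have c2 := T.2.filling.bij.injOn hv hy (e2.trans hTy.symm)
    subst c1 c2
    have := SRT.height_lt (a := a) hv huv huv'
    omega

theorem SIT.swap_isSIT {n : ℕ} {α : Composition n} (T : SIT α) {i : ℕ} (h1 : 1 ≤ i) (h2 : i < n)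
    {x y : ℕ × ℕ} (hx : x ∈ boxes α.blocks) (hy : y ∈ boxes α.blocks) (hTx : T.entry x = i)
    (hTy : T.entry y = i + 1) (hlt : x.1 < y.1) (hc : ¬ (x.2 = 0 ∧ y.2 = 0)) :
    IsSIT α (swapEntries i T.entry) := by
  refine ⟨T.2.filling.swap h1 h2, ?_, ?_⟩
  · intro u hu v hv huv huv'
    refine swap_lt (T.2.row u hu v hv huv huv') ?_
    rintro ⟨e1, e2⟩
    have c1 := T.2.filling.bij.injOn hu hx (e1.trans hTx.symm)
    have c2 := T.2.filling.bij.injOn hv hy (e2.trans hTy.symm)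
    subst c1 c2
    omega
  · intro u hu v hv hu0 hv0 huv'
    refine swap_lt (T.2.col u hu v hv hu0 hv0 huv') ?_
    rintro ⟨e1, e2⟩
    have c1 := T.2.filling.bij.injOn hu hx (e1.trans hTx.symm)
    have c2 := T.2.filling.bij.injOn hv hy (e2.trans hTy.symm)
    subst c1 c2
    exact hc ⟨hu0, hv0⟩

theorem SRT.isDes_iff {n : ℕ} {a : GenComp n} (T : SRT a) {i : ℕ} (h1 : 1 ≤ i) (h2 : i < n) :
    T.IsDes i ↔ a.height (boxOf (boxes a.parts) T.entry i) ≤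
      a.height (boxOf (boxes a.parts) T.entry (i + 1)) := by
  have f := T.2.filling
  constructor
  · rintro ⟨x, hx, y, hy, ex, ey, h⟩
    rwa [f.boxOf_eq h1 h2.le hx ex, f.boxOf_eq (by omega) h2 hy ey] at h
  · intro h
    have a1 := f.boxOf_spec h1 h2.le
    have a2 := f.boxOf_spec (i := i + 1) (by omega) h2
    exact ⟨_, a1.1, _, a2.1, a1.2, a2.2, h⟩

theorem SRT.sameRow_iff {n : ℕ} {a : GenComp n} (T : SRT a) {i : ℕ} (h1 : 1 ≤ i) (h2 : i < n) :
    T.SameRow i ↔ a.height (boxOf (boxes a.parts) T.entry i) =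
      a.height (boxOf (boxes a.parts) T.entry (i + 1)) := by
  have f := T.2.filling
  constructor
  · rintro ⟨x, hx, y, hy, ex, ey, h⟩
    rwa [f.boxOf_eq h1 h2.le hx ex, f.boxOf_eq (by omega) h2 hy ey] at h
  · intro h
    have a1 := f.boxOf_spec h1 h2.le
    have a2 := f.boxOf_spec (i := i + 1) (by omega) h2
    exact ⟨_, a1.1, _, a2.1, a1.2, a2.2, h⟩

theorem SIT.isDes_iff {n : ℕ} {α : Composition n} (T : SIT α) {i : ℕ} (h1 : 1 ≤ i) (h2 : i < n) :
    T.IsDes i ↔ (boxOf (boxes α.blocks) T.entry i).1 < (boxOf (boxes α.blocks) T.entry (i + 1)).1 := by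
  have f := T.2.filling
  constructor
  · rintro ⟨x, hx, y, hy, ex, ey, h⟩
    rwa [f.boxOf_eq h1 h2.le hx ex, f.boxOf_eq (by omega) h2 hy ey] at h
  · intro h
    have a1 := f.boxOf_spec h1 h2.le
    have a2 := f.boxOf_spec (i := i + 1) (by omega) h2
    exact ⟨_, a1.1, _, a2.1, a1.2, a2.2, h⟩

theorem SIT.firstCol_iff {n : ℕ} {α : Composition n} (T : SIT α) {i : ℕ} (h1 : 1 ≤ i)
    (h2 : i < n) :
    T.FirstCol i ↔ (boxOf (boxes α.blocks) T.entry i).2 = 0 ∧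
      (boxOf (boxes α.blocks) T.entry (i + 1)).2 = 0 := by
  have f := T.2.filling
  constructor
  · rintro ⟨x, hx, y, hy, ex, ey, h⟩
    rwa [f.boxOf_eq h1 h2.le hx ex, f.boxOf_eq (by omega) h2 hy ey] at h
  · intro h
    have a1 := f.boxOf_spec h1 h2.le
    have a2 := f.boxOf_spec (i := i + 1) (by omega) h2
    exact ⟨_, a1.1, _, a2.1, a1.2, a2.2, h⟩

theorem SRT.op_single {n : ℕ} {a : GenComp n} (i : ℕ) (T : SRT a) :
    SRT.op a i (Finsupp.single T 1) = SRT.act i T := by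
  simp [SRT.op]

theorem SIT.op_single {n : ℕ} {α : Composition n} (i : ℕ) (T : SIT α) :
    SIT.op α i (Finsupp.single T 1) = SIT.act i T := by
  simp [SIT.op]

open Classical in
/-- The action on standard ribbon tableaux, in terms of boxes. -/
def SRT.moves {n : ℕ} (a : GenComp n) : Moves n (SRT a) (ℕ × ℕ) where
  pos T := boxOf (boxes a.parts) T.entry
  sw x y := a.height x < a.height y
  kill x y := a.height x = a.height y
  s i T := if h : IsSRT a (swapEntries i T.entry) then ⟨_, h⟩ else T
  A := SRT.op a
  inj T T' h := SRT.ext (T.2.filling.ext T'.2.filling h)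
  hs i T h1 h2 h j hj hj' := by
    have a1 := T.2.filling.boxOf_spec h1 h2.le
    have a2 := T.2.filling.boxOf_spec (i := i + 1) (by omega) h2
    rw [dif_pos (T.swap_isSRT h1 h2 a1.1 a2.1 a1.2 a2.2 h)]
    exact T.2.filling.boxOf_swap h1 h2 hj hj'
  hsw i T h1 h2 h := by
    have a1 := T.2.filling.boxOf_spec h1 h2.le
    have a2 := T.2.filling.boxOf_spec (i := i + 1) (by omega) h2
    have v := T.swap_isSRT h1 h2 a1.1 a2.1 a1.2 a2.2 h
    rw [SRT.op_single, SRT.act, if_neg (not_not.2 ((T.isDes_iff h1 h2).2 h.le)),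
      if_neg (fun c => h.ne ((T.sameRow_iff h1 h2).1 c)), SRT.vec, dif_pos v, dif_pos v]
  hkill i T h1 h2 h h' := by
    rw [SRT.op_single, SRT.act, if_neg (not_not.2 ((T.isDes_iff h1 h2).2 h'.le)),
      if_pos ((T.sameRow_iff h1 h2).2 h')]
  hfix i T h1 h2 h h' := by
    rw [SRT.op_single, SRT.act, if_pos]
    rw [T.isDes_iff h1 h2]
    omega
  asymm x y h := by constructor <;> omega
  braid := braid_ribbon a.height

open Classical in
/-- The action on standard immaculate tableaux, in terms of boxes. -/
def SIT.moves {n : ℕ} (α : Composition n) : Moves n (SIT α) (ℕ × ℕ) where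
  pos T := boxOf (boxes α.blocks) T.entry
  sw x y := x.1 < y.1 ∧ ¬ (x.2 = 0 ∧ y.2 = 0)
  kill x y := x.1 < y.1 ∧ x.2 = 0 ∧ y.2 = 0
  s i T := if h : IsSIT α (swapEntries i T.entry) then ⟨_, h⟩ else T
  A := SIT.op α
  inj T T' h := SIT.ext (T.2.filling.ext T'.2.filling h)
  hs i T h1 h2 h j hj hj' := by
    have a1 := T.2.filling.boxOf_spec h1 h2.le
    have a2 := T.2.filling.boxOf_spec (i := i + 1) (by omega) h2
    rw [dif_pos (T.swap_isSIT h1 h2 a1.1 a2.1 a1.2 a2.2 h.1 h.2)]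
    exact T.2.filling.boxOf_swap h1 h2 hj hj'
  hsw i T h1 h2 h := by
    have a1 := T.2.filling.boxOf_spec h1 h2.le
    have a2 := T.2.filling.boxOf_spec (i := i + 1) (by omega) h2
    have v := T.swap_isSIT h1 h2 a1.1 a2.1 a1.2 a2.2 h.1 h.2
    rw [SIT.op_single, SIT.act, if_neg (not_not.2 ((T.isDes_iff h1 h2).2 h.1)),
      if_neg (fun c => h.2 ((T.firstCol_iff h1 h2).1 c)), SIT.vec, dif_pos v, dif_pos v]
  hkill i T h1 h2 h h' := by
    rw [SIT.op_single, SIT.act, if_neg (not_not.2 ((T.isDes_iff h1 h2).2 h'.1)),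
      if_pos ((T.firstCol_iff h1 h2).2 h'.2)]
  hfix i T h1 h2 h h' := by
    rw [SIT.op_single, SIT.act, if_pos]
    rw [T.isDes_iff h1 h2]
    tauto
  asymm x y h := by constructor <;> omega
  braid := braid_imm Prod.fst fun x => x.2 = 0

/-! ### The modules -/

/-- The module `P_𝛂`: the `ℂ`-span of the standard ribbon tableaux of shape `𝛂`. -/
def P {n : ℕ} (a : GenComp n) : Type := SRT a →₀ ℂ

instance {n : ℕ} (a : GenComp n) : AddCommGroup (P a) :=
  inferInstanceAs (AddCommGroup (SRT a →₀ ℂ))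

instance {n : ℕ} (a : GenComp n) : Module ℂ (P a) :=
  inferInstanceAs (Module ℂ (SRT a →₀ ℂ))

instance {n : ℕ} (a : GenComp n) : Module (H n) (P a) :=
  Module.compHom (SRT a →₀ ℂ) (SRT.moves a).toRep.toRingHom

/-- The module `V_α`: the `ℂ`-span of the standard immaculate tableaux of shape `α`. -/
def V {n : ℕ} (α : Composition n) : Type := SIT α →₀ ℂ

instance {n : ℕ} (α : Composition n) : AddCommGroup (V α) :=
  inferInstanceAs (AddCommGroup (SIT α →₀ ℂ))

instance {n : ℕ} (α : Composition n) : Module ℂ (V α) :=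
  inferInstanceAs (Module ℂ (SIT α →₀ ℂ))

instance {n : ℕ} (α : Composition n) : Module (H n) (V α) :=
  Module.compHom (SIT α →₀ ℂ) (SIT.moves α).toRep.toRingHom

/-- The set of the proper partial sums of `β`. -/
def partialSums {n : ℕ} (β : Composition n) : Set ℕ :=
  {m | ∃ k, 0 < k ∧ k < β.length ∧ m = β.sizeUpTo k}

/-- The scalar by which `π_i` acts on `F_β`. -/
def scal {n : ℕ} (β : Composition n) (i : ℕ) : ℂ :=
  open Classical in if i ∈ partialSums β then 0 else 1

/-- The simple module `F_β`: a one-dimensional space on which `π_i` acts by `0` if `i` is a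
partial sum of `β` and by `1` otherwise. -/
def F {n : ℕ} (_β : Composition n) : Type := ℂ

instance {n : ℕ} (β : Composition n) : AddCommGroup (F β) := inferInstanceAs (AddCommGroup ℂ)

instance {n : ℕ} (β : Composition n) : Module ℂ (F β) := inferInstanceAs (Module ℂ ℂ)

theorem scal_mul_self {n : ℕ} (β : Composition n) (i : ℕ) : scal β i * scal β i = scal β i := by
  unfold scal; split_ifs <;> simp

/-- The representation on `F_β`. -/
def F.toRep {n : ℕ} (β : Composition n) : H n →ₐ[ℂ] Module.End ℂ ℂ :=
  rep (fun i : Fin (n - 1) => algebraMap ℂ (Module.End ℂ ℂ) (scal β (i + 1)))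
    (fun i => by rw [← map_mul, scal_mul_self])
    (fun i j _ => by
      rw [← map_mul, ← map_mul, ← map_mul, ← map_mul]
      congr 1
      rw [mul_right_comm, scal_mul_self, mul_right_comm, scal_mul_self, mul_comm])
    (fun i j _ => by rw [← map_mul, ← map_mul, mul_comm])

instance {n : ℕ} (β : Composition n) : Module (H n) (F β) :=
  Module.compHom ℂ (F.toRep β).toRingHom

/-- On `P_𝛂` the generators act by the tableau rule. -/
theorem gen_smul_P {n : ℕ} (a : GenComp n) (i : Fin (n - 1)) (T : SRT a) :
    (gen i • (show P a from Finsupp.single T 1) : P a) = SRT.act (i + 1) T := by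
  have : (gen i • (show P a from Finsupp.single T 1) : P a) =
      (SRT.moves a).toRep (gen i) (Finsupp.single T 1) := rfl
  rw [this, Moves.toRep, rep_gen]
  exact SRT.op_single _ _

/-- On `V_α` the generators act by the tableau rule. -/
theorem gen_smul_V {n : ℕ} (α : Composition n) (i : Fin (n - 1)) (T : SIT α) :
    (gen i • (show V α from Finsupp.single T 1) : V α) = SIT.act (i + 1) T := by
  have : (gen i • (show V α from Finsupp.single T 1) : V α) =
      (SIT.moves α).toRep (gen i) (Finsupp.single T 1) := rfl
  rw [this, Moves.toRep, rep_gen]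
  exact SIT.op_single _ _

/-- On `F_β` the generators act by the scalars above. -/
theorem gen_smul_F {n : ℕ} (β : Composition n) (i : Fin (n - 1)) (v : F β) :
    gen i • v = scal β (i + 1) • v := by
  have : gen i • v = F.toRep β (gen i) v := rfl
  rw [this, F.toRep, rep_gen]
  rfl

/-! ### The maps -/

/-- The `ℂ`-linear map `Φ : P_α → V_α`. It sends a standard ribbon tableau `T` to the filling of
the composition diagram whose `p`-th row is the `p`-th column of `T` if this is a standard
immaculate tableau, and to `0` otherwise. -/
def Phi {n : ℕ} (α : Composition n) : P (GenComp.single α) →ₗ[ℂ] V α :=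
  Finsupp.linearCombination ℂ fun T : SRT (GenComp.single α) => (SIT.vec α T.entry : V α)

/-- The set `I(α)` of the indices `i` such that `i + 1` is the index of a part different from `1`. -/
def calI {n : ℕ} (α : Composition n) : Set ℕ :=
  {i | i + 1 < α.length ∧ α.blocks.getD (i + 1) 0 ≠ 1}

/-- The two summands of `𝛂^{(i)}`. -/
def balLists {n : ℕ} (α : Composition n) (i : ℕ) : List (List ℕ) :=
  [α.blocks.take i ++ [α.blocks.getD i 0 + 1, α.blocks.getD (i + 1) 0 - 1],
    α.blocks.drop (i + 2)]

theorem blocks_split {n : ℕ} (α : Composition n) (i : ℕ) (h : i + 1 < α.length) :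
    α.blocks = α.blocks.take i ++ (α.blocks.getD i 0 :: α.blocks.getD (i + 1) 0 ::
      α.blocks.drop (i + 2)) := by
  have h0 : i < α.blocks.length := by have : i + 1 < α.blocks.length := h; omega
  rw [List.getD_eq_getElem _ _ h0, List.getD_eq_getElem _ _ h, ← List.drop_eq_getElem_cons h,
    ← List.drop_eq_getElem_cons h0, List.take_append_drop]

/-- The generalized composition
`𝛂^{(i)} = (α_1, …, α_{i-1}, α_i + 1, α_{i+1} - 1) ⊕ (α_{i+2}, …, α_ℓ)` (in the usual numbering
of parts from `1`); if the second summand is empty, it is absent. -/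
def bal {n : ℕ} (α : Composition n) (i : calI α) : GenComp n :=
  GenComp.ofLists (balLists α i)
    (by
      obtain ⟨i, h, h'⟩ := i
      have hp : 0 < α.blocks.getD (i + 1) 0 := by
        rw [List.getD_eq_getElem _ _ h]; exact α.blocks_pos' _ h
      intro a ha
      simp only [balLists, List.flatten_cons, List.flatten_nil, List.append_nil, List.mem_append,
        List.mem_cons, List.not_mem_nil, or_false] at ha
      rcases ha with (ha | ha | ha) | ha
      · exact α.blocks_pos (List.mem_of_mem_take ha)
      · omega
      · omega
      · exact α.blocks_pos (List.mem_of_mem_drop ha))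
    (by
      obtain ⟨i, h, h'⟩ := i
      have hp : 0 < α.blocks.getD (i + 1) 0 := by
        rw [List.getD_eq_getElem _ _ h]; exact α.blocks_pos' _ h
      have e := congrArg List.sum (blocks_split α i h)
      rw [α.blocks_sum] at e
      simp only [List.sum_append, List.sum_cons] at e
      simp only [balLists, List.flatten_cons, List.flatten_nil, List.append_nil, List.sum_append,
        List.sum_cons, List.sum_nil]
      omega)

/-- The set of entries of column `p` of a ribbon tableau `T` with column lengths `c`. -/
def column (c : List ℕ) (T : ℕ × ℕ → ℕ) (p : ℕ) : Finset ℕ :=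
  (Finset.range (c.getD p 0)).image fun q => T (p, q)

/-- The set of entries of column `p` of `L(τ)`: the top entry of column `i` of `τ` is moved to
column `i + 1`. -/
def columnL (c : List ℕ) (τ : ℕ × ℕ → ℕ) (i p : ℕ) : Finset ℕ :=
  if p = i then column c τ i \ {τ (i, 0)}
  else if p = i + 1 then column c τ (i + 1) ∪ {τ (i, 0)}
  else column c τ p

/-- The filling `L(τ)`, whose columns are listed increasingly from top to bottom. -/
def fillingL (c : List ℕ) (τ : ℕ × ℕ → ℕ) (i : ℕ) : ℕ × ℕ → ℕ :=
  fun x => ((columnL c τ i x.1).sort (· ≤ ·)).getD x.2 0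

/-- The `ℂ`-linear map `∂₁^{(i)}`: a tableau `τ` goes to `L(τ)` if this is a standard ribbon
tableau of shape `α`, and to `0` otherwise. -/
def partialAt {n : ℕ} (α : Composition n) (i : calI α) :
    P (bal α i) →ₗ[ℂ] P (GenComp.single α) :=
  Finsupp.linearCombination ℂ fun τ : SRT (bal α i) =>
    (SRT.vec (GenComp.single α) (fillingL (bal α i).parts τ.entry i) : P (GenComp.single α))

open Classical in
/-- The `ℂ`-linear map `∂₁ = ∑ ∂₁^{(i)}` on the direct sum of the modules `P_{𝛂^{(i)}}`. -/
def partialOne {n : ℕ} (α : Composition n) :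
    (⨁ i : calI α, P (bal α i)) →ₗ[ℂ] P (GenComp.single α) :=
  DirectSum.toModule ℂ (calI α) (P (GenComp.single α)) (partialAt α)

/-- `J(α)`, the union of the sets `[𝛂^{(i)}]`. -/
def calJ {n : ℕ} (α : Composition n) : Set (Composition n) := ⋃ i : calI α, (bal α i).bracket

/-! ### Projective covers and minimal projective presentations -/

/-- Essential epimorphisms between finitely generated modules. -/
structure IsEssentialEpi {R A B : Type} [Ring R] [AddCommGroup A] [Module R A] [AddCommGroup B]
    [Module R B] (f : A →ₗ[R] B) : Prop where
  finite_source : Module.Finite R A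
  finite_target : Module.Finite R B
  surjective : Function.Surjective f
  essential : ∀ (X : Type) [AddCommGroup X] [Module R X] (g : X →ₗ[R] A),
    Function.Surjective (f ∘ₗ g) → Function.Surjective g

/-- Projective covers. -/
structure IsProjectiveCover {R A B : Type} [Ring R] [AddCommGroup A] [Module R A]
    [AddCommGroup B] [Module R B] (f : A →ₗ[R] B) : Prop where
  projective : Module.Projective R A
  essentialEpi : IsEssentialEpi f

/-- `P₁ → P₀ → A → 0` is a minimal projective presentation: it is exact, `ε` is a projective cover
of `A`, and `∂` is a projective cover of `Ω(A) = ker ε`. -/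
structure IsMinimalProjectivePresentation {R P₁ P₀ A : Type} [Ring R] [AddCommGroup P₁]
    [Module R P₁] [AddCommGroup P₀] [Module R P₀] [AddCommGroup A] [Module R A]
    (d : P₁ →ₗ[R] P₀) (ε : P₀ →ₗ[R] A) : Prop where
  surjective : Function.Surjective ε
  exact : LinearMap.range d = LinearMap.ker ε
  cover : IsProjectiveCover ε
  syzygy_cover : IsProjectiveCover
    (d.codRestrict (LinearMap.ker ε) fun x => exact ▸ LinearMap.mem_range_self d x)

/-- The complex vector space `Ext¹` of two modules over `H_n(0)`. -/
abbrev Ext1 (n : ℕ) (A B : Type) [AddCommGroup A] [Module (H n) A] [AddCommGroup B]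
    [Module (H n) B] : Type :=
  CategoryTheory.Abelian.Ext (ModuleCat.of (H n) A) (ModuleCat.of (H n) B) 1

end ZeroHecke

end

/-!
A filling with increasing columns is the same as the word that lists the columns of the entries
`1, …, n`, and a standard ribbon tableau is a word in which, for any two consecutive columns `p`,
`p + 1` of one component, some letter `p` precedes some letter `p + 1` (`isSRT_fillW`). On words all
generators act by bubble sort: `π_i` turns an ascent at the positions `i`, `i + 1` into a descent
(`gen_smul_vecP`, `gen_smul_vecV`), and `Φ` is the identity on words or zero. The map `L` raises the
first letter `i` to `i + 1`, which commutes with bubble sort (`bub_raise`); hence `Φ` and `∂₁` are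
homomorphisms. A ribbon tableau is not immaculate exactly if it is of the form `L(τ)` for some `τ`
(`exists_raise`, `vecV_raise`), and this is exactness.

*Projectivity.* The regular module has the basis of all permutations with the same bubble sort
action, by a count of normal forms (`permEquiv`). Sending a tableau to the signed sum of the
permutations obtained from its standardization by permuting the entries of each of its rows embeds
`P_𝛂` into the regular module. These vectors are part of a triangular basis, in which the other
vectors are antisymmetrized along the ascending runs of their permutations, and the span of those
other vectors is a submodule; so `P_𝛂` is a direct summand (`project_gen_smul`).

*Essential covers.* Every proper submodule is contained in the kernel of a character, a linear form
on which the generators act by scalars (`exists_character_of_ne_top`). Hence a surjection is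
essential as soon as the characters of its source vanish on its kernel
(`isEssentialEpi_of_character`). A character of `P_𝛂` on which the generators act by scalars `χ` is
determined by its value at the sorted word; if this is nonzero, then `χ` vanishes at the ends of the
columns at which the ribbon is connected, `χ` is `1` at all places that are not ends of columns, and
the character is supported on the tableaux that do not cross the zeros of `χ`
(`WordChar.chi_eq_zero`, `WordChar.chi_eq_one`, `WordChar.noCross`). For `P_α` these tableaux are
immaculate. For `P_{𝛂^{(i)}}` they are recovered, together with `i`, from `L(τ)`
(`eq_of_raise_eq`). So the characters vanish on `ker Φ` and on `ker ∂₁`.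

*Extensions.* As the homomorphisms `P_α → F_β` vanish on `Ω(V_α) = ker Φ`, the space
`Ext¹(V_α, F_β)` is `Hom(Ω(V_α), F_β)`, and as the characters of the source of `∂₁` vanish on
`ker ∂₁`, this is the sum of the spaces `Hom(P_{𝛂^{(i)}}, F_β)`. The latter is one-dimensional or
zero according as `β ∈ [𝛂^{(i)}]` or not (`mem_bracket_bal`), and it is nonzero for at most one `i`
(`bal_character_unique`).
-/

open scoped DirectSum

noncomputable section

namespace ZeroHecke

variable {n : ℕ}

/-! ### Words and bubble sort -/

/-- The position `i` as an element of `Fin n`. -/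
def lo (i : Fin (n - 1)) : Fin n := ⟨i, by omega⟩

/-- The position `i + 1` as an element of `Fin n`. -/
def hi (i : Fin (n - 1)) : Fin n := ⟨i + 1, by omega⟩

/-- The transposition of the positions `i` and `i + 1`. -/
def adj (i : Fin (n - 1)) : Equiv.Perm (Fin n) := Equiv.swap (lo i) (hi i)

@[simp] theorem lo_val (i : Fin (n - 1)) : (lo i : ℕ) = i := rfl

@[simp] theorem hi_val (i : Fin (n - 1)) : (hi i : ℕ) = i + 1 := rfl

theorem lo_lt_hi (i : Fin (n - 1)) : lo i < hi i := by
  rw [Fin.lt_def]; simp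

@[simp] theorem adj_lo (i : Fin (n - 1)) : adj i (lo i) = hi i := Equiv.swap_apply_left _ _

@[simp] theorem adj_hi (i : Fin (n - 1)) : adj i (hi i) = lo i := Equiv.swap_apply_right _ _

theorem adj_of_ne {i : Fin (n - 1)} {k : Fin n} (h1 : k ≠ lo i) (h2 : k ≠ hi i) : adj i k = k :=
  Equiv.swap_apply_of_ne_of_ne h1 h2

@[simp] theorem adj_adj (i : Fin (n - 1)) (k : Fin n) : adj i (adj i k) = k :=
  Equiv.swap_apply_self _ _ _

@[simp] theorem comp_adj_adj {X : Type*} (w : Fin n → X) (i : Fin (n - 1)) :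
    (w ∘ adj i) ∘ adj i = w := by
  funext k; exact congrArg w (adj_adj i k)

/-- The transposition `adj i` preserves the order of all pairs other than `(i, i + 1)`. -/
theorem adj_lt_adj {i : Fin (n - 1)} {j k : Fin n} (h : j < k) (hjk : ¬ (j = lo i ∧ k = hi i)) :
    adj i j < adj i k := by
  simp only [adj, Equiv.swap_apply_def, Fin.ext_iff, Fin.lt_def, lo_val, hi_val] at *
  split_ifs <;> (try simp only [lo_val, hi_val]) <;> omega

/-- The action of `π_{i+1}` on words: an ascent at `i` becomes a descent. -/
def bub (i : Fin (n - 1)) (w : Fin n → ℕ) : Fin n → ℕ :=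
  if w (hi i) ≤ w (lo i) then w else w ∘ adj i

theorem bub_of_le {i : Fin (n - 1)} {w : Fin n → ℕ} (h : w (hi i) ≤ w (lo i)) : bub i w = w :=
  if_pos h

theorem bub_of_lt {i : Fin (n - 1)} {w : Fin n → ℕ} (h : w (lo i) < w (hi i)) :
    bub i w = w ∘ adj i := if_neg h.not_ge

theorem bub_comp_adj {i : Fin (n - 1)} {w : Fin n → ℕ} (h : w (hi i) < w (lo i)) :
    bub i (w ∘ adj i) = w := by
  rw [bub_of_lt (by simpa using h), comp_adj_adj]

theorem bub_bub (i : Fin (n - 1)) (w : Fin n → ℕ) : bub i (bub i w) = bub i w := by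
  rcases le_or_gt (w (hi i)) (w (lo i)) with h | h
  · rw [bub_of_le h, bub_of_le h]
  · rw [bub_of_lt h, bub_of_le (by simpa using h.le)]

theorem monotone_of_lo_le_hi {w : Fin n → ℕ} (h : ∀ i : Fin (n - 1), w (lo i) ≤ w (hi i)) :
    Monotone w := by
  rcases n with _ | n
  · exact fun a => a.elim0
  · exact Fin.monotone_iff_le_succ.2 fun i => h i

/-- Every word is obtained from a weakly increasing one by turning ascents into descents. -/
theorem word_induction {Pr : (Fin n → ℕ) → Prop} (base : ∀ w, Monotone w → Pr w)
    (step : ∀ w (i : Fin (n - 1)), w (hi i) < w (lo i) → Pr (w ∘ adj i) → Pr w)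
    (w : Fin n → ℕ) : Pr w := by
  suffices ∀ w : Lex (Fin n → ℕ), Pr (ofLex w) from this (toLex w)
  intro w
  induction w using WellFoundedLT.induction with
  | ind w ih =>
    by_cases h : ∀ i : Fin (n - 1), ofLex w (lo i) ≤ ofLex w (hi i)
    · exact base _ (monotone_of_lo_le_hi h)
    · push Not at h
      obtain ⟨i, hw⟩ := h
      refine step _ i hw (ih (toLex (ofLex w ∘ adj i)) ⟨lo i, fun j hj => ?_, ?_⟩)
      · have h1 : j ≠ lo i := hj.ne
        have h2 : j ≠ hi i := (hj.trans (lo_lt_hi i)).ne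
        show ofLex w (adj i j) = _
        rw [adj_of_ne h1 h2]; rfl
      · show ofLex w (adj i (lo i)) < _
        rw [adj_lo]; exact hw

/-! ### Words of given content -/

/-- The word `w` contains the letter `p` exactly `ct p` times. -/
def Content (ct : ℕ → ℕ) (w : Fin n → ℕ) : Prop :=
  ∀ p, (Finset.univ.filter fun k => w k = p).card = ct p

/-- The number of letters less than `p` in words of content `ct`. -/
def psum (ct : ℕ → ℕ) (p : ℕ) : ℕ := ∑ r ∈ Finset.range p, ct r

/-- Some letter `p` occurs before some letter `p + 1`. -/
def Linked (w : Fin n → ℕ) (p : ℕ) : Prop := ∃ j k, j < k ∧ w j = p ∧ w k = p + 1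

/-- The first `psum ct p` letters are less than `p`. -/
def NoCross (ct : ℕ → ℕ) (w : Fin n → ℕ) (p : ℕ) : Prop :=
  ∀ k : Fin n, (k : ℕ) < psum ct p → w k < p

variable {ct : ℕ → ℕ} {w : Fin n → ℕ}

theorem psum_succ (ct : ℕ → ℕ) (p : ℕ) : psum ct (p + 1) = psum ct p + ct p :=
  Finset.sum_range_succ _ _

theorem psum_zero (ct : ℕ → ℕ) : psum ct 0 = 0 := rfl

theorem psum_mono (ct : ℕ → ℕ) : Monotone (psum ct) :=
  monotone_nat_of_le_succ fun p => by rw [psum_succ]; omega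

theorem Content.comp_perm (h : Content ct w) (s : Equiv.Perm (Fin n)) : Content ct (w ∘ s) := by
  intro p
  rw [← h p]
  refine Finset.card_bij (fun k _ => s k) ?_ ?_ ?_
  · intro k hk; simpa using hk
  · intro a _ b _ hab; exact s.injective hab
  · intro k hk; exact ⟨s.symm k, by simpa using hk, by simp⟩

theorem Content.bub (h : Content ct w) (i : Fin (n - 1)) : Content ct (bub i w) := by
  unfold ZeroHecke.bub; split_ifs
  exacts [h, h.comp_perm _]

theorem Content.card_lt (h : Content ct w) (p : ℕ) :
    (Finset.univ.filter fun k => w k < p).card = psum ct p := by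
  induction p with
  | zero => simp [psum]
  | succ p ih =>
    rw [psum_succ, ← ih, ← h p, ← Finset.card_union_of_disjoint]
    · congr 1; ext k; simp only [Finset.mem_filter, Finset.mem_univ, true_and, Finset.mem_union]
      omega
    · rw [Finset.disjoint_filter]; intros; omega

theorem Content.psum_le (h : Content ct w) (p : ℕ) : psum ct p ≤ n := by
  rw [← h.card_lt p]; simpa using Finset.card_le_univ (Finset.univ.filter fun k => w k < p)

theorem Content.exists_eq (h : Content ct w) {p : ℕ} (hp : 0 < ct p) : ∃ k, w k = p := by
  rw [← h p, Finset.card_pos] at hp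
  obtain ⟨k, hk⟩ := hp
  exact ⟨k, by simpa using hk⟩

theorem Content.pos (h : Content ct w) (k : Fin n) : 0 < ct (w k) := by
  rw [← h (w k), Finset.card_pos]; exact ⟨k, by simp⟩

theorem card_filter_val_lt {m : ℕ} (h : m ≤ n) :
    (Finset.univ.filter fun k : Fin n => (k : ℕ) < m).card = m := by
  rw [Fin.card_filter_val_lt]; omega

theorem NoCross.lt_iff (h : NoCross ct w p) (hw : Content ct w) (k : Fin n) :
    (k : ℕ) < psum ct p ↔ w k < p := by
  refine ⟨h k, fun hk => ?_⟩
  have e : (Finset.univ.filter fun k : Fin n => (k : ℕ) < psum ct p) =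
      Finset.univ.filter fun k => w k < p := by
    refine Finset.eq_of_subset_of_card_le (fun k hk => ?_) ?_
    · simpa using h k (by simpa using hk)
    · rw [hw.card_lt, card_filter_val_lt (hw.psum_le p)]
  have : k ∈ Finset.univ.filter fun k => w k < p := by simpa using hk
  rw [← e] at this
  simpa using this

theorem NoCross.lt (h : NoCross ct w p) (hw : Content ct w) {j k : Fin n} (hj : w j < p)
    (hk : p ≤ w k) : j < k := by
  rw [Fin.lt_def]
  have h1 := (h.lt_iff hw j).2 hj
  have h2 := mt (h.lt_iff hw k).1 hk.not_gt
  omega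

theorem noCross_of_monotone (hm : Monotone w) (hw : Content ct w) (p : ℕ) : NoCross ct w p := by
  intro k hk
  by_contra hp
  push Not at hp
  have : (Finset.univ.filter fun j => w j < p) ⊆
      Finset.univ.filter fun j : Fin n => (j : ℕ) < k := by
    intro j hj
    simp only [Finset.mem_filter, Finset.mem_univ, true_and] at hj ⊢
    by_contra hjk
    exact absurd (hm (show k ≤ j by rw [Fin.le_def]; omega)) (by omega)
  have := Finset.card_le_card this
  rw [hw.card_lt, card_filter_val_lt k.2.le] at this
  omega

theorem eq_of_noCross {w' : Fin n → ℕ} (hw : Content ct w) (hw' : Content ct w')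
    (h : ∀ p, NoCross ct w p) (h' : ∀ p, NoCross ct w' p) : w = w' := by
  funext k
  apply le_antisymm
  · have := (h' (w' k + 1)).lt_iff hw' k
    have := (h (w' k + 1)).lt_iff hw k
    omega
  · have := (h' (w k + 1)).lt_iff hw' k
    have := (h (w k + 1)).lt_iff hw k
    omega

theorem NoCross.comp_adj (h : NoCross ct w p) {i : Fin (n - 1)} (hi' : (i : ℕ) + 1 ≠ psum ct p) :
    NoCross ct (w ∘ adj i) p := by
  intro k hk
  apply h
  simp only [adj, Equiv.swap_apply_def]
  split_ifs with h1 h2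
  · subst h1; simp at hk ⊢; omega
  · subst h2; simp at hk ⊢; omega
  · exact hk

theorem NoCross.psum_ne (h : NoCross ct w p) (hw : Content ct w) {i : Fin (n - 1)}
    (hd : w (hi i) ≤ w (lo i)) : (i : ℕ) + 1 ≠ psum ct p := by
  intro e
  have h1 := (h.lt_iff hw (lo i)).1 (by simp; omega)
  have h2 := mt (h.lt_iff hw (hi i)).2 (by simp; omega)
  omega

theorem not_linked_bub {i : Fin (n - 1)} {q : ℕ} (h : ¬ Linked w q) : ¬ Linked (bub i w) q := by
  rcases le_or_gt (w (hi i)) (w (lo i)) with hd | hd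
  · rwa [bub_of_le hd]
  · rw [bub_of_lt hd]
    rintro ⟨j, k, hjk, hj, hk⟩
    refine h ⟨_, _, adj_lt_adj (i := i) hjk ?_, hj, hk⟩
    rintro ⟨rfl, rfl⟩
    simp only [Function.comp_apply, adj_lo, adj_hi] at hj hk
    omega

/-- The weakly increasing word of content `ct`. -/
theorem exists_sorted {N : ℕ} (h0 : ∀ p, psum ct p ≤ n) (hN : psum ct N = n) :
    ∃ w : Fin n → ℕ, Monotone w ∧ Content ct w := by
  have ex : ∀ k : Fin n, ∃ p, (k : ℕ) < psum ct (p + 1) := fun k =>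
    ⟨N, by have := psum_mono ct (show N ≤ N + 1 by omega); have := k.2; omega⟩
  have key : ∀ (k : Fin n) p, Nat.find (ex k) = p ↔ psum ct p ≤ k ∧ (k : ℕ) < psum ct (p + 1) := by
    intro k p
    rw [Nat.find_eq_iff]
    constructor
    · rintro ⟨h1, h2⟩
      refine ⟨?_, h1⟩
      rcases p with _ | p
      · simp [psum_zero]
      · exact not_lt.1 (h2 p (by omega))
    · rintro ⟨h1, h2⟩
      exact ⟨h2, fun m hm => not_lt.2 ((psum_mono ct (show m + 1 ≤ p by omega)).trans h1)⟩
  refine ⟨fun k => Nat.find (ex k), ?_, ?_⟩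
  · intro j k hjk
    exact Nat.find_min' _ (lt_of_le_of_lt (Fin.le_def.1 hjk) (Nat.find_spec (ex k)))
  · intro p
    simp only [key]
    have e1 := card_filter_val_lt (h0 (p + 1))
    have e2 := card_filter_val_lt (h0 p)
    have e3 : (Finset.univ.filter fun k : Fin n => (k : ℕ) < psum ct p) ∪
        (Finset.univ.filter fun k : Fin n => psum ct p ≤ k ∧ (k : ℕ) < psum ct (p + 1)) =
        Finset.univ.filter fun k : Fin n => (k : ℕ) < psum ct (p + 1) := by
      have := psum_mono ct (Nat.le_succ p)
      ext k
      simp only [Finset.mem_filter, Finset.mem_univ, true_and, Finset.mem_union]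
      simp only [Nat.succ_eq_add_one] at this
      omega
    rw [← e3, Finset.card_union_of_disjoint, e2] at e1
    · have := psum_succ ct p
      omega
    · rw [Finset.disjoint_filter]; intros; omega

/-! ### Characters on words -/

/-- A function on the words of content `ct` on which `π_{i+1}` acts by the scalar `χ (i + 1)` and
which vanishes on the words that are not linked at the places in `J`. -/
structure WordChar (ct : ℕ → ℕ) (J : Set ℕ) (χ : ℕ → ℂ) (G : (Fin n → ℕ) → ℂ) : Prop where
  smul : ∀ w, Content ct w → ∀ i : Fin (n - 1), G (bub i w) = χ (i + 1) * G w
  zero : ∀ w, Content ct w → ∀ p ∈ J, ¬ Linked w p → G w = 0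

namespace WordChar

variable {J : Set ℕ} {χ : ℕ → ℂ} {G : (Fin n → ℕ) → ℂ}

theorem descent (h : WordChar ct J χ G) (hw : Content ct w) {i : Fin (n - 1)}
    (hd : w (hi i) < w (lo i)) : G w = χ (i + 1) * G (w ∘ adj i) := by
  rw [← h.smul _ (hw.comp_perm _), bub_comp_adj hd]

theorem sorted_ne (h : WordChar ct J χ G) {w₀ : Fin n → ℕ} (hw : Content ct w) (hG : G w ≠ 0)
    (hm : Monotone w₀) (hw₀ : Content ct w₀) : G w₀ ≠ 0 := by
  induction w using word_induction with
  | base w m =>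
    rwa [← eq_of_noCross hw hw₀ (noCross_of_monotone m hw) (noCross_of_monotone hm hw₀)]
  | step w i hd ih =>
    refine ih (hw.comp_perm _) fun h0 => hG ?_
    rw [h.descent hw hd, h0, mul_zero]

theorem chi_sq (h : WordChar ct J χ G) (hw : Content ct w) (hG : G w ≠ 0) (i : Fin (n - 1)) :
    χ (i + 1) = 0 ∨ χ (i + 1) = 1 := by
  have e := h.smul _ (hw.bub i) i
  rw [bub_bub, h.smul w hw i] at e
  have : χ (i + 1) * G w * (χ (i + 1) - 1) = 0 := by linear_combination -e
  rcases mul_eq_zero.1 this with h' | h'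
  · exact Or.inl ((mul_eq_zero.1 h').resolve_right hG)
  · exact Or.inr (sub_eq_zero.1 h')

theorem chi_eq_one (h : WordChar ct J χ G) {w₀ : Fin n → ℕ} (hm : Monotone w₀)
    (hw₀ : Content ct w₀) (hG : G w₀ ≠ 0) (i : Fin (n - 1)) (hi' : ∀ p, (i : ℕ) + 1 ≠ psum ct p) :
    χ (i + 1) = 1 := by
  have e : w₀ (hi i) ≤ w₀ (lo i) := by
    by_contra hlt
    push Not at hlt
    have nc := noCross_of_monotone hm hw₀ (w₀ (hi i))
    have h1 := (nc.lt_iff hw₀ (lo i)).2 hlt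
    have h2 := mt (nc.lt_iff hw₀ (hi i)).1 (lt_irrefl _)
    apply hi' (w₀ (hi i))
    simp at h1 h2
    omega
  have := h.smul w₀ hw₀ i
  rw [bub_of_le e] at this
  have : (χ (i + 1) - 1) * G w₀ = 0 := by linear_combination -this
  exact sub_eq_zero.1 ((mul_eq_zero.1 this).resolve_right hG)

theorem noCross (h : WordChar ct J χ G) (hw : Content ct w) (hG : G w ≠ 0) {p : ℕ}
    (hp : χ (psum ct p) = 0) : NoCross ct w p := by
  induction w using word_induction with
  | base w m => exact noCross_of_monotone m hw p
  | step w i hd ih =>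
    have e := h.descent hw hd
    have h1 : (i : ℕ) + 1 ≠ psum ct p := fun h0 => hG (by rw [e, h0, hp, zero_mul])
    have h2 := ih (hw.comp_perm _) fun h0 => hG (by rw [e, h0, mul_zero])
    simpa using h2.comp_adj h1

/-- If no zero of `χ` is crossed, the value is that on the sorted word. -/
theorem eq_sorted (h : WordChar ct J χ G) {w₀ : Fin n → ℕ} (hm : Monotone w₀)
    (hw₀ : Content ct w₀) (hw : Content ct w)
    (hc : ∀ i : Fin (n - 1), χ (i + 1) ≠ 1 → ∃ p, (i : ℕ) + 1 = psum ct p ∧ NoCross ct w p) :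
    G w = G w₀ := by
  induction w using word_induction with
  | base w m =>
    rw [eq_of_noCross hw hw₀ (noCross_of_monotone m hw) (noCross_of_monotone hm hw₀)]
  | step w i hd ih =>
    have e := h.descent hw hd
    have h1 : χ (i + 1) = 1 := by
      by_contra h1
      obtain ⟨p, hp, hp'⟩ := hc i h1
      exact hp'.psum_ne hw hd.le hp
    rw [e, h1, one_mul]
    refine ih (hw.comp_perm _) fun j hj => ?_
    obtain ⟨p, hp, hp'⟩ := hc j hj
    refine ⟨p, hp, hp'.comp_adj fun e => ?_⟩
    rw [← hp, Nat.add_right_cancel_iff, ← Fin.ext_iff] at e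
    subst e
    exact hj h1

/-- Reversal of the segment `[a, b)`. -/
def revSeg {a b : ℕ} (hb : b ≤ n) (k : Fin n) : Fin n :=
  if h : a ≤ k ∧ (k : ℕ) < b then ⟨a + b - 1 - k, by omega⟩ else k

theorem revSeg_revSeg {a b : ℕ} (hb : b ≤ n) : Function.Involutive (revSeg (a := a) hb) := by
  intro k
  by_cases h : a ≤ k ∧ (k : ℕ) < b
  · have e : revSeg hb k = ⟨a + b - 1 - k, by omega⟩ := dif_pos h
    rw [e, revSeg, dif_pos (by simp; omega)]
    ext; simp; omega
  · have e : revSeg hb k = k := dif_neg h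
    rw [e, e]

/-- `χ` vanishes at the places where linking is required: otherwise the letters `p` and `p + 1`
of the sorted word could be interchanged without changing the value. -/
theorem chi_eq_zero (h : WordChar ct J χ G) {w₀ : Fin n → ℕ} (hm : Monotone w₀)
    (hw₀ : Content ct w₀) (hG : G w₀ ≠ 0) {p : ℕ} (hp : p ∈ J) (h0 : 0 < ct p)
    (h1 : 0 < ct (p + 1)) : χ (psum ct (p + 1)) = 0 := by
  by_contra hne
  have hb := hw₀.psum_le (p + 2)
  have s1 := psum_succ ct p
  have s2 : psum ct (p + 2) = _ := psum_succ ct (p + 1)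
  have nc := noCross_of_monotone hm hw₀
  let s : Equiv.Perm (Fin n) := (revSeg_revSeg (a := psum ct p) hb).toPerm
  have sv : ∀ k : Fin n, ((s k : Fin n) : ℕ) = if psum ct p ≤ k ∧ (k : ℕ) < psum ct (p + 2) then
      psum ct p + psum ct (p + 2) - 1 - k else k := by
    intro k
    show ((revSeg hb k : Fin n) : ℕ) = _
    unfold revSeg
    split_ifs <;> rfl
  have hw := hw₀.comp_perm s
  have z : G (w₀ ∘ s) = 0 := by
    refine h.zero _ hw p hp ?_
    rintro ⟨j, k, hjk, hj, hk⟩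
    simp only [Function.comp_apply] at hj hk
    have a1 := (nc p).lt_iff hw₀ (s j)
    have a2 := (nc (p + 1)).lt_iff hw₀ (s j)
    have a3 := (nc (p + 1)).lt_iff hw₀ (s k)
    have a4 := (nc (p + 2)).lt_iff hw₀ (s k)
    rw [hj] at a1 a2
    rw [hk] at a3 a4
    rw [sv] at a1 a2 a3 a4
    rw [Fin.lt_def] at hjk
    split_ifs at a1 a2 a3 a4 <;> omega
  refine hG ?_
  rw [← z]
  refine (h.eq_sorted hm hw₀ hw fun i hi' => ?_).symm
  have : ∃ q, (i : ℕ) + 1 = psum ct q := by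
    by_contra hq
    push Not at hq
    exact hi' (h.chi_eq_one hm hw₀ hG i hq)
  obtain ⟨q, hq⟩ := this
  refine ⟨q, hq, fun k hk => nc q _ ?_⟩
  have hqp : psum ct q ≠ psum ct (p + 1) := by
    intro e
    rw [← e, ← hq] at hne
    exact (h.chi_sq hw₀ hG i).elim hne hi'
  have : psum ct q ≤ psum ct p ∨ psum ct (p + 2) ≤ psum ct q := by
    rcases lt_trichotomy q (p + 1) with h' | h' | h'
    · exact Or.inl (psum_mono ct (by omega))
    · exact absurd (by rw [h']) hqp
    · exact Or.inr (psum_mono ct (by omega))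
  rw [sv]
  split_ifs <;> omega

end WordChar

open Classical in
/-- The value `1` on the words that cross no zero of `χ`, and `0` on the others. -/
def charFun (ct : ℕ → ℕ) (χ : ℕ → ℂ) (w : Fin n → ℕ) : ℂ :=
  if ∀ p, χ (psum ct p) = 0 → NoCross ct w p then 1 else 0

theorem charFun_wordChar {J : Set ℕ} {χ : ℕ → ℂ} (h01 : ∀ k, χ k = 0 ∨ χ k = 1)
    (h1 : ∀ i : Fin (n - 1), (∀ p, (i : ℕ) + 1 ≠ psum ct p) → χ (i + 1) = 1)
    (hJ : ∀ p ∈ J, 0 < ct p ∧ 0 < ct (p + 1) ∧ χ (psum ct (p + 1)) = 0) :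
    WordChar (n := n) ct J χ (charFun ct χ) := by
  constructor
  · intro w hw i
    rcases h01 (i + 1) with h0 | h0
    · have : ∃ p, (i : ℕ) + 1 = psum ct p := by
        by_contra hq
        push Not at hq
        have := h1 i hq
        rw [h0] at this
        exact zero_ne_one this
      obtain ⟨p, hp⟩ := this
      rw [h0, zero_mul, charFun, if_neg]
      intro h
      have := (h p (by rw [← hp, h0])).psum_ne (hw.bub i) (i := i)
      refine this ?_ hp
      rcases le_or_gt (w (hi i)) (w (lo i)) with hd | hd
      · rwa [bub_of_le hd]
      · rw [bub_of_lt hd]; simpa using hd.le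
    · rw [h0, one_mul]
      rcases le_or_gt (w (hi i)) (w (lo i)) with hd | hd
      · rw [bub_of_le hd]
      · rw [bub_of_lt hd]
        unfold charFun
        congr 1
        refine propext (forall₂_congr fun p hp => ?_)
        have : (i : ℕ) + 1 ≠ psum ct p := by
          intro e; rw [← e, h0] at hp; exact one_ne_zero hp
        exact ⟨fun h => by simpa using h.comp_adj this, fun h => h.comp_adj this⟩
  · intro w hw p hp hl
    obtain ⟨c0, c1, z⟩ := hJ p hp
    rw [charFun, if_neg]
    intro h
    obtain ⟨j, hj⟩ := hw.exists_eq c0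
    obtain ⟨k, hk⟩ := hw.exists_eq c1
    exact hl ⟨j, k, (h (p + 1) z).lt hw (by omega) (by omega), hj, hk⟩

theorem charFun_of_noCross {χ : ℕ → ℂ} (h : ∀ p, NoCross ct w p) : charFun ct χ w = 1 :=
  if_pos fun p _ => h p

/-! ### Words and tableaux with increasing columns -/

/-- The multiplicity function of a list of column lengths. -/
def cnt (c : List ℕ) (p : ℕ) : ℕ := c.getD p 0

/-- Fillings of the boxes of `c` by `1, …, n` with increasing columns; unlike in a standard
ribbon tableau, no condition is imposed on the rows. -/
structure IsColStd (n : ℕ) (c : List ℕ) (T : ℕ × ℕ → ℕ) : Prop where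
  filling : IsFilling n (boxes c) T
  col : ∀ x ∈ boxes c, ∀ y ∈ boxes c, x.1 = y.1 → x.2 < y.2 → T x < T y

/-- The word of a filling: its letter at `k : Fin n` is the column of the entry `k + 1`. -/
def colWord (c : List ℕ) (T : ℕ × ℕ → ℕ) (k : Fin n) : ℕ := (boxOf (boxes c) T (k + 1)).1

/-- The set of entries that the word `w` puts into column `p`. -/
def colSet (w : Fin n → ℕ) (p : ℕ) : Finset ℕ :=
  (Finset.univ.filter fun k => w k = p).image fun k : Fin n => (k : ℕ) + 1

/-- The filling with increasing columns described by the word `w`. -/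
def fillW (w : Fin n → ℕ) : ℕ × ℕ → ℕ := fun x => ((colSet w x.1).sort (· ≤ ·)).getD x.2 0

theorem getD_sort_mem {s : Finset ℕ} {q : ℕ} (h : q < s.card) :
    (s.sort (· ≤ ·)).getD q 0 ∈ s := by
  have h' : q < (s.sort (· ≤ ·)).length := by rwa [Finset.length_sort]
  rw [List.getD_eq_getElem _ _ h', ← Finset.mem_sort (· ≤ ·)]
  exact List.getElem_mem h'

theorem getD_sort_lt {s : Finset ℕ} {q q' : ℕ} (h : q < q') (h' : q' < s.card) :
    (s.sort (· ≤ ·)).getD q 0 < (s.sort (· ≤ ·)).getD q' 0 := by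
  have l' : q' < (s.sort (· ≤ ·)).length := by rwa [Finset.length_sort]
  have l : q < (s.sort (· ≤ ·)).length := h.trans l'
  rw [List.getD_eq_getElem _ _ l, List.getD_eq_getElem _ _ l']
  exact (Finset.sortedLT_sort s).getElem_lt_getElem_of_lt h

theorem getD_sort_eq {s : Finset ℕ} {f : ℕ → ℕ} (hf : ∀ q < s.card, f q ∈ s)
    (hm : ∀ q q', q < q' → q' < s.card → f q < f q') {q : ℕ} (hq : q < s.card) :
    (s.sort (· ≤ ·)).getD q 0 = f q := by
  have := Finset.orderEmbOfFin_unique (s := s) rfl (f := fun i : Fin s.card => f i)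
    (fun i => hf i i.2) (fun i j hij => hm i j hij j.2)
  have e := congrFun this ⟨q, hq⟩
  rw [Finset.orderEmbOfFin_apply] at e
  have h' : q < (s.sort (· ≤ ·)).length := by rwa [Finset.length_sort]
  rw [List.getD_eq_getElem _ _ h']
  exact e.symm

theorem getD_sort_surj {s : Finset ℕ} {x : ℕ} (hx : x ∈ s) :
    ∃ q < s.card, (s.sort (· ≤ ·)).getD q 0 = x := by
  rw [← Finset.mem_sort (· ≤ ·)] at hx
  obtain ⟨q, h, rfl⟩ := List.getElem_of_mem hx
  exact ⟨q, by rwa [Finset.length_sort] at h, List.getD_eq_getElem _ _ h⟩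

theorem mem_colSet {w : Fin n → ℕ} {p e : ℕ} :
    e ∈ colSet w p ↔ ∃ k : Fin n, w k = p ∧ e = k + 1 := by
  simp only [colSet, Finset.mem_image, Finset.mem_filter, Finset.mem_univ, true_and]
  exact exists_congr fun k => and_congr_right fun _ => eq_comm

theorem card_colSet {ct : ℕ → ℕ} {w : Fin n → ℕ} (hw : Content ct w) (p : ℕ) :
    (colSet w p).card = ct p := by
  rw [colSet, Finset.card_image_of_injective _ fun a b h => by ext; simpa using h, hw p]

section
variable {c : List ℕ} {w : Fin n → ℕ}

theorem fillW_spec (hw : Content (cnt c) w) {x : ℕ × ℕ} (hx : x ∈ boxes c) :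
    ∃ k : Fin n, w k = x.1 ∧ fillW w x = k + 1 := by
  have : x.2 < (colSet w x.1).card := by rw [card_colSet hw]; exact hx
  exact mem_colSet.1 (getD_sort_mem this)

theorem fillW_isColStd (hw : Content (cnt c) w) : IsColStd n c (fillW w) := by
  have hcol : ∀ x ∈ boxes c, ∀ y ∈ boxes c, x.1 = y.1 → x.2 < y.2 → fillW w x < fillW w y := by
    intro x hx y hy h1 h2
    have : y.2 < (colSet w x.1).card := by rw [card_colSet hw, h1]; exact hy
    simpa only [fillW, h1] using getD_sort_lt h2 this
  refine ⟨⟨?_, ?_, ?_, ?_⟩, hcol⟩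
  · intro x hx
    refine List.getD_eq_default _ _ ?_
    rw [Finset.length_sort, card_colSet hw]
    exact not_lt.1 hx
  · intro x hx
    obtain ⟨k, -, e⟩ := fillW_spec hw hx
    rw [e]; exact ⟨by omega, k.2⟩
  · intro x hx y hy e
    obtain ⟨k, h1, e1⟩ := fillW_spec hw hx
    obtain ⟨k', h2, e2⟩ := fillW_spec hw hy
    have : k = k' := by ext; omega
    subst this
    have h12 : x.1 = y.1 := h1.symm.trans h2
    rcases lt_trichotomy x.2 y.2 with h | h | h
    · exact absurd e (hcol x hx y hy h12 h).ne
    · exact Prod.ext h12 h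
    · exact absurd e (hcol y hy x hx h12.symm h).ne'
  · intro e he
    obtain ⟨k, rfl⟩ : ∃ k : Fin n, e = k + 1 :=
      ⟨⟨e - 1, by have := he.1; have := he.2; omega⟩, by have := he.1; simp; omega⟩
    obtain ⟨q, hq, e⟩ := getD_sort_surj (mem_colSet.2 ⟨k, rfl, rfl⟩)
    rw [card_colSet hw] at hq
    exact ⟨(w k, q), hq, e⟩

theorem IsFilling.colWord_eq {T : ℕ × ℕ → ℕ} (h : IsFilling n (boxes c) T)
    {x : ℕ × ℕ} (hx : x ∈ boxes c) {k : Fin n} (e : T x = k + 1) : colWord c T k = x.1 := by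
  rw [colWord, ← h.boxOf_eq (by omega) (by omega) hx e]

theorem IsFilling.exists_entry {T : ℕ × ℕ → ℕ} (h : IsFilling n (boxes c) T) (k : Fin n) :
    ∃ x ∈ boxes c, T x = k + 1 ∧ x.1 = colWord c T k := by
  obtain ⟨h1, h2⟩ := h.boxOf_spec (i := (k : ℕ) + 1) (by omega) (by omega)
  exact ⟨_, h1, h2, rfl⟩

theorem IsFilling.exists_eq_add_one {T : ℕ × ℕ → ℕ} (h : IsFilling n (boxes c) T) {x : ℕ × ℕ}
    (hx : x ∈ boxes c) : ∃ k : Fin n, T x = k + 1 := by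
  have := h.bij.mapsTo hx
  simp only [Set.mem_Icc] at this
  exact ⟨⟨T x - 1, by omega⟩, by simp; omega⟩

theorem colWord_fillW (hw : Content (cnt c) w) : colWord c (fillW w) = w := by
  funext k
  obtain ⟨x, hx, e, hk⟩ := (fillW_isColStd hw).filling.exists_entry k
  obtain ⟨k', h1, h2⟩ := fillW_spec hw hx
  rw [← hk, ← h1]
  congr 1; ext; omega

theorem content_colWord {T : ℕ × ℕ → ℕ} (h : IsFilling n (boxes c) T) :
    Content (cnt c) (colWord (n := n) c T) := by
  intro p
  rw [← Finset.card_range (cnt c p)]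
  symm
  have ex : ∀ q ∈ Finset.range (cnt c p), ∃ k : Fin n, T (p, q) = k + 1 := fun q hq =>
    h.exists_eq_add_one (x := (p, q)) (Finset.mem_range.1 hq)
  choose f hf using ex
  refine Finset.card_bij f ?_ ?_ ?_
  · intro q hq
    simp only [Finset.mem_filter, Finset.mem_univ, true_and]
    exact h.colWord_eq (x := (p, q)) (Finset.mem_range.1 hq) (hf q hq)
  · intro q hq q' hq' e
    have := h.bij.injOn (x₁ := (p, q)) (x₂ := (p, q')) (by exact Finset.mem_range.1 hq)
      (by exact Finset.mem_range.1 hq') (by rw [hf q hq, hf q' hq', e])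
    exact congrArg Prod.snd this
  · intro k hk
    obtain ⟨⟨p', q⟩, hx, e, e'⟩ := h.exists_entry k
    simp only [Finset.mem_filter, Finset.mem_univ, true_and] at hk
    obtain rfl : p' = p := e'.trans hk
    refine ⟨q, Finset.mem_range.2 hx, ?_⟩
    have := hf q (Finset.mem_range.2 hx)
    ext; omega

theorem IsColStd.fillW_colWord {T : ℕ × ℕ → ℕ} (h : IsColStd n c T) :
    fillW (colWord (n := n) c T) = T := by
  have hw := content_colWord h.filling
  funext x
  by_cases hx : x ∈ boxes c
  · have hc := card_colSet hw x.1
    refine getD_sort_eq (f := fun q => T (x.1, q)) ?_ ?_ (by rw [hc]; exact hx)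
    · intro q hq
      rw [hc] at hq
      obtain ⟨k, hk⟩ := h.filling.exists_eq_add_one (x := (x.1, q)) hq
      exact mem_colSet.2 ⟨k, h.filling.colWord_eq (x := (x.1, q)) hq hk, hk⟩
    · intro q q' hq hq'
      rw [hc] at hq'
      exact h.col (x.1, q) (hq.trans hq') (x.1, q') hq' rfl hq
  · rw [h.filling.zero x hx, (fillW_isColStd hw).filling.zero x hx]

/-- The top entry of column `p` is the first place of the letter `p`. -/
theorem fillW_top (hw : Content (cnt c) w) {p : ℕ} (hp : 0 < cnt c p) :
    ∃ k : Fin n, w k = p ∧ fillW w (p, 0) = k + 1 ∧ ∀ j, w j = p → k ≤ j := by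
  obtain ⟨k, h1, h2⟩ := fillW_spec hw (x := (p, 0)) hp
  refine ⟨k, h1, h2, fun j hj => ?_⟩
  obtain ⟨⟨p', q⟩, hx, e, e'⟩ := (fillW_isColStd hw).filling.exists_entry j
  rw [colWord_fillW hw, hj] at e'
  obtain rfl : p' = p := e'
  rcases q.eq_zero_or_pos with rfl | hq
  · rw [Fin.le_def]; omega
  · have := (fillW_isColStd hw).col (p', 0) hp (p', q) hx rfl hq
    rw [Fin.le_def]; omega

/-- The bottom entry of column `p` is the last place of the letter `p`. -/
theorem fillW_bottom (hw : Content (cnt c) w) {p : ℕ} (hp : 0 < cnt c p) :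
    ∃ k : Fin n, w k = p ∧ fillW w (p, cnt c p - 1) = k + 1 ∧ ∀ j, w j = p → j ≤ k := by
  have hb : (p, cnt c p - 1) ∈ boxes c := Nat.sub_lt hp one_pos
  obtain ⟨k, h1, h2⟩ := fillW_spec hw hb
  refine ⟨k, h1, h2, fun j hj => ?_⟩
  obtain ⟨⟨p', q⟩, hx, e, e'⟩ := (fillW_isColStd hw).filling.exists_entry j
  rw [colWord_fillW hw, hj] at e'
  obtain rfl : p' = p := e'
  have hx' : q < cnt c p' := hx
  rcases (show q ≤ cnt c p' - 1 by omega).eq_or_lt with rfl | hq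
  · rw [Fin.le_def]; omega
  · have := (fillW_isColStd hw).col (p', q) hx (p', cnt c p' - 1) hb rfl hq
    rw [Fin.le_def]; omega

theorem linked_iff (hw : Content (cnt c) w) {p : ℕ} (hp : 0 < cnt c p) (hp' : 0 < cnt c (p + 1)) :
    Linked w p ↔ fillW w (p, 0) < fillW w (p + 1, cnt c (p + 1) - 1) := by
  obtain ⟨k, h1, h2, h3⟩ := fillW_top hw hp
  obtain ⟨k', h1', h2', h3'⟩ := fillW_bottom hw hp'
  constructor
  · rintro ⟨i, j, hij, hi, hj⟩
    have := h3 i hi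
    have := h3' j hj
    rw [h2, h2']
    simp only [Fin.le_def, Fin.lt_def] at *
    omega
  · intro h
    exact ⟨k, k', by rw [Fin.lt_def]; omega, h1, h1'⟩

theorem swapEntries_fillW (hw : Content (cnt c) w) (i : Fin (n - 1)) (hne : w (lo i) ≠ w (hi i)) :
    swapEntries (i + 1) (fillW w) = fillW (w ∘ adj i) := by
  have hf := fillW_isColStd hw
  have hs : IsColStd n c (swapEntries (i + 1) (fillW w)) := by
    refine ⟨hf.filling.swap (by omega) (by omega), fun x hx y hy h1 h2 => ?_⟩
    refine swap_lt (hf.col x hx y hy h1 h2) ?_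
    rintro ⟨e1, e2⟩
    have a1 := hf.filling.colWord_eq hx (k := lo i) e1
    have a2 := hf.filling.colWord_eq hy (k := hi i) e2
    rw [colWord_fillW hw] at a1 a2
    exact hne (a1.trans (h1.trans a2.symm))
  rw [← hs.fillW_colWord]
  congr 1
  funext k
  have := hf.filling.boxOf_swap (i := i + 1) (by omega) (by omega) (j := k + 1) (by omega)
    (by omega)
  rw [colWord, this]
  have e : Equiv.swap ((i : ℕ) + 1) (i + 1 + 1) (k + 1) = (adj i k : ℕ) + 1 := by
    simp only [adj, Equiv.swap_apply_def, Fin.ext_iff]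
    simp only [lo_val, hi_val, Nat.add_right_cancel_iff]
    split_ifs <;> simp [*]
  rw [e]
  exact congrFun (colWord_fillW hw) (adj i k)

end

/-! ### Standard ribbon tableaux in terms of words -/

/-- The columns `p` and `p + 1` are in the same component of the ribbon diagram. -/
def Conn (a : GenComp n) (p : ℕ) : Prop :=
  p + 1 < a.parts.length ∧ a.compIndex (p + 1) = a.compIndex p

section
variable {a : GenComp n}

theorem cnt_pos {c : List ℕ} (hc : ∀ b ∈ c, 0 < b) {p : ℕ} : 0 < cnt c p ↔ p < c.length := by
  unfold cnt
  constructor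
  · intro h
    by_contra hp
    rw [List.getD_eq_default _ _ (not_lt.1 hp)] at h
    omega
  · intro h
    rw [List.getD_eq_getElem _ _ h]
    exact hc _ (List.getElem_mem h)

theorem GenComp.cnt_pos {p : ℕ} : 0 < cnt a.parts p ↔ p < a.parts.length :=
  ZeroHecke.cnt_pos a.parts_pos

theorem psum_cnt (c : List ℕ) (p : ℕ) : psum (cnt c) p = (c.take p).sum := by
  induction p with
  | zero => simp [psum]
  | succ p ih =>
    rw [psum_succ, ih, cnt, List.take_add_one, List.sum_append]
    rcases lt_or_ge p c.length with h | h
    · simp [h]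
    · simp [h]

theorem compIndex_mono (a : GenComp n) : Monotone a.compIndex := by
  intro p q h
  refine Finset.card_le_card fun k hk => ?_
  simp only [Finset.mem_filter] at hk ⊢
  exact ⟨hk.1, hk.2.trans h⟩

/-- The height of the bottom box of column `p`. -/
def baseHeight (a : GenComp n) (p : ℕ) : ℕ :=
  (∑ r ∈ Finset.range p, (a.parts.getD r 0 - 1)) + a.compIndex p

theorem height_eq (a : GenComp n) (x : ℕ × ℕ) :
    a.height x = baseHeight a x.1 + (cnt a.parts x.1 - 1 - x.2) := rfl

theorem baseHeight_succ (a : GenComp n) (p : ℕ) : baseHeight a (p + 1) + a.compIndex p =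
    baseHeight a p + (cnt a.parts p - 1) + a.compIndex (p + 1) := by
  unfold baseHeight cnt
  rw [Finset.sum_range_succ]
  omega

theorem baseHeight_succ_le (a : GenComp n) (p : ℕ) :
    baseHeight a p + (cnt a.parts p - 1) ≤ baseHeight a (p + 1) := by
  have := baseHeight_succ a p
  have := compIndex_mono a (Nat.le_succ p)
  simp only [Nat.succ_eq_add_one] at this
  omega

theorem baseHeight_mono (a : GenComp n) : Monotone (baseHeight a) :=
  monotone_nat_of_le_succ fun p => by have := baseHeight_succ_le a p; omega

theorem height_le_of_lt {x y : ℕ × ℕ} (h : x.1 < y.1) : a.height x ≤ a.height y := by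
  have h1 := baseHeight_succ_le a x.1
  have h2 := baseHeight_mono a (show x.1 + 1 ≤ y.1 from h)
  rw [height_eq, height_eq]
  omega

/-- Boxes in the same row, in different columns: the columns in between are connected, and those
strictly in between have length one. -/
theorem row_chain {x y : ℕ × ℕ} (hy : y ∈ boxes a.parts)
    (hx : x ∈ boxes a.parts) (h : x.1 < y.1) (e : a.height x = a.height y) :
    x.2 = 0 ∧ Conn a x.1 ∧ (x.1 + 1 = y.1 → y.2 = cnt a.parts y.1 - 1) ∧
      (x.1 + 1 < y.1 → cnt a.parts (x.1 + 1) = 1 ∧ a.height (x.1 + 1, 0) = a.height y) := by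
  have h1 := baseHeight_succ a x.1
  have h2 := baseHeight_mono a (show x.1 + 1 ≤ y.1 from h)
  have hm := compIndex_mono a (Nat.le_succ x.1)
  have hxx : x.2 < cnt a.parts x.1 := hx
  have hyy : y.2 < cnt a.parts y.1 := hy
  have hl : x.1 + 1 < a.parts.length := by
    have := GenComp.cnt_pos.1 (show 0 < cnt a.parts y.1 by omega); omega
  simp only [Nat.succ_eq_add_one] at hm
  rw [height_eq, height_eq] at e
  refine ⟨by omega, ⟨hl, by omega⟩, fun h3 => ?_, fun h3 => ?_⟩
  · rw [← h3] at e hyy ⊢; omega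
  · have h4 := baseHeight_succ_le a (x.1 + 1)
    have h5 := baseHeight_mono a (show x.1 + 1 + 1 ≤ y.1 from h3)
    have h6 := GenComp.cnt_pos.2 hl
    rw [height_eq, height_eq]
    dsimp only
    omega

theorem row_of_linked {T : ℕ × ℕ → ℕ}
    (hj : ∀ p, Conn a p → T (p, 0) < T (p + 1, cnt a.parts (p + 1) - 1)) :
    ∀ d x y, x ∈ boxes a.parts → y ∈ boxes a.parts → a.height x = a.height y →
      x.1 + d + 1 = y.1 → T x < T y := by
  intro d
  induction d with
  | zero =>
    intro x y hx hy e h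
    obtain ⟨h1, h2, h3, -⟩ := row_chain hy hx (by omega) e
    have h3 := h3 (by omega)
    have := hj _ h2
    have ex : x = (x.1, 0) := Prod.ext rfl h1
    have ey : y = (x.1 + 1, cnt a.parts (x.1 + 1) - 1) :=
      Prod.ext (by dsimp only; omega) (by dsimp only; rw [h3]; congr 3; omega)
    rw [ex, ey]; exact this
  | succ d ih =>
    intro x y hx hy e h
    obtain ⟨h1, h2, -, h3⟩ := row_chain hy hx (by omega) e
    obtain ⟨h3, h4⟩ := h3 (by omega)
    have := hj _ h2
    rw [h3] at this
    have ex : x = (x.1, 0) := Prod.ext rfl h1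
    rw [ex]
    refine this.trans (ih _ _ ?_ hy h4 (by dsimp only; omega))
    show 0 < cnt a.parts (x.1 + 1)
    omega

/-- The row condition only concerns adjacent connected columns. -/
theorem isSRT_iff {T : ℕ × ℕ → ℕ} : IsSRT a T ↔ IsColStd n a.parts T ∧
    ∀ p, Conn a p → T (p, 0) < T (p + 1, cnt a.parts (p + 1) - 1) := by
  constructor
  · refine fun h => ⟨⟨h.filling, h.col⟩, fun p hp => ?_⟩
    have h0 := GenComp.cnt_pos.2 (show p < a.parts.length by have := hp.1; omega)
    have h1 := GenComp.cnt_pos.2 hp.1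
    refine h.row _ h0 _ (show cnt a.parts (p + 1) - 1 < cnt a.parts (p + 1) by omega) ?_ (by simp)
    have := baseHeight_succ a p
    have := hp.2
    rw [height_eq, height_eq]
    dsimp only
    omega
  · rintro ⟨h, h'⟩
    refine ⟨h.filling, fun x hx y hy e hlt => ?_, h.col⟩
    exact row_of_linked h' (y.1 - x.1 - 1) x y hx hy e (by omega)

theorem isSRT_fillW {w : Fin n → ℕ} (hw : Content (cnt a.parts) w) :
    IsSRT a (fillW w) ↔ ∀ p, Conn a p → Linked w p := by
  rw [isSRT_iff, and_iff_right (fillW_isColStd hw)]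
  refine forall₂_congr fun p hp => (linked_iff hw (GenComp.cnt_pos.2 ?_) (GenComp.cnt_pos.2 hp.1)).symm
  have := hp.1; omega

/-- The word of a standard ribbon tableau. -/
def SRT.word (T : SRT a) : Fin n → ℕ := colWord a.parts T.entry

theorem SRT.content (T : SRT a) : Content (cnt a.parts) T.word := content_colWord T.2.filling

theorem SRT.fillW_word (T : SRT a) : fillW T.word = T.entry :=
  (isSRT_iff.1 T.2).1.fillW_colWord

theorem SRT.linked (T : SRT a) {p : ℕ} (hp : Conn a p) : Linked T.word p :=
  (isSRT_fillW T.content).1 (by rw [T.fillW_word]; exact T.2) p hp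

theorem SRT.word_injective : Function.Injective (SRT.word (a := a)) := by
  intro T T' h
  ext1
  rw [← T.fillW_word, ← T'.fillW_word, h]

/-- The standard ribbon tableau of a linked word. -/
def SRT.ofWord (w : Fin n → ℕ) (hw : Content (cnt a.parts) w) (hl : ∀ p, Conn a p → Linked w p) :
    SRT a := ⟨fillW w, (isSRT_fillW hw).2 hl⟩

theorem SRT.word_ofWord (w : Fin n → ℕ) (hw : Content (cnt a.parts) w)
    (hl : ∀ p, Conn a p → Linked w p) : (SRT.ofWord w hw hl).word = w := colWord_fillW hw

/-- The element of `P_𝛂` attached to a word; it is `0` if the word is not linked where it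
should be. -/
def vecP (a : GenComp n) (w : Fin n → ℕ) : P a := (SRT.vec a (fillW w) : SRT a →₀ ℂ)

theorem vecP_word (T : SRT a) : vecP a T.word = (Finsupp.single T 1 : SRT a →₀ ℂ) := by
  rw [vecP, T.fillW_word, SRT.vec, dif_pos T.2]

theorem vecP_eq_zero {w : Fin n → ℕ} (hw : Content (cnt a.parts) w) {p : ℕ} (hp : Conn a p)
    (h : ¬ Linked w p) : vecP a w = 0 := by
  rw [vecP, SRT.vec, dif_neg]
  · rfl
  · rw [isSRT_fillW hw]; exact fun h' => h (h' p hp)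

theorem SRT.act_eq (T : SRT a) (i : Fin (n - 1)) :
    SRT.act (i + 1) T = (vecP a (bub i T.word) : SRT a →₀ ℂ) := by
  have f := T.2.filling
  have d := T.isDes_iff (i := i + 1) (by omega) (by omega)
  have s := T.sameRow_iff (i := i + 1) (by omega) (by omega)
  obtain ⟨hx, ex⟩ := f.boxOf_spec (i := (i : ℕ) + 1) (by omega) (by omega)
  obtain ⟨hy, ey⟩ := f.boxOf_spec (i := (i : ℕ) + 1 + 1) (by omega) (by omega)
  have wl : T.word (lo i) = (boxOf (boxes a.parts) T.entry (i + 1)).1 := rfl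
  have wh : T.word (hi i) = (boxOf (boxes a.parts) T.entry (i + 1 + 1)).1 := rfl
  generalize boxOf (boxes a.parts) T.entry (i + 1) = x at *
  generalize boxOf (boxes a.parts) T.entry (i + 1 + 1) = y at *
  unfold SRT.act
  rcases le_or_gt (T.word (hi i)) (T.word (lo i)) with h | h
  · rw [bub_of_le h, vecP_word, if_pos]
    rw [d, not_le]
    rw [wl, wh] at h
    rcases h.lt_or_eq with h | h
    · refine (height_le_of_lt h).lt_of_ne fun e => ?_
      have := T.2.row y hy x hx e h
      omega
    · refine SRT.height_lt hy h.symm (lt_of_not_ge fun h' => ?_)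
      rcases h'.lt_or_eq with h' | h'
      · have := T.2.col y hy x hx h h'
        omega
      · rw [Prod.ext h h'] at ey; omega
  · have hc := bub_of_lt h ▸ swapEntries_fillW T.content i h.ne
    rw [T.fillW_word] at hc
    rw [vecP, ← hc]
    rw [wl, wh] at h
    rw [if_neg (not_not.2 (d.2 (height_le_of_lt h)))]
    split_ifs with h'
    · rw [SRT.vec, dif_neg]
      intro hS
      have := hS.row x hx y hy (s.1 h') h
      simp only [swapEntries, ex, ey, Equiv.swap_apply_left, Equiv.swap_apply_right] at this
      omega
    · rfl

theorem gen_smul_vecP {w : Fin n → ℕ} (hw : Content (cnt a.parts) w) (i : Fin (n - 1)) :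
    (gen i : H n) • vecP a w = vecP a (bub i w) := by
  by_cases h : ∀ p, Conn a p → Linked w p
  · rw [← SRT.word_ofWord w hw h, vecP_word]
    exact (gen_smul_P a i _).trans (SRT.act_eq _ i)
  · push Not at h
    obtain ⟨p, hp, hl⟩ := h
    rw [vecP_eq_zero hw hp hl, vecP_eq_zero (hw.bub i) hp (not_linked_bub hl), smul_zero]

end

/-! ### Standard immaculate tableaux in terms of words -/

section
variable {α : Composition n} {w : Fin n → ℕ}

theorem cnt_blocks_pos {p : ℕ} : 0 < cnt α.blocks p ↔ p < α.length :=
  ZeroHecke.cnt_pos fun _ h => α.blocks_pos h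

/-- Immaculate tableaux: each letter `p + 1` occurs after some letter `p`. -/
theorem isSIT_fillW (hw : Content (cnt α.blocks) w) : IsSIT α (fillW w) ↔
    ∀ p q, p < q → ∀ k, w k = q → p < α.length → ∃ j, j < k ∧ w j = p := by
  have hf := fillW_isColStd hw
  constructor
  · intro h p q hpq k hk hp
    have hq : 0 < cnt α.blocks q := hk ▸ hw.pos k
    obtain ⟨k', h1, h2, h3⟩ := fillW_top hw hq
    obtain ⟨j, h1', h2', h3'⟩ := fillW_top hw (cnt_blocks_pos.2 hp)
    have := h.col (p, 0) (cnt_blocks_pos.2 hp) (q, 0) hq rfl rfl hpq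
    refine ⟨j, ?_, h1'⟩
    have := h3 k hk
    simp only [Fin.le_def, Fin.lt_def] at *
    omega
  · intro h
    refine ⟨hf.filling, hf.col, ?_⟩
    rintro ⟨p, _⟩ hx ⟨q, _⟩ hy rfl rfl hpq
    obtain ⟨k', h1, h2, h3⟩ := fillW_top hw hy
    obtain ⟨j, h1', h2', h3'⟩ := fillW_top hw hx
    obtain ⟨j', hj, hj'⟩ := h p q hpq k' h1 (cnt_blocks_pos.1 hx)
    have := h3' j' hj'
    simp only [Fin.le_def, Fin.lt_def] at *
    omega

/-- The element of `V_α` attached to a word; it is `0` if the tableau is not immaculate. -/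
def vecV (α : Composition n) (w : Fin n → ℕ) : V α := (SIT.vec α (fillW w) : SIT α →₀ ℂ)

theorem isSIT_of_bub (hw : Content (cnt α.blocks) w) {i : Fin (n - 1)}
    (h : IsSIT α (fillW (bub i w))) : IsSIT α (fillW w) := by
  rcases le_or_gt (w (hi i)) (w (lo i)) with hd | hd
  · rwa [bub_of_le hd] at h
  · rw [bub_of_lt hd, isSIT_fillW (hw.comp_perm _)] at h
    rw [isSIT_fillW hw]
    intro p q hpq k hk hp
    obtain ⟨j, hj, hj'⟩ := h p q hpq (adj i k) (by simpa using hk) hp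
    refine ⟨adj i j, ?_, hj'⟩
    have := adj_lt_adj (i := i) hj ?_
    · simpa using this
    · rintro ⟨rfl, e⟩
      have e' : k = lo i := by rw [← adj_adj i k, e, adj_hi]
      subst e'
      simp only [Function.comp_apply, adj_lo] at hj'
      omega

theorem gen_smul_vecV (hw : Content (cnt α.blocks) w) (i : Fin (n - 1)) :
    (gen i : H n) • vecV α w = vecV α (bub i w) := by
  by_cases hS : IsSIT α (fillW w)
  swap
  · rw [vecV, vecV, SIT.vec, SIT.vec, dif_neg hS, dif_neg fun h => hS (isSIT_of_bub hw h)]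
    exact (smul_zero (gen i : H n) : gen i • (0 : V α) = 0)
  let T : SIT α := ⟨fillW w, hS⟩
  have e1 : vecV α w = (Finsupp.single T 1 : SIT α →₀ ℂ) := dif_pos hS
  rw [e1]
  refine (gen_smul_V α i T).trans ?_
  have f := T.2.filling
  have d := T.isDes_iff (i := i + 1) (by omega) (by omega)
  have s := T.firstCol_iff (i := i + 1) (by omega) (by omega)
  obtain ⟨hx, ex⟩ := f.boxOf_spec (i := (i : ℕ) + 1) (by omega) (by omega)
  obtain ⟨hy, ey⟩ := f.boxOf_spec (i := (i : ℕ) + 1 + 1) (by omega) (by omega)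
  have wl : w (lo i) = (boxOf (boxes α.blocks) T.entry (i + 1)).1 :=
    (congrFun (colWord_fillW hw) (lo i)).symm
  have wh : w (hi i) = (boxOf (boxes α.blocks) T.entry (i + 1 + 1)).1 :=
    (congrFun (colWord_fillW hw) (hi i)).symm
  generalize boxOf (boxes α.blocks) T.entry (i + 1) = x at *
  generalize boxOf (boxes α.blocks) T.entry (i + 1 + 1) = y at *
  unfold SIT.act
  rcases le_or_gt (w (hi i)) (w (lo i)) with h | h
  · rw [bub_of_le h, if_pos]
    · exact e1.symm
    · rw [d]; omega
  · rw [if_neg (not_not.2 (d.2 (by omega))), vecV, bub_of_lt h, ← swapEntries_fillW hw i h.ne]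
    split_ifs with h'
    · rw [SIT.vec, dif_neg]
      intro hS'
      obtain ⟨x2, y2⟩ := s.1 h'
      have := hS'.col x hx y hy x2 y2 (by omega)
      simp only [swapEntries] at this
      rw [show fillW w x = _ from ex, show fillW w y = _ from ey, Equiv.swap_apply_left,
        Equiv.swap_apply_right] at this
      omega
    · rfl

end

/-! ### Linear maps over the 0-Hecke algebra -/

instance {n : ℕ} (a : GenComp n) : IsScalarTower ℂ (H n) (P a) where
  smul_assoc c h x := by
    show (SRT.moves a).toRep (c • h) x = c • (SRT.moves a).toRep h x
    rw [map_smul]; rfl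

instance {n : ℕ} (α : Composition n) : IsScalarTower ℂ (H n) (V α) where
  smul_assoc c h x := by
    show (SIT.moves α).toRep (c • h) x = c • (SIT.moves α).toRep h x
    rw [map_smul]; rfl

instance {n : ℕ} (β : Composition n) : IsScalarTower ℂ (H n) (F β) where
  smul_assoc c h x := by
    show F.toRep β (c • h) x = c • F.toRep β h x
    rw [map_smul]; rfl

theorem H_induction {Pr : H n → Prop} (h : H n) (scalar : ∀ c : ℂ, Pr (algebraMap ℂ (H n) c))
    (gen : ∀ i, Pr (gen i)) (mul : ∀ x y, Pr x → Pr y → Pr (x * y))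
    (add : ∀ x y, Pr x → Pr y → Pr (x + y)) : Pr h := by
  obtain ⟨x, rfl⟩ := RingQuot.mkAlgHom_surjective ℂ (Rel n) h
  induction x using FreeAlgebra.induction with
  | grade0 r => rw [AlgHom.commutes]; exact scalar r
  | grade1 i => exact gen i
  | mul a b ha hb => rw [map_mul]; exact mul _ _ ha hb
  | add a b ha hb => rw [map_add]; exact add _ _ ha hb

section
variable {A B : Type} [AddCommGroup A] [Module (H n) A] [Module ℂ A] [IsScalarTower ℂ (H n) A]
  [AddCommGroup B] [Module (H n) B] [Module ℂ B] [IsScalarTower ℂ (H n) B]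

/-- A `ℂ`-linear map that commutes with the generators is linear over the 0-Hecke algebra. -/
def homOfGen (f : A →ₗ[ℂ] B) (hf : ∀ (i : Fin (n - 1)) x, f ((gen i : H n) • x) =
    (gen i : H n) • f x) : A →ₗ[H n] B where
  toFun := f
  map_add' := f.map_add
  map_smul' h := by
    induction h using H_induction with
    | scalar c => intro x; simp
    | gen i => exact hf i
    | mul h h' e e' => intro x; rw [mul_smul, e, e', RingHom.id_apply, RingHom.id_apply,
        RingHom.id_apply, mul_smul]
    | add h h' e e' => intro x; rw [add_smul, f.map_add, e, e', RingHom.id_apply, RingHom.id_apply,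
        RingHom.id_apply, add_smul]

end

theorem P_induction {a : GenComp n} {Pr : P a → Prop} (x : P a) (zero : Pr 0)
    (add : ∀ x y, Pr x → Pr y → Pr (x + y)) (smul : ∀ (c : ℂ) (T : SRT a), Pr (c • vecP a T.word)) :
    Pr x := by
  induction x using Finsupp.induction_linear with
  | zero => exact zero
  | add x y hx hy => exact add x y hx hy
  | single T c =>
    have := smul c T
    rw [vecP_word] at this
    have e : (c • Finsupp.single T 1 : SRT a →₀ ℂ) = Finsupp.single T c := by simp
    rw [← e]; exact this

theorem P_map_gen_smul {a : GenComp n} {B : Type} [AddCommGroup B] [Module (H n) B] [Module ℂ B]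
    [IsScalarTower ℂ (H n) B] (f : P a →ₗ[ℂ] B)
    (hf : ∀ (i : Fin (n - 1)) w, Content (cnt a.parts) w →
      f (vecP a (bub i w)) = (gen i : H n) • f (vecP a w)) (i : Fin (n - 1)) (x : P a) :
    f ((gen i : H n) • x) = (gen i : H n) • f x := by
  induction x using P_induction with
  | zero => simp
  | add x y hx hy => rw [smul_add, map_add, hx, hy, map_add, smul_add]
  | smul c T =>
    rw [smul_comm, gen_smul_vecP T.content, f.map_smul, f.map_smul, hf i _ T.content, smul_comm]

/-- The coefficient of a tableau. -/
def coeffP {a : GenComp n} (T : SRT a) : P a →ₗ[ℂ] ℂ :=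
  (Finsupp.lapply T : (SRT a →₀ ℂ) →ₗ[ℂ] ℂ)

/-- The coefficient of a tableau. -/
def coeffV {α : Composition n} (T : SIT α) : V α →ₗ[ℂ] ℂ :=
  (Finsupp.lapply T : (SIT α →₀ ℂ) →ₗ[ℂ] ℂ)

open Classical in
theorem coeffP_vecP {a : GenComp n} (T T' : SRT a) :
    coeffP T (vecP a T'.word) = if T' = T then 1 else 0 := by
  rw [vecP_word]
  exact Finsupp.single_apply

/-! ### The map `Φ` -/

@[simp] theorem single_parts (α : Composition n) : (GenComp.single α).parts = α.blocks := by
  show ([α.blocks].filter fun c => !c.isEmpty).flatten = _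
  rw [List.flatten_filter_not_isEmpty]; simp

theorem conn_single {α : Composition n} {p : ℕ} :
    Conn (GenComp.single α) p ↔ p + 1 < α.length := by
  have key : ∀ q, q < α.length → (GenComp.single α).compIndex q = 0 := by
    intro q hq
    have hc : (GenComp.single α).comps = [α.blocks] := by
      show [α.blocks].filter (fun c => !c.isEmpty) = _
      rw [List.filter_eq_self]
      intro c hc
      simp only [List.mem_singleton] at hc
      subst hc
      rcases e : α.blocks with _ | _
      · have : α.blocks.length = α.length := rfl
        rw [e, List.length_nil] at this; omega
      · rfl
    rw [GenComp.compIndex, hc, Finset.card_eq_zero, Finset.filter_eq_empty_iff]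
    intro k _
    have : α.blocks.length = α.length := rfl
    simp
    omega
  rw [Conn, single_parts]
  exact ⟨fun h => h.1, fun h => ⟨h, by rw [key _ h, key p (by omega)]⟩⟩

section
variable {α : Composition n} {w : Fin n → ℕ}

theorem vecV_eq_zero (h : ¬ IsSIT α (fillW w)) : vecV α w = 0 := by
  rw [vecV, SIT.vec, dif_neg h]; rfl

/-- An immaculate tableau is a ribbon tableau. -/
theorem IsSIT.linked (hw : Content (cnt α.blocks) w) (h : IsSIT α (fillW w)) {p : ℕ}
    (hp : p + 1 < α.length) : Linked w p := by
  obtain ⟨k, hk⟩ := hw.exists_eq (cnt_blocks_pos.2 hp)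
  obtain ⟨j, hj, hj'⟩ := (isSIT_fillW hw).1 h p (p + 1) (by omega) k hk (by omega)
  exact ⟨j, k, hj, hj', hk⟩

theorem Phi_word (T : SRT (GenComp.single α)) :
    Phi α (vecP (GenComp.single α) T.word) = vecV α T.word := by
  rw [vecP_word, vecV, T.fillW_word]
  exact (Finsupp.linearCombination_single ℂ _ _).trans (one_smul _ _)

theorem Phi_vecP (hw : Content (cnt α.blocks) w) :
    Phi α (vecP (GenComp.single α) w) = vecV α w := by
  have hw' : Content (cnt (GenComp.single α).parts) w := by rwa [single_parts]
  by_cases h : ∀ p, Conn (GenComp.single α) p → Linked w p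
  · have := Phi_word (SRT.ofWord w hw' h)
    rwa [SRT.word_ofWord] at this
  · push Not at h
    obtain ⟨p, hp, hl⟩ := h
    rw [vecP_eq_zero hw' hp hl, vecV_eq_zero, map_zero]
    exact fun h => hl (h.linked hw (conn_single.1 hp))

/-- `Φ` as a homomorphism over the 0-Hecke algebra. -/
def PhiH (α : Composition n) : P (GenComp.single α) →ₗ[H n] V α :=
  homOfGen (Phi α) <| P_map_gen_smul _ fun i w hw => by
    rw [single_parts] at hw
    rw [Phi_vecP hw, Phi_vecP (hw.bub i), gen_smul_vecV hw]

theorem vecV_colWord (T : SIT α) : vecV α (colWord α.blocks T.entry) =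
    (Finsupp.single T 1 : SIT α →₀ ℂ) := by
  have e : fillW (colWord (n := n) α.blocks T.entry) = T.entry :=
    IsColStd.fillW_colWord ⟨T.2.filling, T.2.row⟩
  rw [vecV, e, SIT.vec, dif_pos T.2]

theorem PhiH_surjective (α : Composition n) : Function.Surjective (PhiH α) := by
  intro y
  induction y using Finsupp.induction_linear with
  | zero => exact ⟨0, map_zero _⟩
  | add x y hx hy =>
    obtain ⟨a, rfl⟩ := hx
    obtain ⟨b, rfl⟩ := hy
    exact ⟨a + b, map_add _ _ _⟩
  | single T c =>
    refine ⟨c • vecP (GenComp.single α) (colWord α.blocks T.entry), ?_⟩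
    show Phi α _ = _
    rw [map_smul, Phi_vecP (content_colWord T.2.filling), vecV_colWord]
    exact (Finsupp.smul_single_one T c)

/-- The coefficient of an immaculate tableau in `Φ x` is its coefficient in `x`. -/
theorem coeffV_Phi (x : P (GenComp.single α)) (T : SRT (GenComp.single α))
    (hT : IsSIT α T.entry) : coeffV ⟨T.entry, hT⟩ (Phi α x) = coeffP T x := by
  induction x using P_induction with
  | zero => simp
  | add x y hx hy => rw [map_add, map_add, map_add, hx, hy]
  | smul c T' =>
    rw [map_smul, map_smul, map_smul, coeffP_vecP, Phi_word, vecV, T'.fillW_word, SIT.vec]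
    congr 1
    split_ifs with h h' h'
    · subst h'; exact Finsupp.single_eq_same
    · refine Finsupp.single_eq_of_ne fun e => h' ?_
      exact SRT.ext (congrArg SIT.entry e).symm
    · subst h'; exact absurd hT h
    · exact map_zero (coeffV _)

end

/-! ### The shape `𝛂^{(i)}` -/

section
variable {α : Composition n} (i : calI α)

theorem bal_parts : (bal α i).parts = (balLists α i).flatten := by
  show ((balLists α i).filter fun c => !c.isEmpty).flatten = _
  rw [List.flatten_filter_not_isEmpty]

theorem calI.lt : (i : ℕ) + 1 < α.length := i.2.1

theorem calI.two_le : 2 ≤ cnt α.blocks (i + 1) := by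
  have h1 : cnt α.blocks (i + 1) ≠ 1 := i.2.2
  have h2 := (cnt_blocks_pos (α := α)).2 (calI.lt i)
  omega

theorem bal_parts_length : (bal α i).parts.length = α.length := by
  have h := calI.lt i
  rw [bal_parts, balLists]
  have : α.blocks.length = α.length := rfl
  simp [this]
  omega

theorem cnt_bal (p : ℕ) : cnt (bal α i).parts p =
    if p = i then cnt α.blocks i + 1 else if p = i + 1 then cnt α.blocks (i + 1) - 1
    else cnt α.blocks p := by
  have h := calI.lt i
  have hl : α.blocks.length = α.length := rfl
  have hi : (i : ℕ) ≤ α.blocks.length := by omega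
  have e : (bal α i).parts = α.blocks.take i ++ (cnt α.blocks i + 1) ::
      (cnt α.blocks (i + 1) - 1) :: α.blocks.drop (i + 2) := by
    rw [bal_parts, balLists]; simp [cnt]
  unfold cnt at *
  rw [e]
  split_ifs with h1 h2
  · subst h1
    rw [List.getD_append_right _ _ _ _ (by simp)]
    simp [hi]
  · subst h2
    rw [List.getD_append_right _ _ _ _ (by simp)]
    simp [hi]
  · rcases lt_or_ge p i with h3 | h3
    · rw [List.getD_append _ _ _ _ (by simp; omega)]
      simp [List.getD_eq_getElem?_getD, h3]
    · rw [List.getD_append_right _ _ _ _ (by simp; omega)]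
      obtain ⟨q, rfl⟩ : ∃ q, p = i + (q + 2) := ⟨p - i - 2, by omega⟩
      have : (i : ℕ) + (q + 2) - (α.blocks.take i).length = q + 1 + 1 := by simp [hi]
      rw [this]
      simp [List.getD_eq_getElem?_getD, List.getElem?_drop]
      congr 2; omega

theorem bal_comps : (bal α i).comps = (α.blocks.take i ++
    [α.blocks.getD i 0 + 1, α.blocks.getD (i + 1) 0 - 1]) ::
      (if α.blocks.drop (i + 2) = [] then [] else [α.blocks.drop (i + 2)]) := by
  show (balLists α i).filter (fun c => !c.isEmpty) = _
  rw [balLists, List.filter_cons_of_pos (by simp)]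
  congr 1
  split_ifs with h
  · rw [h]; rfl
  · rw [List.filter_cons_of_pos]
    · rfl
    · simpa using h

theorem compIndex_bal {p : ℕ} (hp : p < α.length) :
    (bal α i).compIndex p = if (i : ℕ) + 2 ≤ p then 1 else 0 := by
  have h := calI.lt i
  have hl : α.blocks.length = α.length := rfl
  rw [GenComp.compIndex, bal_comps]
  split_ifs with h1 h2 h2
  · rw [List.drop_eq_nil_iff] at h1; omega
  · rw [List.drop_eq_nil_iff] at h1
    rw [Finset.card_eq_zero, Finset.filter_eq_empty_iff]
    intro k _
    simp; omega
  · rw [List.drop_eq_nil_iff] at h1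
    rw [Finset.card_eq_one]
    refine ⟨0, ?_⟩
    ext k
    simp only [Finset.mem_filter, Finset.mem_range, Finset.mem_singleton]
    constructor
    · rintro ⟨h3, h4⟩
      by_contra hk
      obtain rfl : k = 1 := by simp at h3; omega
      simp at h4
      omega
    · rintro rfl
      simp
      omega
  · rw [Finset.card_eq_zero, Finset.filter_eq_empty_iff]
    intro k _
    rcases k with _ | k
    · simp; omega
    · have hi : (i : ℕ) ≤ α.blocks.length := by omega
      simp only [List.take_succ_cons, List.flatten_cons, List.length_append, List.length_take,
        min_eq_left hi, List.length_cons]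
      omega

/-- The ribbon diagram of `𝛂^{(i)}` is broken between the columns `i + 1` and `i + 2`. -/
theorem conn_bal {p : ℕ} : Conn (bal α i) p ↔ p + 1 < α.length ∧ p ≠ i + 1 := by
  rw [Conn, bal_parts_length]
  refine and_congr_right fun h => ?_
  rw [compIndex_bal i h, compIndex_bal i (show p < α.length by omega)]
  constructor
  · rintro e rfl
    split_ifs at e <;> omega
  · intro hp
    split_ifs <;> omega

theorem psum_bal (p : ℕ) : psum (cnt (bal α i).parts) p =
    psum (cnt α.blocks) p + if p = i + 1 then 1 else 0 := by
  have h2 := calI.two_le i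
  induction p with
  | zero => simp [psum]
  | succ p ih =>
    rw [psum_succ, psum_succ, ih, cnt_bal]
    split_ifs <;> first | omega | (subst_vars; omega)

end

/-! ### The map `L` on words -/

/-- Replace the first letter `p` by `p + 1`. -/
def raise (p : ℕ) (w : Fin n → ℕ) : Fin n → ℕ := fun k =>
  open Classical in if w k = p ∧ ∀ j, w j = p → k ≤ j then p + 1 else w k

section
variable {w : Fin n → ℕ} {p : ℕ}

theorem raise_eq {f : Fin n} (h : w f = p) (h' : ∀ j, w j = p → f ≤ j) :
    raise p w = Function.update w f (p + 1) := by
  funext k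
  rw [raise, Function.update_apply]
  by_cases hk : k = f
  · subst hk; rw [if_pos ⟨h, h'⟩, if_pos rfl]
  · rw [if_neg hk, if_neg]
    rintro ⟨h1, h2⟩
    exact hk (le_antisymm (h2 f h) (h' k h1))

theorem exists_first (h : ∃ k, w k = p) : ∃ f : Fin n, w f = p ∧ ∀ j, w j = p → f ≤ j := by
  obtain ⟨f, hf, hf'⟩ := WellFounded.has_min (wellFounded_lt (α := Fin n)) {k | w k = p} h
  exact ⟨f, hf, fun j hj => not_lt.1 (hf' j hj)⟩

theorem bub_raise (h : ∃ k, w k = p) (i : Fin (n - 1)) :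
    bub i (raise p w) = raise p (bub i w) := by
  obtain ⟨f, hf, hf'⟩ := exists_first h
  have hlh := lo_lt_hi i
  rw [raise_eq hf hf']
  rcases le_or_gt (w (hi i)) (w (lo i)) with hd | hd
  · rw [bub_of_le hd, raise_eq hf hf', bub_of_le]
    simp only [Function.update_apply]
    split_ifs with h1 h2 h2
    · omega
    · have : w (lo i) ≠ p := fun e => absurd (hf' _ e) (by rw [← h1]; exact hlh.not_ge)
      rw [← h1] at hf; omega
    · rw [← h2] at hf; omega
    · exact hd
  · rw [bub_of_lt hd]
    by_cases h1 : lo i = f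
    · subst h1
      have e : raise p (w ∘ adj i) = Function.update (w ∘ adj i) (hi i) (p + 1) := by
        refine raise_eq (by simpa using hf) fun j hj => ?_
        have h1 : adj i j ≠ hi i := by
          intro e; simp only [Function.comp_apply, e] at hj; omega
        have h2 := hf' _ hj
        by_cases h3 : j = hi i
        · exact h3.ge
        by_cases h4 : j = lo i
        · exact absurd (by rw [h4, adj_lo]) h1
        rw [adj_of_ne h4 h3] at h2
        rw [Fin.le_def] at h2 ⊢
        rw [Fin.ext_iff] at h4
        simp at *; omega
      rw [e]
      rcases (show p + 1 ≤ w (hi i) by omega).eq_or_lt with h2 | h2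
      · rw [bub_of_le]
        · funext k
          simp only [Function.update_apply, Function.comp_apply]
          by_cases h3 : k = hi i
          · rw [if_pos h3, h3, if_neg hlh.ne', h2]
          · rw [if_neg h3]
            by_cases h4 : k = lo i
            · rw [if_pos h4, h4, adj_lo, h2]
            · rw [if_neg h4, adj_of_ne h4 h3]
        · rw [Function.update_self, Function.update_of_ne hlh.ne', h2]
      · rw [bub_of_lt]
        · funext k
          simp only [Function.update_apply, Function.comp_apply]
          by_cases h3 : k = hi i
          · rw [h3, adj_hi, if_pos rfl, if_pos rfl]
          · rw [if_neg h3, if_neg]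
            intro e; exact h3 (by rw [← adj_adj i k, e, adj_lo])
        · rwa [Function.update_self, Function.update_of_ne hlh.ne']
    · have e : raise p (w ∘ adj i) = Function.update (w ∘ adj i) (adj i f) (p + 1) := by
        refine raise_eq (by simpa using hf) fun j hj => ?_
        rcases (hf' _ hj).eq_or_lt with h2 | h2
        · rw [h2, adj_adj]
        · have := adj_lt_adj (i := i) h2 (fun h => h1 h.1.symm)
          rw [adj_adj] at this
          exact this.le
      rw [e, bub_of_lt]
      · funext k
        simp only [Function.update_apply, Function.comp_apply]
        by_cases h3 : k = adj i f
        · rw [if_pos h3, h3, adj_adj, if_pos rfl]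
        · rw [if_neg h3, if_neg]
          intro e; exact h3 (by rw [← e, adj_adj])
      · rw [Function.update_of_ne h1, Function.update_apply]
        split_ifs with h2
        · rw [h2, hf] at hd; omega
        · exact hd

end

section
variable {α : Composition n} {i : calI α} {w : Fin n → ℕ}

theorem exists_first_bal (hw : Content (cnt (bal α i).parts) w) :
    ∃ f : Fin n, w f = i ∧ ∀ j, w j = i → f ≤ j :=
  exists_first (hw.exists_eq (by rw [cnt_bal, if_pos rfl]; omega))

theorem content_raise (hw : Content (cnt (bal α i).parts) w) :
    Content (cnt α.blocks) (raise i w) := by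
  obtain ⟨f, hf, hf'⟩ := exists_first_bal hw
  have h2 := calI.two_le i
  rw [raise_eq hf hf']
  intro p
  have e := hw p
  rw [cnt_bal] at e
  by_cases h1 : p = i
  · subst h1
    rw [if_pos rfl] at e
    have : (Finset.univ.filter fun k => Function.update w f ((i : ℕ) + 1) k = i) =
        (Finset.univ.filter fun k => w k = i).erase f := by
      ext k
      simp only [Finset.mem_filter, Finset.mem_univ, true_and, Finset.mem_erase,
        Function.update_apply]
      split_ifs with h <;> simp [h]
    rw [this, Finset.card_erase_of_mem (by simpa using hf), e]
    omega
  · rw [if_neg h1] at e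
    by_cases h3 : p = i + 1
    · subst h3
      rw [if_pos rfl] at e
      have : (Finset.univ.filter fun k => Function.update w f ((i : ℕ) + 1) k = i + 1) =
          insert f (Finset.univ.filter fun k => w k = i + 1) := by
        ext k
        simp only [Finset.mem_filter, Finset.mem_univ, true_and, Finset.mem_insert,
          Function.update_apply]
        split_ifs with h <;> simp [h]
      rw [this, Finset.card_insert_of_notMem (by simp [hf]), e]
      omega
    · rw [if_neg h3] at e
      rw [← e]
      congr 1
      ext k
      simp only [Finset.mem_filter, Finset.mem_univ, true_and, Function.update_apply]
      split_ifs with h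
      · subst h; omega
      · rfl

/-- If `L(τ)` satisfies the row conditions, so does `τ`. -/
theorem linked_of_linked_raise (hw : Content (cnt (bal α i).parts) w) {p : ℕ} (hp : p ≠ i + 1)
    (h : Linked (raise i w) p) : Linked w p := by
  obtain ⟨f, hf, hf'⟩ := exists_first_bal hw
  rw [raise_eq hf hf'] at h
  obtain ⟨j, k, hjk, hj, hk⟩ := h
  rw [Function.update_apply] at hj hk
  have hj' : j ≠ f := by
    rintro rfl; rw [if_pos rfl] at hj; omega
  rw [if_neg hj'] at hj
  by_cases hk' : k = f
  · rw [if_pos hk'] at hk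
    obtain rfl : p = i := by omega
    exact absurd (hf' j hj) (by rw [← hk']; exact hjk.not_ge)
  · rw [if_neg hk'] at hk
    exact ⟨j, k, hjk, hj, hk⟩

theorem column_fillW {c : List ℕ} (hw : Content (cnt c) w) (p : ℕ) :
    column c (fillW w) p = colSet w p := by
  ext e
  simp only [column, Finset.mem_image, Finset.mem_range]
  constructor
  · rintro ⟨q, hq, rfl⟩
    exact getD_sort_mem (by rwa [card_colSet hw])
  · intro he
    obtain ⟨q, hq, h⟩ := getD_sort_surj he
    rw [card_colSet hw] at hq
    exact ⟨q, hq, h⟩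

theorem fillingL_fillW (hw : Content (cnt (bal α i).parts) w) :
    fillingL (bal α i).parts (fillW w) i = fillW (raise i w) := by
  obtain ⟨f, hf, hf', hf''⟩ := fillW_top hw (p := i) (by rw [cnt_bal, if_pos rfl]; omega)
  funext x
  have : columnL (bal α i).parts (fillW w) i x.1 = colSet (raise i w) x.1 := by
    rw [raise_eq hf hf'']
    ext e
    simp only [columnL, column_fillW hw]
    split_ifs with h1 h2
    · simp only [Finset.mem_sdiff, Finset.mem_singleton, mem_colSet, hf', h1,
        Function.update_apply]
      constructor
      · rintro ⟨⟨k, hk, rfl⟩, hne⟩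
        refine ⟨k, ?_, rfl⟩
        rw [if_neg (by rintro rfl; exact hne rfl), hk]
      · rintro ⟨k, hk, rfl⟩
        split_ifs at hk with h
        · omega
        · exact ⟨⟨k, hk, rfl⟩, fun e => h (by ext; omega)⟩
    · simp only [Finset.mem_union, Finset.mem_singleton, mem_colSet, hf', h2,
        Function.update_apply]
      constructor
      · rintro (⟨k, hk, rfl⟩ | rfl)
        · refine ⟨k, ?_, rfl⟩
          split_ifs
          · rfl
          · exact hk
        · exact ⟨f, if_pos rfl, rfl⟩
      · rintro ⟨k, hk, rfl⟩
        split_ifs at hk with h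
        · subst h; exact Or.inr rfl
        · exact Or.inl ⟨k, hk, rfl⟩
    · simp only [mem_colSet, Function.update_apply]
      refine exists_congr fun k => and_congr_left fun _ => ?_
      split_ifs with h
      · subst h; omega
      · rfl
  rw [fillingL, this]; rfl

theorem partialAt_word (τ : SRT (bal α i)) :
    partialAt α i (vecP (bal α i) τ.word) = vecP (GenComp.single α) (raise i τ.word) := by
  rw [vecP_word, vecP, ← fillingL_fillW τ.content, τ.fillW_word]
  exact (Finsupp.linearCombination_single ℂ _ _).trans (one_smul _ _)

theorem partialAt_vecP (hw : Content (cnt (bal α i).parts) w) :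
    partialAt α i (vecP (bal α i) w) = vecP (GenComp.single α) (raise i w) := by
  by_cases h : ∀ p, Conn (bal α i) p → Linked w p
  · have := partialAt_word (SRT.ofWord w hw h)
    rwa [SRT.word_ofWord] at this
  · push Not at h
    obtain ⟨p, hp, hl⟩ := h
    obtain ⟨h1, h2⟩ := (conn_bal i).1 hp
    have hr := content_raise hw
    rw [← single_parts] at hr
    rw [vecP_eq_zero hw hp hl, map_zero, vecP_eq_zero hr (conn_single.2 h1)]
    exact fun h => hl (linked_of_linked_raise hw h2 h)

theorem partialAt_gen_smul (j : Fin (n - 1)) (x : P (bal α i)) :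
    partialAt α i ((gen j : H n) • x) = (gen j : H n) • partialAt α i x := by
  refine P_map_gen_smul (partialAt α i) (fun j w hw => ?_) j x
  have hr := content_raise hw
  rw [← single_parts] at hr
  rw [partialAt_vecP hw, partialAt_vecP (hw.bub j), gen_smul_vecP hr, bub_raise]
  exact hw.exists_eq (by rw [cnt_bal, if_pos rfl]; omega)

end

/-! ### The map `∂₁` and its image -/

section
variable {α : Composition n}

theorem partialOne_lof (i : calI α) (x : P (bal α i)) :
    partialOne α (DirectSum.lof ℂ (calI α) (fun i => P (bal α i)) i x) = partialAt α i x := by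
  have := DirectSum.toModule_lof (ι := calI α) ℂ (M := fun i => P (bal α i)) (φ := partialAt α) i x
  exact this

/-- `∂₁` as a homomorphism over the 0-Hecke algebra. -/
def dH (α : Composition n) : (⨁ i : calI α, P (bal α i)) →ₗ[H n] P (GenComp.single α) :=
  homOfGen (partialOne α) <| by
    classical
    intro j x
    induction x using DirectSum.induction_on with
    | zero => simp
    | add x y hx hy => rw [smul_add, map_add, hx, hy, map_add, smul_add]
    | of i x =>
      have e : (gen j : H n) • DirectSum.of (fun i => P (bal α i)) i x =
          DirectSum.lof ℂ (calI α) (fun i => P (bal α i)) i ((gen j : H n) • x) :=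
        ((DirectSum.lof (H n) (calI α) (fun i => P (bal α i)) i).map_smul (gen j) x).symm
      rw [e]
      have := partialOne_lof i x
      rw [partialOne_lof, partialAt_gen_smul]
      congr 1
      exact this.symm

theorem dH_lof (i : calI α) (x : P (bal α i)) :
    dH α (DirectSum.lof ℂ (calI α) (fun i => P (bal α i)) i x) = partialAt α i x :=
  partialOne_lof i x

/-- In `L(τ)` the top entry of column `i + 1` is smaller than that of column `i`. -/
theorem vecV_raise {i : calI α} {w : Fin n → ℕ} (hw : Content (cnt (bal α i).parts) w) :
    vecV α (raise i w) = 0 := by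
  apply vecV_eq_zero
  rw [isSIT_fillW (content_raise hw)]
  intro h
  obtain ⟨f, hf, hf'⟩ := exists_first_bal hw
  rw [raise_eq hf hf'] at h
  have := calI.lt i
  obtain ⟨j, hj, hj'⟩ := h i (i + 1) (by omega) f (by simp) (by omega)
  rw [Function.update_of_ne hj.ne] at hj'
  exact absurd (hf' j hj') hj.not_ge

theorem Phi_partialAt (i : calI α) (x : P (bal α i)) : Phi α (partialAt α i x) = 0 := by
  induction x using P_induction with
  | zero => simp
  | add x y hx hy => rw [map_add, map_add, hx, hy, add_zero]
  | smul c τ =>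
    rw [map_smul, map_smul, partialAt_vecP τ.content, Phi_vecP (content_raise τ.content),
      vecV_raise τ.content, smul_zero]

theorem PhiH_dH (x) : PhiH α (dH α x) = 0 := by
  classical
  induction x using DirectSum.induction_on with
  | zero => simp
  | add x y hx hy => rw [map_add, map_add, hx, hy, add_zero]
  | of i x =>
    have := dH_lof i x
    exact (congrArg _ this).trans (Phi_partialAt i x)

/-- A non-immaculate standard ribbon tableau of shape `α` is of the form `L(τ)`: move the top entry
of a column `i + 1` that is smaller than the top entry of column `i` to column `i`. -/
theorem exists_raise {u : Fin n → ℕ} (hu : Content (cnt α.blocks) u)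
    (hl : ∀ p, p + 1 < α.length → Linked u p) (hS : ¬ IsSIT α (fillW u)) :
    ∃ (i : calI α) (w : Fin n → ℕ), Content (cnt (bal α i).parts) w ∧
      (∀ p, Conn (bal α i) p → Linked w p) ∧ raise i w = u := by
  have h1 : ∃ p, p + 1 < α.length ∧ ∃ f, u f = p + 1 ∧ ∀ j, u j = p → f < j := by
    by_contra hne
    push Not at hne
    apply hS
    rw [isSIT_fillW hu]
    intro p q hpq
    induction q, hpq using Nat.le_induction with
    | base =>
      intro k hk hp
      have hp' := cnt_blocks_pos.1 (hk ▸ hu.pos k)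
      obtain ⟨j, hj, hj'⟩ := hne p hp' k hk
      refine ⟨j, lt_of_le_of_ne hj' ?_, hj⟩
      rintro rfl; omega
    | succ q hpq ih =>
      intro k hk hp
      have hp' := cnt_blocks_pos.1 (hk ▸ hu.pos k)
      obtain ⟨j, hj, hj'⟩ := hne q hp' k hk
      obtain ⟨j', hj1, hj2⟩ := ih j hj hp
      exact ⟨j', hj1.trans_le hj', hj2⟩
  obtain ⟨p, hp, f', hf', hfl'⟩ := h1
  obtain ⟨f, hf, hff⟩ := exists_first ⟨f', hf'⟩
  have hfl : ∀ j, u j = p → f < j := fun j hj => (hff f' hf').trans_lt (hfl' j hj)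
  obtain ⟨j0, k0, hjk0, hj0, hk0⟩ := hl p hp
  have hfk : f ≠ k0 := ((hfl j0 hj0).trans hjk0).ne
  have hmem : p ∈ calI α := by
    refine ⟨hp, fun h => ?_⟩
    have := hu (p + 1)
    rw [cnt, h, Finset.card_eq_one] at this
    obtain ⟨a, ha⟩ := this
    have e1 : f ∈ ({a} : Finset (Fin n)) := by rw [← ha]; simpa using hf
    have e2 : k0 ∈ ({a} : Finset (Fin n)) := by rw [← ha]; simpa using hk0
    rw [Finset.mem_singleton] at e1 e2
    exact hfk (e1.trans e2.symm)
  have hw : Content (cnt (bal α ⟨p, hmem⟩).parts) (Function.update u f p) := by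
    intro q
    rw [cnt_bal]
    dsimp only
    split_ifs with h1 h2
    · subst h1
      have : (Finset.univ.filter fun k => Function.update u f q k = q) =
          insert f (Finset.univ.filter fun k => u k = q) := by
        ext k
        simp only [Finset.mem_filter, Finset.mem_univ, true_and, Finset.mem_insert,
          Function.update_apply]
        split_ifs with h <;> simp [h]
      rw [this, Finset.card_insert_of_notMem (by simp [hf]), hu]
    · subst h2
      have : (Finset.univ.filter fun k => Function.update u f p k = p + 1) =
          (Finset.univ.filter fun k => u k = p + 1).erase f := by
        ext k
        simp only [Finset.mem_filter, Finset.mem_univ, true_and, Finset.mem_erase,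
          Function.update_apply]
        split_ifs with h <;> simp [h]
      rw [this, Finset.card_erase_of_mem (by simpa using hf), hu]
    · rw [← hu q]
      congr 1
      ext k
      simp only [Finset.mem_filter, Finset.mem_univ, true_and, Function.update_apply]
      split_ifs with h
      · subst h; omega
      · rfl
  refine ⟨⟨p, hmem⟩, Function.update u f p, hw, fun q hq => ?_, ?_⟩
  · obtain ⟨h1, h2⟩ := (conn_bal _).1 hq
    dsimp only at h2
    obtain ⟨j, k, hjk, hj, hk⟩ := hl q h1
    by_cases hqp : q = p
    · subst hqp
      exact ⟨f, k0, (hfl j0 hj0).trans hjk0, by simp, by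
        rw [Function.update_of_ne hfk.symm, hk0]⟩
    · have hj' : j ≠ f := by rintro rfl; omega
      have hk' : k ≠ f := by rintro rfl; omega
      exact ⟨j, k, hjk, by rw [Function.update_of_ne hj', hj],
        by rw [Function.update_of_ne hk', hk]⟩
  · rw [raise_eq (f := f) (by simp) fun j hj => ?_]
    · rw [Function.update_idem, ← hf, Function.update_eq_self]
    · by_cases h : j = f
      · exact h.ge
      · rw [Function.update_of_ne h] at hj
        exact (hfl j hj).le

theorem range_dH : LinearMap.range (dH α) = LinearMap.ker (PhiH α) := by
  apply le_antisymm
  · rintro _ ⟨x, rfl⟩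
    exact PhiH_dH x
  · intro x hx
    have hx : Phi α x = 0 := hx
    have : (x : SRT (GenComp.single α) →₀ ℂ).sum (fun T c => Finsupp.single T c) = x :=
      Finsupp.sum_single _
    rw [← this]
    refine Submodule.sum_mem _ fun T hT => ?_
    have hc : coeffP T x ≠ 0 := Finsupp.mem_support_iff.1 hT
    have hS : ¬ IsSIT α (fillW T.word) := by
      rw [T.fillW_word]
      intro h
      rw [← coeffV_Phi x T h, hx, map_zero] at hc
      exact hc rfl
    have hu := T.content
    rw [single_parts] at hu
    obtain ⟨i, w, hw, hl, e⟩ := exists_raise hu (fun p hp => T.linked (conn_single.2 hp)) hS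
    refine ⟨DirectSum.lof ℂ (calI α) (fun i => P (bal α i)) i (coeffP T x • vecP _ w), ?_⟩
    rw [dH_lof, map_smul, partialAt_vecP hw, e, vecP_word]
    exact Finsupp.smul_single_one T _

end

/-! ### A spanning set of the 0-Hecke algebra -/

section
variable {A : Type} [Ring A] (g : ℕ → A)

/-- The product `g_k g_{k+1} ⋯ g_{k+t-1}`. -/
def run : ℕ → ℕ → A
  | _, 0 => 1
  | k, t + 1 => g k * run (k + 1) t

open Classical in
/-- The products `run k₁ ⋯ run k_m` that correspond to the `m!` normal forms of permutations. -/
def normalForms : ℕ → Finset A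
  | 0 => {1}
  | m + 1 => Finset.image₂ (fun k b => run g k (m - k) * b) (Finset.range (m + 1)) (normalForms m)

theorem card_normalForms (m : ℕ) : (normalForms g m).card ≤ m.factorial := by
  classical
  induction m with
  | zero => simp [normalForms]
  | succ m ih =>
    refine (Finset.card_image₂_le _ _ _).trans ?_
    rw [Finset.card_range, Nat.factorial_succ]
    exact Nat.mul_le_mul_left _ ih

theorem one_mem_normalForms (m : ℕ) : 1 ∈ normalForms g m := by
  classical
  induction m with
  | zero => simp [normalForms]
  | succ m ih =>
    refine Finset.mem_image₂.2 ⟨m, by simp, 1, ih, ?_⟩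
    simp [run]

variable {g} {N : ℕ} (idem : ∀ i, i < N → g i * g i = g i)
  (braid : ∀ i, i + 1 < N → g i * g (i + 1) * g i = g (i + 1) * g i * g (i + 1))
  (comm : ∀ i j, i + 2 ≤ j → j < N → g i * g j = g j * g i)

section
include comm

theorem run_comm {j k t : ℕ} (h : j + 2 ≤ k) (hN : k + t ≤ N) :
    g j * run g k t = run g k t * g j := by
  induction t generalizing k with
  | zero => simp [run]
  | succ t ih =>
    rw [run, ← mul_assoc, comm j k h (by omega), mul_assoc, ih (by omega) (by omega), mul_assoc]

include braid in
theorem run_braid {s k t : ℕ} (h : s + 1 < t) (hN : k + t ≤ N) :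
    g (k + s + 1) * run g k t = run g k t * g (k + s) := by
  induction s generalizing k t with
  | zero =>
    obtain ⟨t, rfl⟩ : ∃ t', t = t' + 2 := ⟨t - 2, by omega⟩
    have e := braid k (by omega)
    have c := run_comm comm (g := g) (j := k) (k := k + 2) (t := t) le_rfl (by omega)
    simp only [run, add_zero] at *
    rw [← mul_assoc, ← mul_assoc, ← e, mul_assoc _ (g k), c]
    simp only [mul_assoc]
  | succ s ih =>
    obtain ⟨t, rfl⟩ : ∃ t', t = t' + 1 := ⟨t - 1, by omega⟩
    have e := ih (k := k + 1) (t := t) (by omega) (by omega)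
    rw [show k + 1 + s + 1 = k + (s + 1) + 1 by omega, show k + 1 + s = k + (s + 1) by omega] at e
    rw [run, ← mul_assoc, ← comm k _ (by omega) (by omega), mul_assoc, e, mul_assoc]

end

include idem braid comm in
theorem mul_mem_span_normalForms [Algebra ℂ A] {m : ℕ} (hm : m ≤ N + 1) {j : ℕ} (hj : j + 1 < m) {x : A}
    (hx : x ∈ Submodule.span ℂ (normalForms g m : Set A)) :
    g j * x ∈ Submodule.span ℂ (normalForms g m : Set A) := by
  classical
  induction m generalizing j x with
  | zero => omega
  | succ m ih =>
    have key : ∀ k < m + 1, ∀ b ∈ Submodule.span ℂ (normalForms g m : Set A),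
        run g k (m - k) * b ∈ Submodule.span ℂ (normalForms g (m + 1) : Set A) := by
      intro k hk b hb
      induction hb using Submodule.span_induction with
      | mem b hb =>
        exact Submodule.subset_span (Finset.mem_coe.2
          (Finset.mem_image₂.2 ⟨k, by simpa using hk, b, hb, rfl⟩))
      | zero => rw [mul_zero]; exact Submodule.zero_mem _
      | add b b' _ _ h h' => rw [mul_add]; exact Submodule.add_mem _ h h'
      | smul c b _ h => rw [mul_smul_comm]; exact Submodule.smul_mem _ c h
    induction hx using Submodule.span_induction with
    | zero => rw [mul_zero]; exact Submodule.zero_mem _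
    | add b b' _ _ h h' => rw [mul_add]; exact Submodule.add_mem _ h h'
    | smul c b _ h => rw [mul_smul_comm]; exact Submodule.smul_mem _ c h
    | mem x hx =>
      obtain ⟨k, hk, b, hb, rfl⟩ := Finset.mem_image₂.1 (Finset.mem_coe.1 hx)
      have hk : k < m + 1 := Finset.mem_range.1 hk
      have hb' : b ∈ Submodule.span ℂ (normalForms g m : Set A) := Submodule.subset_span hb
      rcases lt_trichotomy (j + 1) k with h | h | h
      · rw [← mul_assoc, run_comm comm (by omega) (by omega), mul_assoc]
        exact key k hk _ (ih (by omega) (by omega) hb')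
      · have : g j * run g k (m - k) = run g j (m - j) := by
          rw [show m - j = (m - k) + 1 by omega, run, h]
        rw [← mul_assoc, this]
        exact key j (by omega) b hb'
      · rcases (show k ≤ j by omega).eq_or_lt with rfl | h'
        · have : g k * run g k (m - k) = run g k (m - k) := by
            rw [show m - k = (m - k - 1) + 1 by omega, run, ← mul_assoc, idem k (by omega)]
          rw [← mul_assoc, this]
          exact key k hk b hb'
        · obtain ⟨s, rfl⟩ : ∃ s, j = k + s + 1 := ⟨j - k - 1, by omega⟩
          rw [← mul_assoc, run_braid braid comm (by omega) (by omega), mul_assoc]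
          exact key k hk _ (ih (by omega) (by omega) hb')

end

theorem gen_rel {x y : FreeAlgebra ℂ (Fin (n - 1))} (h : Rel n x y) :
    RingQuot.mkAlgHom ℂ (Rel n) x = RingQuot.mkAlgHom ℂ (Rel n) y :=
  RingQuot.mkAlgHom_rel ℂ h

theorem gen_idem (i : Fin (n - 1)) : (gen i * gen i : H n) = gen i := by
  have := gen_rel (Rel.idem i)
  rwa [map_mul] at this

theorem gen_braid (i j : Fin (n - 1)) (h : (j : ℕ) = i + 1) :
    (gen i * gen j * gen i : H n) = gen j * gen i * gen j := by
  have := gen_rel (Rel.braid i j h)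
  rwa [map_mul, map_mul, map_mul, map_mul] at this

theorem gen_comm (i j : Fin (n - 1)) (h : (i : ℕ) + 2 ≤ j) :
    (gen i * gen j : H n) = gen j * gen i := by
  have := gen_rel (Rel.comm i j h)
  rwa [map_mul, map_mul] at this

/-- `H_n(0)` is spanned by `n!` elements. -/
theorem exists_spanning (n : ℕ) :
    ∃ s : Finset (H n), s.card ≤ n.factorial ∧ Submodule.span ℂ (s : Set (H n)) = ⊤ := by
  let g : ℕ → H n := fun i => if h : i < n - 1 then gen ⟨i, h⟩ else 0
  have gv : ∀ i (h : i < n - 1), g i = gen ⟨i, h⟩ := fun i h => dif_pos h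
  refine ⟨normalForms g n, card_normalForms g n, ?_⟩
  rw [eq_top_iff]
  rintro h -
  suffices ∀ x ∈ Submodule.span ℂ (normalForms g n : Set (H n)),
      h * x ∈ Submodule.span ℂ (normalForms g n : Set (H n)) by
    have := this 1 (Submodule.subset_span (one_mem_normalForms g n))
    rwa [mul_one] at this
  induction h using H_induction with
  | scalar c => intro x hx; rw [← Algebra.smul_def]; exact Submodule.smul_mem _ c hx
  | gen i =>
    intro x hx
    rw [← gv i i.2]
    refine mul_mem_span_normalForms (N := n - 1) ?_ ?_ ?_ (by omega) (by omega) hx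
    · intro i hi; rw [gv i hi, gen_idem]
    · intro i hi
      rw [gv i (by omega), gv (i + 1) hi]
      exact gen_braid _ _ rfl
    · intro i j h hj
      rw [gv i (by omega), gv j hj]
      exact gen_comm _ _ h
  | mul a b ha hb => intro x hx; rw [mul_assoc]; exact ha _ (hb x hx)
  | add a b ha hb => intro x hx; rw [add_mul]; exact Submodule.add_mem _ (ha x hx) (hb x hx)

/-! ### The regular representation on permutations -/

/-- The action of `π_{i+1}` on permutations, considered as words. -/
def bubPerm (i : Fin (n - 1)) (v : Equiv.Perm (Fin n)) : Equiv.Perm (Fin n) :=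
  if v (lo i) < v (hi i) then v * adj i else v

theorem bubPerm_of_lt {i : Fin (n - 1)} {v : Equiv.Perm (Fin n)} (h : v (lo i) < v (hi i)) :
    bubPerm i v = v * adj i := if_pos h

theorem bubPerm_of_gt {i : Fin (n - 1)} {v : Equiv.Perm (Fin n)} (h : v (hi i) < v (lo i)) :
    bubPerm i v = v := if_neg h.not_gt

theorem bubPerm_mul_adj {i : Fin (n - 1)} {v : Equiv.Perm (Fin n)} (h : v (hi i) < v (lo i)) :
    bubPerm i (v * adj i) = v := by
  rw [bubPerm_of_lt (by simpa using h)]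
  ext k; simp

theorem perm_induction {Pr : Equiv.Perm (Fin n) → Prop} (one : Pr 1)
    (step : ∀ v (i : Fin (n - 1)), v (hi i) < v (lo i) → Pr (v * adj i) → Pr v)
    (v : Equiv.Perm (Fin n)) : Pr v := by
  suffices ∀ w : Fin n → ℕ, ∀ v : Equiv.Perm (Fin n), (fun k => (v k : ℕ)) = w → Pr v from
    this _ v rfl
  intro w
  induction w using word_induction with
  | base w hw =>
    rintro v rfl
    have hv : StrictMono v := by
      refine Monotone.strictMono_of_injective (fun j k h => ?_) v.injective
      exact Fin.le_def.2 (hw h)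
    have : v = 1 := by
      ext k
      have e : (⟨v, hv.le_iff_le⟩ : Fin n ≃o Fin n) = OrderIso.refl _ := Subsingleton.elim _ _
      exact congrArg (fun e : Fin n ≃o Fin n => (e k : ℕ)) e
    rwa [this]
  | step w i hd ih =>
    rintro v rfl
    exact step v i (Fin.lt_def.2 hd) (ih _ rfl)

/-- The action of `H_n(0)` on permutations by operators that turn ascents into descents. -/
def permMoves (n : ℕ) : Moves n (Equiv.Perm (Fin n)) ℕ where
  pos v k := if h : 1 ≤ k ∧ k ≤ n then (v ⟨k - 1, by omega⟩ : ℕ) else 0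
  sw x y := x < y ∧ ¬ (False ∧ False)
  kill x y := x < y ∧ False ∧ False
  s i v := if h : 1 ≤ i ∧ i < n then v * adj ⟨i - 1, by omega⟩ else v
  A i := Finsupp.linearCombination ℂ fun v =>
    if h : 1 ≤ i ∧ i < n then Finsupp.single (bubPerm ⟨i - 1, by omega⟩ v) 1 else 0
  inj v v' h := by
    ext k
    have := h (k + 1) (by omega) (by omega)
    simpa using this
  hs i v h1 h2 _ j hj hj' := by
    obtain ⟨i, rfl⟩ : ∃ i', i = i' + 1 := ⟨i - 1, by omega⟩
    obtain ⟨j, rfl⟩ : ∃ j', j = j' + 1 := ⟨j - 1, by omega⟩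
    rw [dif_pos ⟨hj, hj'⟩, dif_pos ⟨h1, h2⟩]
    have e : Equiv.swap (i + 1) (i + 1 + 1) (j + 1) =
        (adj (n := n) ⟨i, by omega⟩ ⟨j, by omega⟩ : ℕ) + 1 := by
      simp only [adj, Equiv.swap_apply_def, Fin.ext_iff]
      simp only [lo_val, hi_val, Nat.add_right_cancel_iff]
      split_ifs <;> simp [*]
    rw [e, dif_pos ⟨by omega, by omega⟩]
    rfl
  hsw i v h1 h2 h := by
    obtain ⟨i, rfl⟩ : ∃ i', i = i' + 1 := ⟨i - 1, by omega⟩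
    rw [dif_pos ⟨h1, h2.le⟩, dif_pos ⟨by omega, h2⟩] at h
    rw [Finsupp.linearCombination_single, one_smul, dif_pos ⟨h1, h2⟩, dif_pos ⟨h1, h2⟩,
      bubPerm_of_lt (Fin.lt_def.2 h.1)]
  hkill i v h1 h2 _ h := h.2.1.elim
  hfix i v h1 h2 h _ := by
    obtain ⟨i, rfl⟩ : ∃ i', i = i' + 1 := ⟨i - 1, by omega⟩
    rw [dif_pos ⟨h1, h2.le⟩, dif_pos ⟨by omega, h2⟩] at h
    rw [Finsupp.linearCombination_single, one_smul, dif_pos ⟨h1, h2⟩, bubPerm, if_neg]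
    exact fun h' => h ⟨Fin.lt_def.1 h', fun h => h.1⟩
  asymm x y h := by constructor <;> omega
  braid := braid_imm id fun _ => False

/-- The `ℂ`-span of the permutations of `Fin n`, as a module over `H_n(0)`. -/
def PermMod (n : ℕ) : Type := Equiv.Perm (Fin n) →₀ ℂ

instance : AddCommGroup (PermMod n) := inferInstanceAs (AddCommGroup (Equiv.Perm (Fin n) →₀ ℂ))

instance : Module ℂ (PermMod n) := inferInstanceAs (Module ℂ (Equiv.Perm (Fin n) →₀ ℂ))

instance : Module (H n) (PermMod n) :=
  Module.compHom (Equiv.Perm (Fin n) →₀ ℂ) (permMoves n).toRep.toRingHom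

instance : IsScalarTower ℂ (H n) (PermMod n) where
  smul_assoc c h x := by
    show (permMoves n).toRep (c • h) x = c • (permMoves n).toRep h x
    rw [map_smul]; rfl

/-- The basis vector of a permutation. -/
def permVec (v : Equiv.Perm (Fin n)) : PermMod n := (Finsupp.single v 1 : Equiv.Perm (Fin n) →₀ ℂ)

theorem permMoves_single (i : Fin (n - 1)) (v : Equiv.Perm (Fin n)) :
    (permMoves n).A (i + 1) (Finsupp.single v 1) = Finsupp.single (bubPerm i v) 1 := by
  refine (Finsupp.linearCombination_single ℂ _ _).trans ?_
  rw [one_smul, dif_pos ⟨by omega, by omega⟩]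
  rfl

theorem gen_smul_permVec (i : Fin (n - 1)) (v : Equiv.Perm (Fin n)) :
    (gen i : H n) • permVec v = permVec (bubPerm i v) := by
  have : (gen i : H n) • permVec v = (permMoves n).toRep (gen i) (Finsupp.single v 1) := rfl
  rw [this, Moves.toRep, rep_gen]
  exact permMoves_single i v

/-- The basis of the permutation module. -/
def permBasis (n : ℕ) : Module.Basis (Equiv.Perm (Fin n)) ℂ (PermMod n) := ⟨LinearEquiv.refl ℂ _⟩

theorem permBasis_apply (v : Equiv.Perm (Fin n)) : permBasis n v = permVec v := rfl

instance : Module.Finite ℂ (PermMod n) := Module.Finite.of_basis (permBasis n)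

/-- The orbit map `h ↦ h • 1`. -/
def orbitMap (n : ℕ) : H n →ₗ[H n] PermMod n := LinearMap.toSpanSingleton (H n) _ (permVec 1)

theorem orbitMap_surjective (n : ℕ) : Function.Surjective (orbitMap n) := by
  have key : ∀ v, permVec v ∈ LinearMap.range (orbitMap n) := by
    intro v
    induction v using perm_induction with
    | one => exact ⟨1, one_smul _ _⟩
    | step v i hd ih =>
      rw [← bubPerm_mul_adj hd, ← gen_smul_permVec]
      exact Submodule.smul_mem _ _ ih
  intro x
  have : x ∈ Submodule.span ℂ (Set.range (permBasis n)) := by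
    rw [(permBasis n).span_eq]; trivial
  refine Submodule.span_le (p := (LinearMap.range (orbitMap n)).restrictScalars ℂ).2 ?_ this
  rintro _ ⟨v, rfl⟩
  exact key v

theorem finite_H (n : ℕ) : Module.Finite ℂ (H n) :=
  let ⟨s, _, hs⟩ := exists_spanning n
  ⟨⟨s, hs⟩⟩

theorem orbitMap_bijective (n : ℕ) : Function.Bijective (orbitMap n) := by
  have := finite_H n
  obtain ⟨s, hs, hs'⟩ := exists_spanning n
  let f : H n →ₗ[ℂ] PermMod n := (orbitMap n).restrictScalars ℂ
  have hf : Function.Surjective f := orbitMap_surjective n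
  have h1 : Module.finrank ℂ (H n) ≤ n.factorial := by
    rw [← finrank_top ℂ (H n), ← hs']
    exact (finrank_span_finset_le_card s).trans hs
  have h2 : Module.finrank ℂ (PermMod n) = n.factorial := by
    rw [Module.finrank_eq_card_basis (permBasis n), Fintype.card_perm, Fintype.card_fin]
  have h3 := LinearMap.finrank_le_finrank_of_surjective hf
  exact ⟨(LinearMap.injective_iff_surjective_of_finrank_eq_finrank
    (by omega : Module.finrank ℂ (H n) = _)).2 hf, hf⟩

/-- The permutation module is the regular module. -/
def permEquiv (n : ℕ) : H n ≃ₗ[H n] PermMod n := LinearEquiv.ofBijective _ (orbitMap_bijective n)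

instance : Module.Projective (H n) (PermMod n) := Module.Projective.of_equiv (permEquiv n)

/-! ### Characters of modules and essential epimorphisms -/

/-- Every nonzero module over `H_n(0)` has a one-dimensional quotient. -/
theorem exists_character (X : Type) [AddCommGroup X] [Module (H n) X] [Module ℂ X]
    [IsScalarTower ℂ (H n) X] [Nontrivial X] :
    ∃ (χ : ℕ → ℂ) (g : X →ₗ[ℂ] ℂ), g ≠ 0 ∧
      ∀ (i : Fin (n - 1)) x, g ((gen i : H n) • x) = χ (i + 1) * g x := by
  -- The dual space is a module by the anti-automorphism that fixes the generators.
  let A : Fin (n - 1) → Module.End ℂ (Module.Dual ℂ X) := fun i =>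
    (Algebra.lsmul ℂ ℂ X (gen i : H n)).dualMap
  have hA : ∀ i (f : Module.Dual ℂ X) x, A i f x = f ((gen i : H n) • x) := fun _ _ _ => rfl
  let ρ : H n →ₐ[ℂ] Module.End ℂ (Module.Dual ℂ X) := rep A
    (fun i => by
      ext f x
      simp only [Module.End.mul_apply, hA]
      rw [← mul_smul, gen_idem])
    (fun i j h => by
      ext f x
      simp only [Module.End.mul_apply, hA]
      rw [← mul_smul, ← mul_smul, ← mul_smul, ← mul_smul, gen_braid i j h])
    (fun i j h => by
      ext f x
      simp only [Module.End.mul_apply, hA]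
      rw [← mul_smul, ← mul_smul, gen_comm i j h])
  have hρ : ∀ i, ρ (gen i) = A i := fun i => rep_gen _ _ _ _ i
  obtain ⟨x₀, hx₀⟩ := exists_ne (0 : X)
  obtain ⟨f₀, hf₀⟩ : ∃ f : Module.Dual ℂ X, f x₀ ≠ 0 := by
    by_contra h
    push Not at h
    exact hx₀ ((Module.forall_dual_apply_eq_zero_iff ℂ x₀).1 h)
  let z : Equiv.Perm (Fin n) → Module.Dual ℂ X := fun v => ρ ((permEquiv n).symm (permVec v)) f₀
  have hz : ∀ i v, A i (z v) = z (bubPerm i v) := by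
    intro i v
    show A i (ρ _ f₀) = ρ _ f₀
    rw [← gen_smul_permVec, map_smul, smul_eq_mul, map_mul, hρ]
    rfl
  have hz1 : z 1 = f₀ := by
    have : (permEquiv n).symm (permVec 1) = 1 := by
      rw [LinearEquiv.symm_apply_eq]; exact (one_smul (H n) (permVec (1 : Equiv.Perm (Fin n)))).symm
    show ρ _ f₀ = f₀
    rw [this, map_one]; rfl
  classical
  obtain ⟨v, hv, hmax⟩ := Finset.exists_max_image (Finset.univ.filter fun v => z v ≠ 0)
    (fun v => toLex (v : Fin n → Fin n)) ⟨1, by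
      simp only [Finset.mem_filter, Finset.mem_univ, true_and, hz1]
      rintro rfl; exact hf₀ rfl⟩
  simp only [Finset.mem_filter, Finset.mem_univ, true_and] at hv hmax
  have key : ∀ i : Fin (n - 1), ∃ c : ℂ, A i (z v) = c • z v := by
    intro i
    rw [hz]
    rcases lt_or_ge (v (lo i)) (v (hi i)) with h | h
    · refine ⟨0, ?_⟩
      rw [zero_smul]
      by_contra hne
      have := hmax _ hne
      refine absurd this (not_le.2 ⟨lo i, fun j hj => ?_, ?_⟩)
      · rw [bubPerm_of_lt h]
        show v j = v (adj i j)
        rw [adj_of_ne hj.ne (hj.trans (lo_lt_hi i)).ne]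
      · rw [bubPerm_of_lt h]
        show v (lo i) < v (adj i (lo i))
        rwa [adj_lo]
    · exact ⟨1, by rw [bubPerm, if_neg h.not_gt, one_smul]⟩
  choose c hc using key
  refine ⟨fun k => if h : k - 1 < n - 1 then c ⟨k - 1, h⟩ else 0, z v, hv, fun i x => ?_⟩
  dsimp only
  rw [dif_pos (show (i : ℕ) + 1 - 1 < n - 1 by omega), ← hA, hc]
  rfl

/-- Every proper submodule is annihilated by a nonzero character. -/
theorem exists_character_of_ne_top {A : Type} [AddCommGroup A] [Module (H n) A] [Module ℂ A]
    [IsScalarTower ℂ (H n) A] {N : Submodule (H n) A} (hN : N ≠ ⊤) :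
    ∃ (χ : ℕ → ℂ) (g : A →ₗ[ℂ] ℂ), g ≠ 0 ∧
      (∀ (i : Fin (n - 1)) x, g ((gen i : H n) • x) = χ (i + 1) * g x) ∧ ∀ x ∈ N, g x = 0 := by
  have : Nontrivial (A ⧸ N) := Submodule.Quotient.nontrivial_iff.2 hN
  obtain ⟨χ, φ, hφ, hχ⟩ := exists_character (n := n) (A ⧸ N)
  refine ⟨χ, φ ∘ₗ N.mkQ.restrictScalars ℂ, fun h => hφ ?_, fun i x => hχ i (N.mkQ x),
    fun x hx => ?_⟩
  · refine LinearMap.ext fun y => ?_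
    obtain ⟨x, rfl⟩ := N.mkQ_surjective y
    exact LinearMap.congr_fun h x
  · have : N.mkQ x = 0 := (Submodule.Quotient.mk_eq_zero _).2 hx
    exact (congrArg φ this).trans (map_zero φ)

/-- A surjection of finitely generated modules is essential if its kernel is annihilated by all
characters of its source. -/
theorem isEssentialEpi_of_character {A B : Type} [AddCommGroup A] [Module (H n) A] [Module ℂ A]
    [IsScalarTower ℂ (H n) A] [AddCommGroup B] [Module (H n) B] (f : A →ₗ[H n] B)
    (hA : Module.Finite (H n) A) (hf : Function.Surjective f)
    (h : ∀ (χ : ℕ → ℂ) (g : A →ₗ[ℂ] ℂ),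
      (∀ (i : Fin (n - 1)) x, g ((gen i : H n) • x) = χ (i + 1) * g x) →
      ∀ x, f x = 0 → g x = 0) : IsEssentialEpi f where
  finite_source := hA
  finite_target := Module.Finite.of_surjective f hf
  surjective := hf
  essential X _ _ g hg := by
    rw [← LinearMap.range_eq_top]
    by_contra hne
    obtain ⟨χ, φ, hφ, hχ, h0⟩ := exists_character_of_ne_top hne
    apply hφ
    refine LinearMap.ext fun x => ?_
    obtain ⟨x', hx'⟩ := hg (f x)
    have e1 : φ (x - g x') = 0 := h χ φ hχ _ (by rw [map_sub, sub_eq_zero]; exact hx'.symm)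
    rw [map_sub, h0 _ ⟨x', rfl⟩, sub_zero] at e1
    exact e1

/-! ### Standardization -/

/-- The places that precede `k` in the standardization of `w`: those of smaller letters, and those
of the equal letters to the right of `k`. -/
def before (w : Fin n → ℕ) (k : Fin n) : Finset (Fin n) :=
  Finset.univ.filter fun j => w j < w k ∨ (w j = w k ∧ k < j)

section
variable {w : Fin n → ℕ}

theorem mem_before {j k : Fin n} : j ∈ before w k ↔ w j < w k ∨ (w j = w k ∧ k < j) := by
  simp [before]

theorem notMem_before_self (k : Fin n) : k ∉ before w k := by simp [mem_before]

theorem card_before_lt {j k : Fin n} (h : j ∈ before w k) :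
    (before w j).card < (before w k).card := by
  refine Finset.card_lt_card ((Finset.ssubset_iff_of_subset fun i hi => ?_).2
    ⟨j, h, notMem_before_self j⟩)
  simp only [mem_before, Fin.lt_def] at *
  omega

theorem card_before (w : Fin n → ℕ) (k : Fin n) : (before w k).card < n := by
  have := Finset.card_lt_card (Finset.ssubset_univ_iff.2 fun e : before w k = Finset.univ =>
    notMem_before_self (w := w) k (by rw [e]; exact Finset.mem_univ k))
  simpa using this

theorem mem_before_or {j k : Fin n} (h : j ≠ k) : j ∈ before w k ∨ k ∈ before w j := by
  have : (j : ℕ) ≠ k := fun e => h (Fin.ext e)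
  simp only [mem_before, Fin.lt_def]
  omega

/-- The standardization of a word: the permutation that numbers the places by increasing letters,
equal letters being numbered from right to left. For the word of a ribbon tableau, it
sends an entry to the number of its box when the boxes are read column by column, from bottom
to top. -/
def std (w : Fin n → ℕ) : Equiv.Perm (Fin n) :=
  Equiv.ofBijective (fun k => ⟨(before w k).card, card_before w k⟩) <|
    Finite.injective_iff_bijective.1 fun j k e => by
      by_contra h
      have e := Fin.ext_iff.1 e
      dsimp only at e
      rcases mem_before_or (w := w) h with h | h <;> have := card_before_lt h <;> omega

theorem std_val (w : Fin n → ℕ) (k : Fin n) : (std w k : ℕ) = (before w k).card := rfl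

theorem std_lt_iff {j k : Fin n} : std w j < std w k ↔ w j < w k ∨ (w j = w k ∧ k < j) := by
  rw [← mem_before, Fin.lt_def, std_val, std_val]
  refine ⟨fun h => ?_, card_before_lt⟩
  by_contra hn
  have : j ≠ k := by rintro rfl; omega
  have := card_before_lt ((mem_before_or (w := w) this).resolve_left hn)
  omega

theorem std_comp_adj {i : Fin (n - 1)} (h : w (lo i) ≠ w (hi i)) :
    std (w ∘ adj i) = std w * adj i := by
  ext k
  show (before _ k).card = (before w (adj i k)).card
  refine Finset.card_bij (fun j _ => adj i j) ?_ (fun a _ b _ e => (adj i).injective e) ?_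
  · intro j hj
    rw [mem_before] at hj ⊢
    refine hj.imp id fun hj => ⟨hj.1, adj_lt_adj hj.2 ?_⟩
    rintro ⟨rfl, rfl⟩
    simp at hj
    exact h hj.1
  · intro j hj
    refine ⟨adj i j, ?_, adj_adj i j⟩
    rw [mem_before] at hj ⊢
    simp only [Function.comp_apply, adj_adj]
    refine hj.imp id fun hj => ⟨hj.1, ?_⟩
    have := adj_lt_adj (i := i) hj.2 ?_
    · rwa [adj_adj] at this
    · rintro ⟨e, rfl⟩
      rw [e] at hj
      exact h hj.1.symm

variable {ct : ℕ → ℕ}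

theorem psum_le_std (hw : Content ct w) (k : Fin n) : psum ct (w k) ≤ std w k := by
  rw [std_val, ← hw.card_lt]
  refine Finset.card_le_card fun j hj => ?_
  rw [mem_before]
  simp only [Finset.mem_filter, Finset.mem_univ, true_and] at hj
  exact Or.inl hj

theorem before_subset (k : Fin n) :
    before w k ⊆ (Finset.univ.filter fun j => w j < w k + 1).erase k := by
  intro j hj
  rw [Finset.mem_erase]
  refine ⟨?_, ?_⟩
  · rintro rfl; exact notMem_before_self _ hj
  · rw [mem_before] at hj
    simp only [Finset.mem_filter, Finset.mem_univ, true_and]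
    omega

theorem std_lt_psum (hw : Content ct w) (k : Fin n) : (std w k : ℕ) < psum ct (w k + 1) := by
  have h1 := Finset.card_le_card (before_subset (w := w) k)
  have hk : k ∈ Finset.univ.filter fun j => w j < w k + 1 := by simp
  have h2 := Finset.card_pos.2 ⟨k, hk⟩
  rw [Finset.card_erase_of_mem hk, hw.card_lt] at h1
  rw [hw.card_lt] at h2
  rw [std_val]
  omega

theorem std_first (hw : Content ct w) {f : Fin n} (hf : ∀ j, w j = w f → f ≤ j) :
    (std w f : ℕ) + 1 = psum ct (w f + 1) := by
  have hk : f ∈ Finset.univ.filter fun j => w j < w f + 1 := by simp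
  have h2 := Finset.card_pos.2 ⟨f, hk⟩
  have : before w f = (Finset.univ.filter fun j => w j < w f + 1).erase f := by
    refine (before_subset f).antisymm fun j hj => ?_
    rw [Finset.mem_erase] at hj
    simp only [Finset.mem_filter, Finset.mem_univ, true_and] at hj
    rw [mem_before]
    rcases (show w j ≤ w f by omega).lt_or_eq with h | h
    · exact Or.inl h
    · exact Or.inr ⟨h, lt_of_le_of_ne (hf j h) (Ne.symm hj.1)⟩
  rw [std_val, this, Finset.card_erase_of_mem hk, ← hw.card_lt]
  omega

theorem std_last (hw : Content ct w) {l : Fin n} (hl : ∀ j, w j = w l → j ≤ l) :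
    (std w l : ℕ) = psum ct (w l) := by
  rw [std_val, ← hw.card_lt]
  congr 1
  ext j
  rw [mem_before]
  simp only [Finset.mem_filter, Finset.mem_univ, true_and, or_iff_left_iff_imp]
  rintro ⟨h1, h2⟩
  exact absurd h2 (hl j h1).not_gt

theorem std_injOn {w' : Fin n → ℕ} (hw : Content ct w) (hw' : Content ct w')
    (e : std w = std w') : w = w' := by
  funext k
  have h1 := psum_le_std hw k
  have h2 := std_lt_psum hw k
  have h1' := psum_le_std hw' k
  have h2' := std_lt_psum hw' k
  rw [← e] at h1' h2'
  rcases lt_trichotomy (w k) (w' k) with h | h | h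
  · have := psum_mono ct (show w k + 1 ≤ w' k from h); omega
  · exact h
  · have := psum_mono ct (show w' k + 1 ≤ w k from h); omega

theorem std_adjacent {i : Fin (n - 1)} (h : w (lo i) = w (hi i)) :
    (std w (hi i) : ℕ) + 1 = std w (lo i) := by
  have : before w (lo i) = insert (hi i) (before w (hi i)) := by
    ext j
    rw [Finset.mem_insert, mem_before, mem_before]
    simp only [Fin.lt_def, Fin.ext_iff, lo_val, hi_val]
    by_cases hj : (j : ℕ) = i + 1
    · have : j = hi i := Fin.ext hj
      subst this
      simp [h]
    · simp only [hj, false_or, h]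
      omega
  rw [std_val, std_val, this, Finset.card_insert_of_notMem (notMem_before_self _)]

theorem exists_last {p : ℕ} (h : ∃ k, w k = p) : ∃ f : Fin n, w f = p ∧ ∀ j, w j = p → j ≤ f := by
  classical
  obtain ⟨k, hk⟩ := h
  obtain ⟨f, hf, hf'⟩ := Finset.exists_max_image (Finset.univ.filter fun k => w k = p) id
    ⟨k, by simpa using hk⟩
  exact ⟨f, by simpa using hf, fun j hj => hf' j (by simpa using hj)⟩

end

/-! ### Row-antisymmetrized permutations -/

open Classical in
/-- The number of the row of position `m`, where the positions `m - 1` and `m` are in the same row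
if and only if `m ∈ R`. -/
def rowIx (R : Set ℕ) (m : ℕ) : ℕ := ((Finset.Icc 1 m).filter (· ∉ R)).card

theorem rowIx_mono (R : Set ℕ) : Monotone (rowIx R) := fun a b h => by
  classical
  refine Finset.card_le_card fun j hj => ?_
  simp only [Finset.mem_filter, Finset.mem_Icc] at hj ⊢
  exact ⟨⟨hj.1.1, hj.1.2.trans h⟩, hj.2⟩

theorem rowIx_succ_eq_iff {R : Set ℕ} {m : ℕ} : rowIx R (m + 1) = rowIx R m ↔ m + 1 ∈ R := by
  classical
  unfold rowIx
  rw [← Finset.insert_Icc_right_eq_Icc_add_one (by omega), Finset.filter_insert]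
  split_ifs with h
  · simpa using h
  · rw [Finset.card_insert_of_notMem (by simp)]
    simp [h]

/-- The positions `m` such that the entry at `m - 1` is smaller than the one at `m`; here `v` maps
entries to positions. -/
def Asc (v : Equiv.Perm (Fin n)) : Set ℕ :=
  {m | ∃ x y : Fin n, x < y ∧ (v x : ℕ) + 1 = m ∧ (v y : ℕ) = m}

section
variable {R : Set ℕ} {v : Equiv.Perm (Fin n)}

theorem lt_of_rowIx_eq (hR : R ⊆ Asc v) {x y : Fin n} (h : v x < v y)
    (e : rowIx R (v x) = rowIx R (v y)) : x < y := by
  obtain ⟨d, hd⟩ : ∃ d, (v x : ℕ) + d + 1 = v y := ⟨v y - v x - 1, by rw [Fin.lt_def] at h; omega⟩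
  induction d generalizing x with
  | zero =>
    rw [add_zero] at hd
    rw [← hd, eq_comm, rowIx_succ_eq_iff] at e
    obtain ⟨x', y', h1, h2, h3⟩ := hR e
    have e1 : x' = x := v.injective (Fin.ext (by omega))
    have e2 : y' = y := v.injective (Fin.ext (by omega))
    rwa [e1, e2] at h1
  | succ d ih =>
    have m1 := rowIx_mono R (show (v x : ℕ) ≤ v x + 1 by omega)
    have m2 := rowIx_mono R (show (v x : ℕ) + 1 ≤ v y by omega)
    obtain ⟨x', y', h1, h2, h3⟩ := hR (rowIx_succ_eq_iff.1 (show rowIx R (v x + 1) = _ by omega))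
    have e1 : x' = x := v.injective (Fin.ext (by omega))
    rw [e1] at h1
    exact h1.trans (ih (by rw [Fin.lt_def]; omega) (by rw [h3]; omega) (by omega))

/-- The sign of a permutation as a complex number. -/
def sg (v : Equiv.Perm (Fin n)) : ℂ := ((Equiv.Perm.sign v : ℤ) : ℂ)

theorem sg_mul_adj (v : Equiv.Perm (Fin n)) (i : Fin (n - 1)) : sg (v * adj i) = -sg v := by
  unfold sg
  rw [Equiv.Perm.sign_mul, adj, Equiv.Perm.sign_swap (lo_lt_hi i).ne]
  simp

theorem sg_mul_self (v : Equiv.Perm (Fin n)) : sg v * sg v = 1 := by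
  unfold sg
  rw [← Int.cast_mul, Int.units_coe_mul_self, Int.cast_one]

open Classical in
/-- The permutations obtained from `v` by permuting the entries in each row. -/
def rowClass (R : Set ℕ) (v : Equiv.Perm (Fin n)) : Finset (Equiv.Perm (Fin n)) :=
  Finset.univ.filter fun v' => ∀ k, rowIx R (v' k) = rowIx R (v k)

theorem mem_rowClass {v' : Equiv.Perm (Fin n)} :
    v' ∈ rowClass R v ↔ ∀ k, rowIx R (v' k) = rowIx R (v k) := by
  classical
  simp [rowClass]

theorem mul_adj_mem_rowClass {v' : Equiv.Perm (Fin n)} {i : Fin (n - 1)} (h : v' ∈ rowClass R v) :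
    v' * adj i ∈ rowClass R (v * adj i) :=
  mem_rowClass.2 fun k => mem_rowClass.1 h (adj i k)

/-- The alternating sum over the permutations obtained from `v` by permuting the entries in each
row. -/
def antisym (R : Set ℕ) (v : Equiv.Perm (Fin n)) : PermMod n :=
  ∑ v' ∈ rowClass R v, (sg v * sg v') • permVec v'

theorem gen_smul_antisym (i : Fin (n - 1)) : (gen i : H n) • antisym R v =
    ∑ v' ∈ rowClass R v, (sg v * sg v') • permVec (bubPerm i v') := by
  rw [antisym, Finset.smul_sum]
  exact Finset.sum_congr rfl fun v' _ => by rw [smul_comm, gen_smul_permVec]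

theorem gen_smul_antisym_of_gt {i : Fin (n - 1)} (h : rowIx R (v (hi i)) < rowIx R (v (lo i))) :
    (gen i : H n) • antisym R v = antisym R v := by
  rw [gen_smul_antisym, antisym]
  refine Finset.sum_congr rfl fun v' hv' => ?_
  rw [bubPerm_of_gt]
  rw [← mem_rowClass.1 hv', ← mem_rowClass.1 hv'] at h
  exact Fin.lt_def.2 ((rowIx_mono R).reflect_lt h)

theorem gen_smul_antisym_of_lt {i : Fin (n - 1)} (h : rowIx R (v (lo i)) < rowIx R (v (hi i))) :
    (gen i : H n) • antisym R v = antisym R (v * adj i) := by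
  rw [gen_smul_antisym, antisym]
  refine Finset.sum_bij (fun v' _ => v' * adj i) (fun v' hv' => mul_adj_mem_rowClass hv')
    (fun a _ b _ e => mul_right_cancel e) (fun v' hv' => ⟨v' * adj i, ?_, ?_⟩) fun v' hv' => ?_
  · have := mul_adj_mem_rowClass (i := i) hv'
    rwa [mul_assoc v, adj, Equiv.swap_mul_self, mul_one] at this
  · rw [mul_assoc, adj, Equiv.swap_mul_self, mul_one]
  · rw [bubPerm_of_lt, sg_mul_adj, sg_mul_adj, neg_mul_neg]
    rw [← mem_rowClass.1 hv', ← mem_rowClass.1 hv'] at h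
    exact Fin.lt_def.2 ((rowIx_mono R).reflect_lt h)

theorem gen_smul_antisym_of_eq {i : Fin (n - 1)} (h : rowIx R (v (lo i)) = rowIx R (v (hi i))) :
    (gen i : H n) • antisym R v = 0 := by
  rw [gen_smul_antisym]
  refine Finset.sum_involution (fun v' _ => v' * adj i) (fun v' hv' => ?_) (fun v' _ _ e => ?_)
    (fun v' hv' => ?_) (fun v' _ => ?_)
  · have e : bubPerm i (v' * adj i) = bubPerm i v' := by
      have hne : v' (lo i) ≠ v' (hi i) := fun e => (lo_lt_hi i).ne (v'.injective e)
      rcases hne.lt_or_gt with h1 | h1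
      · rw [bubPerm_of_lt h1, bubPerm_of_gt (by simpa using h1)]
      · rw [bubPerm_of_gt h1, bubPerm_mul_adj h1]
    rw [e, sg_mul_adj, mul_neg, neg_smul, add_neg_cancel]
  · have := congrArg (fun u : Equiv.Perm (Fin n) => u (lo i)) e
    simp only [Equiv.Perm.mul_apply, adj_lo] at this
    exact (lo_lt_hi i).ne' (v'.injective this)
  · refine mem_rowClass.2 fun k => ?_
    rw [Equiv.Perm.mul_apply, mem_rowClass.1 hv']
    by_cases h1 : k = lo i
    · rw [h1, adj_lo, h]
    by_cases h2 : k = hi i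
    · rw [h2, adj_hi, h]
    rw [adj_of_ne h1 h2]
  · rw [mul_assoc, adj, Equiv.swap_mul_self, mul_one]

theorem repr_permVec (u v : Equiv.Perm (Fin n)) :
    (permBasis n).repr (permVec u) v = if u = v then 1 else 0 := by
  classical
  rw [← permBasis_apply, Module.Basis.repr_self, Finsupp.single_apply]

theorem repr_antisym_self : (permBasis n).repr (antisym R v) v = 1 := by
  classical
  rw [antisym, map_sum, Finsupp.finsetSum_apply, Finset.sum_eq_single v]
  · rw [map_smul, Finsupp.smul_apply, repr_permVec, if_pos rfl, smul_eq_mul, mul_one, sg_mul_self]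
  · intro u _ hu
    rw [map_smul, Finsupp.smul_apply, repr_permVec, if_neg hu, smul_zero]
  · intro h; exact absurd (mem_rowClass.2 fun _ => rfl) h

/-- If the rows of `v` increase, then `v` is the smallest permutation in its row class, for the
lexicographic order of the lists of entries. -/
theorem le_of_repr_antisym_ne (hR : R ⊆ Asc v) {u : Equiv.Perm (Fin n)}
    (h : (permBasis n).repr (antisym R v) u ≠ 0) :
    toLex (v.symm : Fin n → Fin n) ≤ toLex (u.symm : Fin n → Fin n) := by
  classical
  have hu : u ∈ rowClass R v := by
    by_contra hu
    apply h
    rw [antisym, map_sum, Finsupp.finsetSum_apply]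
    refine Finset.sum_eq_zero fun v' hv' => ?_
    rw [map_smul, Finsupp.smul_apply, repr_permVec, if_neg (by rintro rfl; exact hu hv'),
      smul_zero]
  by_contra hlt
  rw [not_le] at hlt
  obtain ⟨m, hm, hm'⟩ := hlt
  have hm : ∀ j < m, u.symm j = v.symm j := hm
  have hm' : u.symm m < v.symm m := hm'
  -- The entry `e` of `u` at the first difference is further right in the same row of `v`.
  have h1 : m < v (u.symm m) := by
    rcases lt_trichotomy m (v (u.symm m)) with h1 | h1 | h1
    · exact h1
    · rw [h1, Equiv.symm_apply_apply, ← h1] at hm'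
      exact absurd hm' (lt_irrefl _)
    · have := hm _ h1
      rw [Equiv.symm_apply_apply, Equiv.apply_eq_iff_eq] at this
      rw [this] at h1
      exact absurd h1 (lt_irrefl _)
  have h2 := mem_rowClass.1 hu (u.symm m)
  rw [Equiv.apply_symm_apply] at h2
  refine absurd hm' (lt_of_rowIx_eq hR ?_ ?_).not_gt
  · rwa [Equiv.apply_symm_apply]
  · rwa [Equiv.apply_symm_apply]

theorem linearIndependent_antisym (R : Equiv.Perm (Fin n) → Set ℕ) (hR : ∀ v, R v ⊆ Asc v) :
    LinearIndependent ℂ fun v => antisym (R v) v := by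
  classical
  rw [Fintype.linearIndependent_iff]
  intro c hc
  by_contra hne
  push Not at hne
  obtain ⟨v₀, hv₀⟩ := hne
  obtain ⟨v, hv, hmin⟩ := Finset.exists_min_image (Finset.univ.filter fun v => c v ≠ 0)
    (fun v => toLex (v.symm : Fin n → Fin n)) ⟨v₀, by simpa using hv₀⟩
  simp only [Finset.mem_filter, Finset.mem_univ, true_and] at hv hmin
  have e := congrArg (fun x => (permBasis n).repr x v) hc
  simp only [map_sum, map_zero, Finsupp.finsetSum_apply, map_smul, Finsupp.smul_apply,
    Finsupp.zero_apply] at e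
  rw [Finset.sum_eq_single v] at e
  · rw [repr_antisym_self, smul_eq_mul, mul_one] at e
    exact hv e
  · intro u _ hu
    by_cases hcu : c u = 0
    · rw [hcu, zero_smul]
    by_cases hr : (permBasis n).repr (antisym (R u) u) v = 0
    · rw [hr, smul_zero]
    have h1 := le_of_repr_antisym_ne (hR u) hr
    have h2 := hmin u hcu
    have : (u.symm : Fin n → Fin n) = v.symm := toLex.injective (le_antisymm h1 h2)
    exact absurd (by rw [← Equiv.symm_symm u, DFunLike.coe_injective this, Equiv.symm_symm]) hu
  · intro h; exact absurd (Finset.mem_univ v) h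

end

/-! ### Projectivity of the ribbon modules -/

section
variable {a : GenComp n} {w : Fin n → ℕ}

/-- The positions that are in the same row of the ribbon diagram as their predecessor. -/
def rowLinks (a : GenComp n) : Set ℕ := {m | ∃ p, Conn a p ∧ m = psum (cnt a.parts) (p + 1)}

theorem first_last (hw : Content (cnt a.parts) w) {p : ℕ} (hp : Conn a p) :
    ∃ f l : Fin n, w f = p ∧ (∀ j, w j = p → f ≤ j) ∧ w l = p + 1 ∧ (∀ j, w j = p + 1 → j ≤ l) ∧
      (std w f : ℕ) + 1 = psum (cnt a.parts) (p + 1) ∧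
      (std w l : ℕ) = psum (cnt a.parts) (p + 1) := by
  obtain ⟨f, hf, hf'⟩ := exists_first (hw.exists_eq (GenComp.cnt_pos.2
    (show p < a.parts.length by have := hp.1; omega)))
  obtain ⟨l, hl, hl'⟩ := exists_last (hw.exists_eq (GenComp.cnt_pos.2 hp.1))
  refine ⟨f, l, hf, hf', hl, hl', ?_, ?_⟩
  · subst hf; exact std_first hw hf'
  · have := std_last hw (l := l) (by rw [hl]; exact hl')
    rwa [hl] at this

theorem rowLinks_subset (hw : Content (cnt a.parts) w) (hl : ∀ p, Conn a p → Linked w p) :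
    rowLinks a ⊆ Asc (std w) := by
  rintro _ ⟨p, hp, rfl⟩
  obtain ⟨f, l, -, hf', -, hl', e1, e2⟩ := first_last hw hp
  obtain ⟨j, k, hjk, hj, hk⟩ := hl p hp
  exact ⟨f, l, (hf' j hj).trans_lt (hjk.trans_le (hl' k hk)), e1, e2⟩

/-- If the swap of `i` and `i + 1` destroys the row condition, these entries are in the same row. -/
theorem linked_comp_adj (hw : Content (cnt a.parts) w) {i : Fin (n - 1)}
    (h : rowIx (rowLinks a) (std w (lo i)) < rowIx (rowLinks a) (std w (hi i)))
    {p : ℕ} (hp : Conn a p) (hl : Linked w p) : Linked (w ∘ adj i) p := by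
  obtain ⟨f, l, hf, hf', hl1, hl', e1, e2⟩ := first_last hw hp
  obtain ⟨j, k, hjk, hj, hk⟩ := hl
  refine ⟨adj i f, adj i l, adj_lt_adj ((hf' j hj).trans_lt (hjk.trans_le (hl' k hk))) ?_, by
    simpa using hf, by simpa using hl1⟩
  rintro ⟨rfl, rfl⟩
  have := rowIx_succ_eq_iff.2 (show (std w (lo i) : ℕ) + 1 ∈ rowLinks a from ⟨p, hp, e1⟩)
  rw [e1, ← e2] at this
  omega

/-- The embedding of `P_𝛂` into the regular module. -/
def embed (a : GenComp n) : P a →ₗ[ℂ] PermMod n :=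
  (Finsupp.linearCombination ℂ fun T : SRT a => antisym (rowLinks a) (std T.word) :
    (SRT a →₀ ℂ) →ₗ[ℂ] PermMod n)

theorem embed_word (T : SRT a) :
    embed a (vecP a T.word) = antisym (rowLinks a) (std T.word) := by
  rw [vecP_word]
  exact (Finsupp.linearCombination_single ℂ _ _).trans (one_smul _ _)

theorem embed_vecP (hw : Content (cnt a.parts) w) (hl : ∀ p, Conn a p → Linked w p) :
    embed a (vecP a w) = antisym (rowLinks a) (std w) := by
  have := embed_word (SRT.ofWord w hw hl)
  rwa [SRT.word_ofWord] at this

theorem embed_bub (i : Fin (n - 1)) (hw : Content (cnt a.parts) w) :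
    embed a (vecP a (bub i w)) = (gen i : H n) • embed a (vecP a w) := by
  by_cases hl : ∀ p, Conn a p → Linked w p
  swap
  · push Not at hl
    obtain ⟨p, hp, hl⟩ := hl
    rw [vecP_eq_zero hw hp hl, vecP_eq_zero (hw.bub i) hp (not_linked_bub hl), map_zero, smul_zero]
  have hR := rowLinks_subset hw hl
  rw [embed_vecP hw hl]
  have hlh := lo_lt_hi i
  rcases le_or_gt (w (hi i)) (w (lo i)) with hd | hd
  · have h1 : std w (hi i) < std w (lo i) := std_lt_iff.2 (hd.lt_or_eq.imp id fun e => ⟨e, hlh⟩)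
    rw [bub_of_le hd, embed_vecP hw hl, gen_smul_antisym_of_gt]
    refine (rowIx_mono _ (Fin.le_def.1 h1.le)).lt_of_ne fun e => ?_
    exact absurd (lt_of_rowIx_eq hR h1 e) hlh.not_gt
  · have h1 : std w (lo i) < std w (hi i) := std_lt_iff.2 (Or.inl hd)
    have hw' := hw.comp_perm (adj i)
    have hs := std_comp_adj (w := w) hd.ne
    rw [bub_of_lt hd]
    rcases (rowIx_mono (rowLinks a) (Fin.le_def.1 h1.le)).lt_or_eq with h | h
    · rw [gen_smul_antisym_of_lt h, ← hs,
        embed_vecP hw' fun p hp => linked_comp_adj hw h hp (hl p hp)]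
    · rw [gen_smul_antisym_of_eq h]
      have : ¬ ∀ p, Conn a p → Linked (w ∘ adj i) p := by
        intro hl'
        have hR' := rowLinks_subset hw' hl'
        have := lt_of_rowIx_eq hR' (x := hi i) (y := lo i) (by simpa [hs] using h1)
          (by simpa [hs] using h)
        exact absurd this hlh.not_gt
      push Not at this
      obtain ⟨p, hp, hl'⟩ := this
      rw [vecP_eq_zero hw' hp hl', map_zero]

/-- The embedding of `P_𝛂` into the regular module, as a homomorphism. -/
def embedH (a : GenComp n) : P a →ₗ[H n] PermMod n :=
  homOfGen (embed a) (P_map_gen_smul _ fun i _ hw => embed_bub i hw)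

open Classical in
/-- The set of positions at which the rows attached to `v` are linked: for the permutations that
come from tableaux of shape `𝛂` these are the rows of the tableau, for the others the
ascending runs of `v`. -/
def links (a : GenComp n) (v : Equiv.Perm (Fin n)) : Set ℕ :=
  if ∃ T : SRT a, std T.word = v then rowLinks a else Asc v

theorem links_subset (v : Equiv.Perm (Fin n)) : links a v ⊆ Asc v := by
  unfold links
  split_ifs with h
  · obtain ⟨T, rfl⟩ := h
    exact rowLinks_subset T.content fun p hp => T.linked hp
  · exact subset_rfl

/-- A basis of the regular module that contains the images of the tableaux of shape `𝛂`. -/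
def antisymBasis (a : GenComp n) : Module.Basis (Equiv.Perm (Fin n)) ℂ (PermMod n) :=
  basisOfLinearIndependentOfCardEqFinrank (linearIndependent_antisym (links a) links_subset)
    (Module.finrank_eq_card_basis (permBasis n)).symm

theorem antisymBasis_apply (v : Equiv.Perm (Fin n)) : antisymBasis a v = antisym (links a v) v := by
  rw [antisymBasis, coe_basisOfLinearIndependentOfCardEqFinrank]

open Classical in
/-- The projection of the regular module onto `P_𝛂`. -/
def project (a : GenComp n) : PermMod n →ₗ[ℂ] P a :=
  (antisymBasis a).constr ℂ fun v =>
    if h : ∃ T : SRT a, std T.word = v then vecP a h.choose.word else 0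

theorem antisymBasis_std (T : SRT a) : antisymBasis a (std T.word) = embed a (vecP a T.word) := by
  rw [antisymBasis_apply, links, if_pos ⟨T, rfl⟩, embed_word]

theorem project_embed (x : P a) : project a (embed a x) = x := by
  induction x using P_induction with
  | zero => simp
  | add x y hx hy => rw [map_add, map_add, hx, hy]
  | smul c T =>
    have h : ∃ T' : SRT a, std T'.word = std T.word := ⟨T, rfl⟩
    rw [map_smul, map_smul, ← antisymBasis_std, project, Module.Basis.constr_basis, dif_pos h]
    have := std_injOn h.choose.content T.content h.choose_spec
    rw [this]

theorem Asc_mul_adj {v : Equiv.Perm (Fin n)} {i : Fin (n - 1)}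
    (h : rowIx (Asc v) (v (lo i)) < rowIx (Asc v) (v (hi i))) : Asc (v * adj i) = Asc v := by
  have hlt : v (lo i) < v (hi i) := Fin.lt_def.2 ((rowIx_mono _).reflect_lt h)
  ext m
  constructor
  · rintro ⟨x, y, hxy, h1, h2⟩
    refine ⟨adj i x, adj i y, adj_lt_adj hxy ?_, h1, h2⟩
    rintro ⟨rfl, rfl⟩
    simp only [Equiv.Perm.mul_apply, adj_lo, adj_hi] at h1 h2
    rw [Fin.lt_def] at hlt
    omega
  · rintro ⟨x, y, hxy, h1, h2⟩
    refine ⟨adj i x, adj i y, adj_lt_adj hxy ?_, by simpa using h1, by simpa using h2⟩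
    rintro ⟨rfl, rfl⟩
    have := rowIx_succ_eq_iff.2 (show (v (lo i) : ℕ) + 1 ∈ Asc v from ⟨_, _, hxy, rfl, by omega⟩)
    rw [h1, ← h2] at this
    omega

theorem exists_std_of_mul_adj {v : Equiv.Perm (Fin n)} {i : Fin (n - 1)}
    (h : rowIx (Asc v) (v (lo i)) < rowIx (Asc v) (v (hi i))) {T : SRT a}
    (hT : std T.word = v * adj i) : ∃ T' : SRT a, std T'.word = v := by
  have hlt : v (lo i) < v (hi i) := Fin.lt_def.2 ((rowIx_mono _).reflect_lt h)
  have e1 : std T.word (hi i) = v (lo i) := by rw [hT]; simp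
  have e2 : std T.word (lo i) = v (hi i) := by rw [hT]; simp
  rw [← e1, ← e2, std_lt_iff] at hlt
  rcases hlt with hd | ⟨hd, -⟩
  · have hs := std_comp_adj hd.ne'
    have hb := bub_comp_adj hd
    refine ⟨SRT.ofWord (T.word ∘ adj i) (T.content.comp_perm _) fun p hp => ?_, ?_⟩
    · by_contra hl
      have := not_linked_bub (i := i) hl
      rw [hb] at this
      exact this (T.linked hp)
    · rw [SRT.word_ofWord, hs, hT, mul_assoc, adj, Equiv.swap_mul_self, mul_one]
  · have := std_adjacent hd.symm
    rw [e1, e2] at this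
    have := rowIx_succ_eq_iff.2 (show (v (lo i) : ℕ) + 1 ∈ Asc v from
      ⟨_, _, lo_lt_hi i, rfl, by omega⟩)
    rw [‹(v (lo i) : ℕ) + 1 = _›] at this
    omega

theorem project_of_not_exists {v : Equiv.Perm (Fin n)} (h : ¬ ∃ T : SRT a, std T.word = v) :
    project a (antisym (Asc v) v) = 0 := by
  have : antisymBasis a v = antisym (Asc v) v := by rw [antisymBasis_apply, links, if_neg h]
  rw [← this, project, Module.Basis.constr_basis, dif_neg h]

theorem project_gen_smul (i : Fin (n - 1)) (x : PermMod n) :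
    project a ((gen i : H n) • x) = (gen i : H n) • project a x := by
  have hx := (antisymBasis a).mem_span x
  induction hx using Submodule.span_induction with
  | zero => simp
  | add x y _ _ hx hy => rw [smul_add, map_add, hx, hy, map_add, smul_add]
  | smul c x _ hx => rw [smul_comm, map_smul, hx, map_smul, smul_comm]
  | mem x hx =>
    obtain ⟨v, rfl⟩ := hx
    by_cases h : ∃ T : SRT a, std T.word = v
    · obtain ⟨T, rfl⟩ := h
      rw [antisymBasis_std, project_embed, ← embed_bub i T.content, project_embed,
        gen_smul_vecP T.content]
    · rw [antisymBasis_apply, links, if_neg h, project_of_not_exists h, smul_zero]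
      rcases lt_trichotomy (rowIx (Asc v) (v (lo i))) (rowIx (Asc v) (v (hi i))) with h1 | h1 | h1
      · have h' : ¬ ∃ T : SRT a, std T.word = v * adj i :=
          fun ⟨T, hT⟩ => h (exists_std_of_mul_adj h1 hT)
        rw [gen_smul_antisym_of_lt h1, ← Asc_mul_adj h1, project_of_not_exists h']
      · rw [gen_smul_antisym_of_eq h1, map_zero]
      · rw [gen_smul_antisym_of_gt h1, project_of_not_exists h]

/-- The modules `P_𝛂` are projective: they are direct summands of the regular module. -/
instance (a : GenComp n) : Module.Projective (H n) (P a) :=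
  Module.Projective.of_split (embedH a) (homOfGen (project a) project_gen_smul)
    (LinearMap.ext project_embed)

end

/-! ### Characters of the modules `P_𝛂` -/

section
variable {a : GenComp n}

theorem exists_sorted_parts (a : GenComp n) :
    ∃ w : Fin n → ℕ, Monotone w ∧ Content (cnt a.parts) w := by
  have hs : a.parts.sum = n := a.sum_eq
  refine exists_sorted (N := a.parts.length) (fun p => ?_) ?_
  · have := List.sum_take_add_sum_drop a.parts p
    rw [psum_cnt]; omega
  · rw [psum_cnt, List.take_length, hs]

theorem wordChar_vecP {χ : ℕ → ℂ} {g : P a →ₗ[ℂ] ℂ}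
    (hg : ∀ (i : Fin (n - 1)) x, g ((gen i : H n) • x) = χ (i + 1) * g x) :
    WordChar (n := n) (cnt a.parts) {p | Conn a p} χ fun w => g (vecP a w) where
  smul w hw i := by rw [← gen_smul_vecP hw, hg]
  zero w hw p hp hl := by rw [vecP_eq_zero hw hp hl, map_zero]

theorem P_hom_ext {B : Type} [AddCommGroup B] [Module ℂ B] {f g : P a →ₗ[ℂ] B}
    (h : ∀ T : SRT a, f (vecP a T.word) = g (vecP a T.word)) : f = g := by
  refine LinearMap.ext fun x => ?_
  induction x using P_induction with
  | zero => simp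
  | add x y hx hy => rw [map_add, map_add, hx, hy]
  | smul c T => rw [map_smul, map_smul, h]

/-- A linear form vanishes at `x` if it vanishes at the tableaux that occur in `x`. -/
theorem eq_zero_of_coeffP (g : P a →ₗ[ℂ] ℂ) (x : P a)
    (h : ∀ T : SRT a, coeffP T x ≠ 0 → g (vecP a T.word) = 0) : g x = 0 := by
  have e : g = (Finsupp.linearCombination ℂ fun T : SRT a => g (vecP a T.word) :
      (SRT a →₀ ℂ) →ₗ[ℂ] ℂ) := by
    refine P_hom_ext fun T => ?_
    conv_rhs => rw [vecP_word]
    exact ((Finsupp.linearCombination_single (v := fun T : SRT a => g (vecP a T.word)) ℂ 1 T).trans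
      (one_smul ℂ _)).symm
  rw [e]
  refine (Finsupp.linearCombination_apply ℂ _).trans (Finset.sum_eq_zero fun T hT => ?_)
  dsimp only
  rw [h T (Finsupp.mem_support_iff.1 hT), smul_zero]

open Classical in
theorem coeffP_vecP_of_content (T : SRT a) {w : Fin n → ℕ} (hw : Content (cnt a.parts) w) :
    coeffP T (vecP a w) = if w = T.word then 1 else 0 := by
  by_cases h : ∀ p, Conn a p → Linked w p
  · have := coeffP_vecP T (SRT.ofWord w hw h)
    rw [SRT.word_ofWord] at this
    rw [this]
    congr 1
    rw [← SRT.word_injective.eq_iff, SRT.word_ofWord]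
  · rw [if_neg]
    · push Not at h
      obtain ⟨p, hp, hl⟩ := h
      rw [vecP_eq_zero hw hp hl, map_zero]
    · rintro rfl; exact h fun p hp => T.linked hp

instance : Module.Finite (H n) (PermMod n) := Module.Finite.of_surjective _ (orbitMap_surjective n)

instance (a : GenComp n) : Module.Finite (H n) (P a) :=
  Module.Finite.of_surjective (homOfGen (project a) project_gen_smul) fun x =>
    ⟨embed a x, project_embed x⟩

end

/-! ### `Φ` is a projective cover -/

section
variable {α : Composition n}

/-- The characters of `P_α` vanish on the kernel of `Φ`: a tableau at which a character is nonzero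
crosses no boundary between columns, and so is immaculate. -/
theorem eq_zero_of_Phi_eq_zero {χ : ℕ → ℂ} {g : P (GenComp.single α) →ₗ[ℂ] ℂ}
    (hg : ∀ (i : Fin (n - 1)) x, g ((gen i : H n) • x) = χ (i + 1) * g x)
    (x : P (GenComp.single α)) (hx : Phi α x = 0) : g x = 0 := by
  refine eq_zero_of_coeffP g x fun T hT => ?_
  by_contra hne
  have hc := wordChar_vecP hg
  obtain ⟨w₀, hm, hw₀⟩ := exists_sorted_parts (GenComp.single α)
  have h0 := hc.sorted_ne T.content hne hm hw₀
  have nc : ∀ p, p + 1 < α.length → NoCross (cnt α.blocks) T.word (p + 1) := by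
    intro p hp
    have h1 : 0 < cnt (GenComp.single α).parts p := by
      rw [single_parts, cnt_blocks_pos]; omega
    have h2 : 0 < cnt (GenComp.single α).parts (p + 1) := by
      rw [single_parts, cnt_blocks_pos]; omega
    have := hc.noCross T.content hne (hc.chi_eq_zero hm hw₀ h0 (conn_single.2 hp) h1 h2)
    rwa [single_parts] at this
  have hw : Content (cnt α.blocks) T.word := by
    have := T.content
    rwa [single_parts] at this
  have hS : IsSIT α T.entry := by
    rw [← T.fillW_word, isSIT_fillW hw]
    intro p q hpq k hk _
    have hq := cnt_blocks_pos.1 (hk ▸ hw.pos k)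
    obtain ⟨j, hj⟩ := hw.exists_eq (cnt_blocks_pos.2 (show p < α.length by omega))
    exact ⟨j, (nc p (by omega)).lt hw (by omega) (by omega), hj⟩
  apply hT
  rw [← coeffV_Phi x T hS, hx, map_zero]

theorem isProjectiveCover_PhiH (α : Composition n) : IsProjectiveCover (PhiH α) where
  projective := inferInstance
  essentialEpi := isEssentialEpi_of_character _ inferInstance (PhiH_surjective α)
    fun _ _ hg x hx => eq_zero_of_Phi_eq_zero hg x hx

end

/-! ### `∂₁` is a projective cover of its image -/

section
variable {α : Composition n} {i : calI α} {w : Fin n → ℕ}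

theorem cnt_bal_pos {p : ℕ} : 0 < cnt (bal α i).parts p ↔ p < α.length := by
  rw [GenComp.cnt_pos, bal_parts_length]

/-- If `τ` crosses no boundary between columns of one component, then `L(τ)` satisfies the row
conditions. -/
theorem linked_raise (hw : Content (cnt (bal α i).parts) w)
    (nc : ∀ p, p + 1 < α.length → p ≠ i + 1 → NoCross (cnt (bal α i).parts) w (p + 1))
    {p : ℕ} (hp : p + 1 < α.length) : Linked (raise i w) p := by
  have hu := content_raise hw
  obtain ⟨f, hf, hf'⟩ := exists_first_bal hw
  have hi' := calI.lt i
  have h0 : ∀ k, raise i w k = if k = f then (i : ℕ) + 1 else w k := fun k => by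
    rw [raise_eq hf hf', Function.update_apply]
  by_cases h1 : p = i + 1
  · obtain ⟨k, hk⟩ := hu.exists_eq (cnt_blocks_pos.2 hp)
    have hk' := hk
    rw [h0] at hk'
    split_ifs at hk' with hkf
    · omega
    · refine ⟨f, k, (nc i hi' (by omega)).lt hw (by omega) (by omega), ?_, hk⟩
      rw [h0, if_pos rfl, h1]
  · obtain ⟨j, hj⟩ := hu.exists_eq (cnt_blocks_pos.2 (show p < α.length by omega))
    obtain ⟨k, hk, hk'⟩ : ∃ k, w k = p + 1 ∧ raise i w k = p + 1 := by
      by_cases h2 : p = i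
      · obtain ⟨k, hk⟩ := hw.exists_eq (cnt_bal_pos.2 hp)
        refine ⟨k, hk, ?_⟩
        rw [h0, if_neg, hk]
        rintro rfl; omega
      · obtain ⟨k, hk⟩ := hu.exists_eq (cnt_blocks_pos.2 hp)
        refine ⟨k, ?_, hk⟩
        rw [h0] at hk
        split_ifs at hk
        · omega
        · exact hk
    have hj' := hj
    rw [h0] at hj'
    split_ifs at hj'
    · omega
    · exact ⟨j, k, (nc p hp h1).lt hw (by omega) (by omega), hj, hk'⟩

/-- If `τ` crosses no boundary between columns of one component, then `τ` and its shape are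
determined by `L(τ)`. -/
theorem eq_of_raise_eq (hw : Content (cnt (bal α i).parts) w)
    (nc : ∀ p, p + 1 < α.length → p ≠ i + 1 → NoCross (cnt (bal α i).parts) w (p + 1))
    {j : calI α} {w' : Fin n → ℕ} (hw' : Content (cnt (bal α j).parts) w')
    (h : raise j w' = raise i w) : j = i ∧ w' = w := by
  have hu := content_raise hw
  have hu' := content_raise hw'
  obtain ⟨f, hf, hff⟩ := exists_first_bal hw
  obtain ⟨f', hf', hff'⟩ := exists_first_bal hw'
  have hi' := calI.lt i
  have hj' := calI.lt j
  have h0 : ∀ k, raise i w k = if k = f then (i : ℕ) + 1 else w k := fun k => by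
    rw [raise_eq hf hff, Function.update_apply]
  have h0' : ∀ k, raise i w k = if k = f' then (j : ℕ) + 1 else w' k := fun k => by
    rw [← h, raise_eq hf' hff', Function.update_apply]
  have a1 : raise i w f' = j + 1 := by rw [h0', if_pos rfl]
  have a2 : ∀ k, raise i w k = j → f' < k := by
    intro k hk
    rw [h0'] at hk
    split_ifs at hk with hkf
    · omega
    · exact lt_of_le_of_ne (hff' k hk) (Ne.symm hkf)
  obtain ⟨k, hk⟩ := hu.exists_eq (cnt_blocks_pos.2 (show (j : ℕ) < α.length by omega))
  have hk' := a2 k hk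
  by_cases c1 : (j : ℕ) = i
  · obtain rfl : j = i := Subtype.ext c1
    refine ⟨rfl, ?_⟩
    by_cases c2 : f' = f
    · subst c2
      funext l
      have e := (h0' l).symm.trans (h0 l)
      by_cases hl : l = f'
      · rw [hl, hf, hf']
      · rwa [if_neg hl, if_neg hl] at e
    · rw [h0, if_neg c2] at a1
      rw [h0] at hk
      split_ifs at hk
      · omega
      · exact absurd ((nc j hi' (by omega)).lt hw (j := k) (k := f') (by omega) (by omega))
          hk'.not_gt
  · exfalso
    rw [h0] at a1
    split_ifs at a1 with c2
    · omega
    by_cases c3 : (j : ℕ) = i + 1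
    · have := a2 f (by rw [h0, if_pos rfl, c3])
      exact absurd ((nc i hi' (by omega)).lt hw (j := f) (k := f') (by omega) (by omega))
        this.not_gt
    · rw [h0] at hk
      split_ifs at hk
      · omega
      · exact absurd ((nc j hj' c3).lt hw (j := k) (k := f') (by omega) (by omega)) hk'.not_gt

/-- If `τ` crosses no boundary between columns of one component, then its coefficient in `x` is the
coefficient of `L(τ)` in `∂₁ x`. -/
theorem coeffP_dH (τ : SRT (bal α i))
    (nc : ∀ p, p + 1 < α.length → p ≠ i + 1 → NoCross (cnt (bal α i).parts) τ.word (p + 1))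
    (T : SRT (GenComp.single α)) (hT : T.word = raise i τ.word)
    (x : ⨁ i : calI α, P (bal α i)) : coeffP T (dH α x) = coeffP τ (x i) := by
  classical
  have key : coeffP T ∘ₗ (dH α).restrictScalars ℂ =
      coeffP τ ∘ₗ DirectSum.component ℂ (calI α) (fun i => P (bal α i)) i := by
    refine DirectSum.linearMap_ext ℂ fun j => P_hom_ext fun τ' => ?_
    show coeffP T (dH α (DirectSum.lof ℂ (calI α) (fun i => P (bal α i)) j (vecP _ τ'.word))) =
      coeffP τ ((DirectSum.lof ℂ (calI α) (fun i => P (bal α i)) j (vecP _ τ'.word)) i)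
    have hr := content_raise τ'.content
    rw [← single_parts] at hr
    rw [dH_lof, partialAt_vecP τ'.content, coeffP_vecP_of_content T hr, hT]
    by_cases h : j = i
    · subst h
      rw [DirectSum.lof_apply, coeffP_vecP, ← SRT.word_injective.eq_iff]
      congr 1
      exact propext ⟨fun h => (eq_of_raise_eq τ.content nc τ'.content h).2, fun h => by rw [h]⟩
    · rw [if_neg fun h' => h (eq_of_raise_eq τ.content nc τ'.content h').1]
      have : (DirectSum.lof ℂ (calI α) (fun i => P (bal α i)) j (vecP _ τ'.word)) i = 0 :=
        DirectSum.of_eq_of_ne _ _ _ (Ne.symm h)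
      rw [this, map_zero]
  exact LinearMap.congr_fun key x

section
variable {χ : ℕ → ℂ} {g : P (bal α i) →ₗ[ℂ] ℂ}

theorem chi_bal_eq_zero (hg : ∀ (k : Fin (n - 1)) x, g ((gen k : H n) • x) = χ (k + 1) * g x)
    (h : g ≠ 0) {p : ℕ} (hp : p + 1 < α.length) (hp' : p ≠ i + 1) :
    χ (psum (cnt (bal α i).parts) (p + 1)) = 0 := by
  obtain ⟨w₀, hm, hw₀⟩ := exists_sorted_parts (bal α i)
  have hc := wordChar_vecP hg
  have h0 : g (vecP _ w₀) ≠ 0 := fun h0 => h <| P_hom_ext fun τ => by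
    by_contra hne
    exact hc.sorted_ne τ.content hne hm hw₀ h0
  exact hc.chi_eq_zero hm hw₀ h0 ((conn_bal i).2 ⟨hp, hp'⟩) (cnt_bal_pos.2 (by omega))
    (cnt_bal_pos.2 hp)

theorem chi_bal_eq_one (hg : ∀ (k : Fin (n - 1)) x, g ((gen k : H n) • x) = χ (k + 1) * g x)
    (h : g ≠ 0) {m : ℕ} (hm0 : 0 < m) (hmn : m < n)
    (hm : ∀ p, m ≠ psum (cnt (bal α i).parts) p) : χ m = 1 := by
  obtain ⟨w₀, hmon, hw₀⟩ := exists_sorted_parts (bal α i)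
  have hc := wordChar_vecP hg
  have h0 : g (vecP _ w₀) ≠ 0 := fun h0 => h <| P_hom_ext fun τ => by
    by_contra hne
    exact hc.sorted_ne τ.content hne hmon hw₀ h0
  have e : m - 1 + 1 = m := by omega
  have := hc.chi_eq_one hmon hw₀ h0 ⟨m - 1, by omega⟩ (by simpa [e] using hm)
  simpa [e] using this

end

/-- A character determines the shape `𝛂^{(i)}` on which it is nonzero. -/
theorem bal_character_unique {χ : ℕ → ℂ} {i j : calI α} {g : P (bal α i) →ₗ[ℂ] ℂ}
    {g' : P (bal α j) →ₗ[ℂ] ℂ}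
    (hg : ∀ (k : Fin (n - 1)) x, g ((gen k : H n) • x) = χ (k + 1) * g x) (h : g ≠ 0)
    (hg' : ∀ (k : Fin (n - 1)) x, g' ((gen k : H n) • x) = χ (k + 1) * g' x) (h' : g' ≠ 0) :
    i = j := by
  by_contra hij
  have hij' : (i : ℕ) ≠ j := fun e => hij (Subtype.ext e)
  have h0 := chi_bal_eq_zero hg h (calI.lt i) (by omega)
  rw [psum_bal, if_pos rfl] at h0
  have s1 := psum_succ (cnt α.blocks) i
  have s2 : psum (cnt α.blocks) (i + 2) = _ := psum_succ (cnt α.blocks) (i + 1)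
  have p1 : 0 < cnt α.blocks i := cnt_blocks_pos.2 (by have := calI.lt i; omega)
  have p2 := calI.two_le i
  have hn : psum (cnt α.blocks) (i + 2) ≤ n := by
    obtain ⟨w, -, hw⟩ := exists_sorted_parts (GenComp.single α)
    rw [single_parts] at hw
    exact hw.psum_le _
  refine zero_ne_one (h0.symm.trans (chi_bal_eq_one hg' h' (by omega) (by omega) fun p e => ?_))
  rw [psum_bal] at e
  rcases lt_trichotomy p (i + 1) with hp | hp | hp
  · have := psum_mono (cnt α.blocks) (show p ≤ i by omega)
    split_ifs at e <;> omega
  · subst hp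
    rw [if_neg (by omega)] at e
    omega
  · have := psum_mono (cnt α.blocks) (show (i : ℕ) + 2 ≤ p by omega)
    split_ifs at e <;> omega

/-- The characters of the source of `∂₁` vanish on the kernel of `∂₁`. -/
theorem eq_zero_of_dH_eq_zero {χ : ℕ → ℂ} {g : (⨁ i : calI α, P (bal α i)) →ₗ[ℂ] ℂ}
    (hg : ∀ (k : Fin (n - 1)) x, g ((gen k : H n) • x) = χ (k + 1) * g x)
    (x : ⨁ i : calI α, P (bal α i)) (hx : dH α x = 0) : g x = 0 := by
  classical
  rw [← DirectSum.sum_support_of x, map_sum]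
  refine Finset.sum_eq_zero fun i _ => ?_
  let gi : P (bal α i) →ₗ[ℂ] ℂ := g ∘ₗ DirectSum.lof ℂ (calI α) (fun i => P (bal α i)) i
  show gi (x i) = 0
  have hgi : ∀ (k : Fin (n - 1)) x, gi ((gen k : H n) • x) = χ (k + 1) * gi x := by
    intro k y
    refine Eq.trans ?_ (hg k _)
    exact congrArg g ((DirectSum.lof (H n) (calI α) (fun i => P (bal α i)) i).map_smul (gen k) y)
  refine eq_zero_of_coeffP gi (x i) fun τ hτ => ?_
  by_contra hne
  have hgi0 : gi ≠ 0 := by rintro h; exact hne (by rw [h]; rfl)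
  have nc : ∀ p, p + 1 < α.length → p ≠ i + 1 →
      NoCross (cnt (bal α i).parts) τ.word (p + 1) := fun p hp hp' =>
    (wordChar_vecP hgi).noCross τ.content hne (chi_bal_eq_zero hgi hgi0 hp hp')
  have hr := content_raise τ.content
  rw [← single_parts] at hr
  have := coeffP_dH τ nc (SRT.ofWord _ hr fun p hp =>
    linked_raise τ.content nc (conn_single.1 hp)) (SRT.word_ofWord _ hr _) x
  rw [hx, map_zero] at this
  exact hτ this.symm

instance : Finite (calI α) :=
  Set.Finite.subset (Set.finite_lt_nat α.length) fun i hi => by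
    have := hi.1
    show i < α.length
    omega

/-- `∂₁` as a homomorphism onto `Ω(V_α)`. -/
def dHker (α : Composition n) :
    (⨁ i : calI α, P (bal α i)) →ₗ[H n] LinearMap.ker (PhiH α) :=
  (dH α).codRestrict _ PhiH_dH

theorem dHker_surjective (α : Composition n) : Function.Surjective (dHker α) := by
  rintro ⟨y, hy⟩
  rw [← range_dH] at hy
  obtain ⟨x, rfl⟩ := hy
  exact ⟨x, rfl⟩

theorem isProjectiveCover_dHker (α : Composition n) : IsProjectiveCover (dHker α) where
  projective := inferInstanceAs (Module.Projective (H n) (Π₀ i : calI α, P (bal α i)))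
  essentialEpi := isEssentialEpi_of_character _
    (inferInstanceAs (Module.Finite (H n) (Π₀ i : calI α, P (bal α i))))
    (dHker_surjective α) fun _ _ hg x hx => eq_zero_of_dH_eq_zero hg x (congrArg Subtype.val hx)

end

/-! ### The sets `[𝛂^{(i)}]` in terms of partial sums -/

/-- The sums of the initial segments of a list. -/
def prefixSums (c : List ℕ) : Set ℕ := Set.range fun k => (c.take k).sum

theorem zero_mem_prefixSums (c : List ℕ) : 0 ∈ prefixSums c := ⟨0, by simp⟩

theorem sum_mem_prefixSums (c : List ℕ) : c.sum ∈ prefixSums c := ⟨c.length, by simp⟩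

theorem le_sum_of_mem_prefixSums {c : List ℕ} {m : ℕ} (h : m ∈ prefixSums c) : m ≤ c.sum := by
  obtain ⟨k, rfl⟩ := h
  have := List.sum_take_add_sum_drop c k
  dsimp only
  omega

theorem mem_prefixSums_cons {a : ℕ} {c : List ℕ} {m : ℕ} :
    m ∈ prefixSums (a :: c) ↔ m = 0 ∨ ∃ m' ∈ prefixSums c, m = a + m' := by
  constructor
  · rintro ⟨k, rfl⟩
    rcases k with _ | k
    · simp
    · exact Or.inr ⟨_, ⟨k, rfl⟩, by simp⟩
  · rintro (rfl | ⟨_, ⟨k, rfl⟩, rfl⟩)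
    · exact zero_mem_prefixSums _
    · exact ⟨k + 1, by simp⟩

theorem mem_prefixSums_append {c d : List ℕ} {m : ℕ} :
    m ∈ prefixSums (c ++ d) ↔ m ∈ prefixSums c ∨ ∃ m' ∈ prefixSums d, m = c.sum + m' := by
  induction c generalizing m with
  | nil =>
    simp only [List.nil_append, List.sum_nil, zero_add, exists_eq_right']
    refine ⟨Or.inr, fun h => h.elim ?_ id⟩
    rintro ⟨k, rfl⟩
    simpa using zero_mem_prefixSums d
  | cons a c ih =>
    rw [List.cons_append, mem_prefixSums_cons, mem_prefixSums_cons]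
    simp only [ih, List.sum_cons]
    constructor
    · rintro (h | ⟨m', h | ⟨m'', h, rfl⟩, rfl⟩)
      · exact Or.inl (Or.inl h)
      · exact Or.inl (Or.inr ⟨m', h, rfl⟩)
      · exact Or.inr ⟨m'', h, by omega⟩
    · rintro ((h | ⟨m', h, rfl⟩) | ⟨m', h, rfl⟩)
      · exact Or.inl h
      · exact Or.inr ⟨m', Or.inl h, rfl⟩
      · exact Or.inr ⟨_, Or.inr ⟨m', h, rfl⟩, by omega⟩

/-- Near concatenation omits exactly one of the partial sums of the concatenation. -/
theorem mem_prefixSums_append_iff_near {c d : List ℕ} (hc : c ≠ []) (hd : d ≠ []) {m : ℕ} :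
    m ∈ prefixSums (c ++ d) ↔ m ∈ prefixSums (near c d) ∨ m = c.sum := by
  obtain ⟨c', x, rfl⟩ := (List.eq_nil_or_concat' c).resolve_left hc
  obtain ⟨y, d', rfl⟩ := List.exists_cons_of_ne_nil hd
  have e : near (c' ++ [x]) (y :: d') = c' ++ (x + y) :: d' := by simp [near]
  rw [e, List.append_assoc, mem_prefixSums_append, mem_prefixSums_append]
  simp only [List.singleton_append, mem_prefixSums_cons, List.sum_append, List.sum_singleton]
  constructor
  · rintro (h | ⟨_, rfl | ⟨_, rfl | ⟨m, h, rfl⟩, rfl⟩, rfl⟩)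
    · exact Or.inl (Or.inl h)
    · exact Or.inl (Or.inr ⟨0, Or.inl rfl, rfl⟩)
    · exact Or.inr (by omega)
    · exact Or.inl (Or.inr ⟨_, Or.inr ⟨m, h, rfl⟩, by omega⟩)
  · rintro ((h | ⟨_, rfl | ⟨m, h, rfl⟩, rfl⟩) | rfl)
    · exact Or.inl h
    · exact Or.inr ⟨0, Or.inl rfl, rfl⟩
    · exact Or.inr ⟨_, Or.inr ⟨_, Or.inr ⟨m, h, rfl⟩, rfl⟩, by omega⟩
    · exact Or.inr ⟨_, Or.inr ⟨0, Or.inl rfl, rfl⟩, by omega⟩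

theorem sum_notMem_prefixSums_near {c d : List ℕ} (hc : c ≠ []) (hd : d ≠ [])
    (hc' : ∀ a ∈ c, 0 < a) (hd' : ∀ a ∈ d, 0 < a) : c.sum ∉ prefixSums (near c d) := by
  obtain ⟨c', x, rfl⟩ := (List.eq_nil_or_concat' c).resolve_left hc
  obtain ⟨y, d', rfl⟩ := List.exists_cons_of_ne_nil hd
  have e : near (c' ++ [x]) (y :: d') = c' ++ (x + y) :: d' := by simp [near]
  have hx := hc' x (by simp)
  have hy := hd' y (by simp)
  rw [e, mem_prefixSums_append]
  simp only [mem_prefixSums_cons, List.sum_append, List.sum_singleton]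
  rintro (h | ⟨_, rfl | ⟨m, -, rfl⟩, h⟩)
  · have := le_sum_of_mem_prefixSums h
    omega
  · omega
  · omega

theorem near_sum {c d : List ℕ} (hc : c ≠ []) (hd : d ≠ []) : (near c d).sum = c.sum + d.sum := by
  obtain ⟨c', x, rfl⟩ := (List.eq_nil_or_concat' c).resolve_left hc
  obtain ⟨y, d', rfl⟩ := List.exists_cons_of_ne_nil hd
  simp [near]; omega

theorem near_pos {c d : List ℕ} (hc : c ≠ []) (hd : d ≠ []) (hc' : ∀ a ∈ c, 0 < a)
    (hd' : ∀ a ∈ d, 0 < a) : ∀ a ∈ near c d, 0 < a := by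
  obtain ⟨c', x, rfl⟩ := (List.eq_nil_or_concat' c).resolve_left hc
  obtain ⟨y, d', rfl⟩ := List.exists_cons_of_ne_nil hd
  have e : near (c' ++ [x]) (y :: d') = c' ++ (x + y) :: d' := by simp [near]
  intro a ha
  rw [e, List.mem_append, List.mem_cons] at ha
  rcases ha with ha | rfl | ha
  · exact hc' a (by simp [ha])
  · have := hc' x (by simp); omega
  · exact hd' a (by simp [ha])

/-- A composition is determined by its partial sums. -/
theorem composition_eq_of_prefixSums {β γ : Composition n}
    (h : prefixSums β.blocks = prefixSums γ.blocks) : β = γ := by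
  have key : ∀ (β : Composition n) (m : Fin (n + 1)),
      m ∈ β.boundaries ↔ (m : ℕ) ∈ prefixSums β.blocks := by
    intro β m
    simp only [Composition.boundaries, Finset.mem_map, Finset.mem_univ, true_and]
    constructor
    · rintro ⟨k, rfl⟩
      exact ⟨k, rfl⟩
    · rintro ⟨k, hk⟩
      rcases le_or_gt k β.length with hkl | hkl
      · exact ⟨⟨k, by omega⟩, Fin.ext hk⟩
      · refine ⟨Fin.last _, Fin.ext ?_⟩
        rw [← hk]
        show β.sizeUpTo β.length = β.sizeUpTo k
        rw [β.sizeUpTo_length, β.sizeUpTo_ofLength_le _ hkl.le]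
  apply (compositionEquiv n).injective
  apply CompositionAsSet.ext
  show β.boundaries = γ.boundaries
  ext m
  rw [key, key, h]

theorem blocks_eq_of_prefixSums {β : Composition n} {c : List ℕ} (hc : ∀ a ∈ c, 0 < a)
    (hs : c.sum = n) (h : prefixSums β.blocks = prefixSums c) : β.blocks = c :=
  congrArg Composition.blocks
    (composition_eq_of_prefixSums (γ := ⟨c, fun {a} ha => hc a ha, hs⟩) h)

theorem mem_partialSums {β : Composition n} {m : ℕ} :
    m ∈ partialSums β ↔ 0 < m ∧ m < n ∧ m ∈ prefixSums β.blocks := by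
  constructor
  · rintro ⟨k, hk, hk', rfl⟩
    refine ⟨?_, ?_, k, rfl⟩
    · have h1 := β.sizeUpTo_strict_mono (show 0 < β.length by omega)
      have h2 := β.monotone_sizeUpTo (show 0 + 1 ≤ k by omega)
      omega
    · have h1 := β.sizeUpTo_strict_mono hk'
      have h2 := β.sizeUpTo_le (k + 1)
      omega
  · rintro ⟨h0, h1, k, hk⟩
    refine ⟨k, ?_, ?_, hk.symm⟩
    · rcases k with _ | k
      · simp at hk; omega
      · omega
    · by_contra hkl
      have := β.sizeUpTo_ofLength_le k (not_lt.1 hkl)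
      have e : β.sizeUpTo k = m := hk
      omega

section
variable {α : Composition n} {i : calI α}

theorem psum_parts_lt_psum_parts (a : GenComp n) {p q : ℕ} (h : p < q) (hq : q ≤ a.parts.length) :
    psum (cnt a.parts) p < psum (cnt a.parts) q := by
  have h1 := psum_succ (cnt a.parts) p
  have h2 : 0 < cnt a.parts p := GenComp.cnt_pos.2 (by omega)
  have h3 := psum_mono (cnt a.parts) (show p + 1 ≤ q by omega)
  omega

theorem psum_parts_length (a : GenComp n) : psum (cnt a.parts) a.parts.length = n := by
  rw [psum_cnt, List.take_length]; exact a.sum_eq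

theorem psum_parts_of_ge (a : GenComp n) {p : ℕ} (h : a.parts.length ≤ p) :
    psum (cnt a.parts) p = n := by
  rw [psum_cnt, List.take_of_length_le h]; exact a.sum_eq

/-- `[𝛂^{(i)}]` consists of the compositions `β` such that the characters of `F_β` vanish at the
places where the ribbon diagram of `𝛂^{(i)}` is connected, and only at ends of its columns. -/
theorem mem_bracket_bal {β : Composition n} : β ∈ (bal α i).bracket ↔
    (∀ p, p + 1 < α.length → p ≠ i + 1 →
      psum (cnt (bal α i).parts) (p + 1) ∈ partialSums β) ∧
    ∀ m ∈ partialSums β, ∃ p, m = psum (cnt (bal α i).parts) p := by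
  have hlen := bal_parts_length i
  have hi' := calI.lt i
  obtain ⟨X, Y, hX, hXl, hparts, hcomps⟩ : ∃ X Y : List ℕ, X ≠ [] ∧ X.length = i + 2 ∧
      (bal α i).parts = X ++ Y ∧ (bal α i).comps = X :: if Y = [] then [] else [Y] := by
    refine ⟨_, _, by simp, ?_, ?_, bal_comps i⟩
    · have : α.blocks.length = α.length := rfl
      simp [this]; omega
    · rw [bal_parts, balLists, List.flatten_cons, List.flatten_singleton]
  have hsum : psum (cnt (bal α i).parts) (i + 2) = X.sum := by
    rw [psum_cnt, hparts, ← hXl, List.take_left]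
  have hpos : ∀ a ∈ X ++ Y, 0 < a := hparts ▸ (bal α i).parts_pos
  have hXpos : ∀ a ∈ X, 0 < a := fun a ha => hpos a (by simp [ha])
  have hYpos : ∀ a ∈ Y, 0 < a := fun a ha => hpos a (by simp [ha])
  have hn : (X ++ Y).sum = n := hparts ▸ (bal α i).sum_eq
  have hnβ : n ∈ prefixSums β.blocks := by
    have := sum_mem_prefixSums β.blocks
    rwa [β.blocks_sum] at this
  have hE : ∀ m, m ∈ prefixSums (X ++ Y) ↔ ∃ p, m = psum (cnt (bal α i).parts) p := by
    intro m
    rw [← hparts]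
    simp only [prefixSums, Set.mem_range, psum_cnt, eq_comm]
  have hbr : β ∈ (bal α i).bracket ↔ β.blocks = X ++ Y ∨ Y ≠ [] ∧ β.blocks = near X Y := by
    show β.blocks ∈ joins (bal α i).comps ↔ _
    rw [hcomps]
    by_cases hY : Y = []
    · simp [hY, joins]
    · simp [hY, joins]
  have hR : ((∀ p, p + 1 < α.length → p ≠ i + 1 →
      psum (cnt (bal α i).parts) (p + 1) ∈ partialSums β) ∧
      ∀ m ∈ partialSums β, ∃ p, m = psum (cnt (bal α i).parts) p) ↔
      (∀ m ∈ prefixSums (X ++ Y), m ≠ X.sum → m ∈ prefixSums β.blocks) ∧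
        prefixSums β.blocks ⊆ prefixSums (X ++ Y) := by
    constructor
    · rintro ⟨h1, h2⟩
      constructor
      · intro m hm hm'
        obtain ⟨p, rfl⟩ := (hE m).1 hm
        rcases p with _ | p
        · exact zero_mem_prefixSums _
        · rcases lt_or_ge (p + 1) α.length with hp | hp
          · exact (mem_partialSums.1 (h1 p hp fun e => hm' (by rw [e]; exact hsum))).2.2
          · rwa [psum_parts_of_ge _ (by omega)]
      · intro m hm
        by_cases h0 : m = 0
        · rw [h0]; exact zero_mem_prefixSums _
        have hle := le_sum_of_mem_prefixSums hm
        rw [β.blocks_sum] at hle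
        rcases hle.lt_or_eq with hlt | rfl
        · exact (hE m).2 (h2 m (mem_partialSums.2 ⟨by omega, hlt, hm⟩))
        · have := sum_mem_prefixSums (X ++ Y)
          rwa [hn] at this
    · rintro ⟨h1, h2⟩
      constructor
      · intro p hp hp'
        have a1 := psum_parts_lt_psum_parts (bal α i) (show 0 < p + 1 by omega) (by omega)
        have a2 := psum_parts_lt_psum_parts (bal α i) (show p + 1 < α.length from hp) (by omega)
        rw [← hlen, psum_parts_length] at a2
        refine mem_partialSums.2 ⟨by omega, a2, h1 _ ((hE _).2 ⟨_, rfl⟩) ?_⟩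
        rw [← hsum]
        rcases lt_or_gt_of_ne hp' with hlt | hlt
        · exact (psum_parts_lt_psum_parts (bal α i) (by omega) (by omega)).ne
        · exact (psum_parts_lt_psum_parts (bal α i) (by omega) (by omega)).ne'
      · intro m hm
        exact (hE m).1 (h2 (mem_partialSums.1 hm).2.2)
  rw [hbr, hR]
  constructor
  · rintro (h | ⟨hY, h⟩)
    · rw [h]
      exact ⟨fun _ h _ => h, subset_rfl⟩
    · rw [h]
      have := @mem_prefixSums_append_iff_near X Y hX hY
      exact ⟨fun m hm hm' => (this.1 hm).resolve_right hm', fun m hm => this.2 (Or.inl hm)⟩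
  · rintro ⟨h1, h2⟩
    by_cases hx : X.sum ∈ prefixSums β.blocks
    · refine Or.inl (blocks_eq_of_prefixSums hpos hn (h2.antisymm fun m hm => ?_))
      by_cases hm' : m = X.sum
      · rwa [hm']
      · exact h1 m hm hm'
    · have hY : Y ≠ [] := by
        rintro rfl
        rw [List.append_nil] at hn
        exact hx (hn ▸ hnβ)
      have h3 := @mem_prefixSums_append_iff_near X Y hX hY
      have h4 := sum_notMem_prefixSums_near hX hY hXpos hYpos
      refine Or.inr ⟨hY, blocks_eq_of_prefixSums (near_pos hX hY hXpos hYpos)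
        (by rw [near_sum hX hY, ← hn, List.sum_append]) ?_⟩
      ext m
      refine ⟨fun hm => (h3.1 (h2 hm)).resolve_right fun e => hx (e ▸ hm), fun hm => ?_⟩
      exact h1 m (h3.2 (Or.inl hm)) fun e => h4 (e ▸ hm)

end

/-! ### Homomorphisms into the simple modules -/

/-- The underlying vector space of `F_β`. -/
def F.coord (β : Composition n) : F β ≃ₗ[ℂ] ℂ := LinearEquiv.refl ℂ ℂ

section
variable {X : Type} [AddCommGroup X] [Module (H n) X] [Module ℂ X] [IsScalarTower ℂ (H n) X]
  {β : Composition n}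

/-- The character given by a homomorphism into `F_β`. -/
def homChar (h : X →ₗ[H n] F β) : X →ₗ[ℂ] ℂ := (F.coord β).toLinearMap ∘ₗ h.restrictScalars ℂ

theorem homChar_apply (h : X →ₗ[H n] F β) (x : X) : homChar h x = F.coord β (h x) := rfl

theorem homChar_gen_smul (h : X →ₗ[H n] F β) (k : Fin (n - 1)) (x : X) :
    homChar h ((gen k : H n) • x) = scal β (k + 1) * homChar h x := by
  rw [homChar_apply, map_smul, gen_smul_F, map_smul, homChar_apply, smul_eq_mul]

theorem homChar_eq_zero {h : X →ₗ[H n] F β} {x : X} : homChar h x = 0 ↔ h x = 0 := by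
  rw [homChar_apply, LinearEquiv.map_eq_zero_iff]

/-- The homomorphism into `F_β` given by a character. -/
def charHom (g : X →ₗ[ℂ] ℂ)
    (hg : ∀ (k : Fin (n - 1)) x, g ((gen k : H n) • x) = scal β (k + 1) * g x) : X →ₗ[H n] F β :=
  homOfGen ((F.coord β).symm.toLinearMap ∘ₗ g) fun k x => by
    rw [LinearMap.comp_apply, hg, gen_smul_F, ← smul_eq_mul, map_smul]
    rfl

theorem charHom_eq_zero {g : X →ₗ[ℂ] ℂ}
    {hg : ∀ (k : Fin (n - 1)) x, g ((gen k : H n) • x) = scal β (k + 1) * g x} {x : X} :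
    charHom g hg x = 0 ↔ g x = 0 := by
  show (F.coord β).symm (g x) = 0 ↔ _
  rw [LinearEquiv.map_eq_zero_iff]

end

/-- The linear form on `P_𝛂` with the value `1` at the tableaux that cross no zero of `χ`, and `0` at
the others. -/
def charForm (a : GenComp n) (χ : ℕ → ℂ) : P a →ₗ[ℂ] ℂ :=
  (Finsupp.linearCombination ℂ fun T : SRT a => charFun (cnt a.parts) χ T.word :
    (SRT a →₀ ℂ) →ₗ[ℂ] ℂ)

theorem charForm_word {a : GenComp n} (χ : ℕ → ℂ) (T : SRT a) :
    charForm a χ (vecP a T.word) = charFun (cnt a.parts) χ T.word := by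
  rw [vecP_word]
  exact (Finsupp.linearCombination_single ℂ _ _).trans (one_smul _ _)

theorem charForm_vecP {a : GenComp n} {χ : ℕ → ℂ}
    (hc : WordChar (n := n) (cnt a.parts) {p | Conn a p} χ (charFun (cnt a.parts) χ))
    {w : Fin n → ℕ} (hw : Content (cnt a.parts) w) :
    charForm a χ (vecP a w) = charFun (cnt a.parts) χ w := by
  by_cases h : ∀ p, Conn a p → Linked w p
  · have := charForm_word χ (SRT.ofWord w hw h)
    rwa [SRT.word_ofWord] at this
  · push Not at h
    obtain ⟨p, hp, hl⟩ := h
    rw [vecP_eq_zero hw hp hl, map_zero, hc.zero w hw p hp hl]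

theorem charForm_gen_smul {a : GenComp n} {χ : ℕ → ℂ}
    (hc : WordChar (n := n) (cnt a.parts) {p | Conn a p} χ (charFun (cnt a.parts) χ))
    (k : Fin (n - 1)) (x : P a) :
    charForm a χ ((gen k : H n) • x) = χ (k + 1) * charForm a χ x := by
  induction x using P_induction with
  | zero => simp
  | add x y hx hy => rw [smul_add, map_add, hx, hy, map_add, mul_add]
  | smul c T =>
    rw [smul_comm, gen_smul_vecP T.content, map_smul, map_smul, charForm_vecP hc (T.content.bub k),
      hc.smul _ T.content, charForm_vecP hc T.content, smul_eq_mul, smul_eq_mul]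
    ring

section
variable {α : Composition n} {β : Composition n} {i : calI α}

theorem scal_eq_zero_iff {m : ℕ} : scal β m = 0 ↔ m ∈ partialSums β := by
  unfold scal; split_ifs with h <;> simp [h]

theorem scal_eq_one_iff {m : ℕ} : scal β m = 1 ↔ m ∉ partialSums β := by
  unfold scal; split_ifs with h <;> simp [h]

theorem wordChar_of_mem_bracket (h : β ∈ (bal α i).bracket) :
    WordChar (n := n) (cnt (bal α i).parts) {p | Conn (bal α i) p} (scal β)
      (charFun (cnt (bal α i).parts) (scal β)) := by
  obtain ⟨h1, h2⟩ := mem_bracket_bal.1 h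
  refine charFun_wordChar (fun k => ?_) (fun k hk => ?_) fun p hp => ?_
  · unfold scal; split_ifs <;> simp
  · rw [scal_eq_one_iff]
    intro hm
    obtain ⟨p, hp⟩ := h2 _ hm
    exact hk p hp
  · obtain ⟨hp1, hp2⟩ := (conn_bal i).1 hp
    exact ⟨cnt_bal_pos.2 (by omega), cnt_bal_pos.2 hp1, scal_eq_zero_iff.2 (h1 p hp1 hp2)⟩

/-- The inclusion of a summand into the source of `∂₁`. -/
def incl (α : Composition n) (i : calI α) : P (bal α i) →ₗ[H n] ⨁ i : calI α, P (bal α i) :=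
  DirectSum.lof (H n) (calI α) (fun i => P (bal α i)) i

theorem hom_ext_incl {B : Type} [AddCommGroup B] [Module (H n) B]
    {f g : (⨁ i : calI α, P (bal α i)) →ₗ[H n] B} (h : ∀ i, f ∘ₗ incl α i = g ∘ₗ incl α i) :
    f = g := DirectSum.linearMap_ext (H n) h

/-- `F_β` is a quotient of `P_{𝛂^{(i)}}` only if `β ∈ [𝛂^{(i)}]`. -/
theorem mem_bracket_of_hom_ne_zero {h : P (bal α i) →ₗ[H n] F β} (hh : h ≠ 0) :
    β ∈ (bal α i).bracket := by
  have hg : homChar h ≠ 0 := fun h0 => hh <| LinearMap.ext fun x =>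
    homChar_eq_zero.1 (LinearMap.congr_fun h0 x)
  refine mem_bracket_bal.2 ⟨fun p hp hp' => scal_eq_zero_iff.1
    (chi_bal_eq_zero (homChar_gen_smul h) hg hp hp'), fun m hm => ?_⟩
  by_contra hne
  push Not at hne
  obtain ⟨h0, h1, -⟩ := mem_partialSums.1 hm
  exact scal_eq_one_iff.1 (chi_bal_eq_one (homChar_gen_smul h) hg h0 h1 hne) hm

theorem hom_ker_eq_zero (hβ : β ∉ calJ α) (h : LinearMap.ker (PhiH α) →ₗ[H n] F β) : h = 0 := by
  have h0 : h ∘ₗ dHker α = 0 := hom_ext_incl fun i => by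
    by_contra hne
    exact hβ (Set.mem_iUnion.2 ⟨i, mem_bracket_of_hom_ne_zero hne⟩)
  refine LinearMap.ext fun y => ?_
  obtain ⟨x, rfl⟩ := dHker_surjective α y
  exact LinearMap.congr_fun h0 x

/-- If `β ∈ [𝛂^{(i)}]`, a homomorphism from `Ω(V_α)` to `F_β` is determined by its value at the
image of the tableau of shape `𝛂^{(i)}` attached to the sorted word, and this value can be
nonzero. -/
theorem exists_hom_ker (hβ : β ∈ calJ α) : ∃ y₀ : LinearMap.ker (PhiH α),
    (∀ h : LinearMap.ker (PhiH α) →ₗ[H n] F β, h y₀ = 0 → h = 0) ∧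
    ∃ h : LinearMap.ker (PhiH α) →ₗ[H n] F β, h y₀ ≠ 0 := by
  obtain ⟨i, hi⟩ := Set.mem_iUnion.1 hβ
  obtain ⟨w₀, hm, hw₀⟩ := exists_sorted_parts (bal α i)
  have hc := wordChar_of_mem_bracket hi
  have hG : charForm (bal α i) (scal β) (vecP _ w₀) = 1 := by
    rw [charForm_vecP hc hw₀, charFun_of_noCross (noCross_of_monotone hm hw₀)]
  let q : P (bal α i) →ₗ[H n] F β := charHom (charForm _ _) (charForm_gen_smul hc)
  have hq : q (vecP _ w₀) ≠ 0 := by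
    rw [Ne, charHom_eq_zero, hG]; exact one_ne_zero
  have hq0 : q ≠ 0 := by rintro h0; exact hq (by rw [h0]; rfl)
  have hchar : ∀ {j : calI α} {h : P (bal α j) →ₗ[H n] F β}, h ≠ 0 → homChar h ≠ 0 :=
    fun hh h0 => hh <| LinearMap.ext fun x => homChar_eq_zero.1 (LinearMap.congr_fun h0 x)
  refine ⟨dHker α (incl α i (vecP _ w₀)), fun h h0 => ?_, ?_⟩
  · have h1 : h ∘ₗ dHker α = 0 := hom_ext_incl fun j => by
      by_contra hne
      obtain rfl : j = i := bal_character_unique (homChar_gen_smul _) (hchar hne)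
        (homChar_gen_smul _) (hchar hq0)
      have hw := wordChar_vecP (homChar_gen_smul ((h ∘ₗ dHker α) ∘ₗ incl α j))
      refine hchar hne (P_hom_ext fun τ => ?_)
      by_contra hne'
      exact hw.sorted_ne τ.content hne' hm hw₀ (homChar_eq_zero.2 h0)
    refine LinearMap.ext fun y => ?_
    obtain ⟨x, rfl⟩ := dHker_surjective α y
    exact LinearMap.congr_fun h1 x
  · let f : (⨁ i : calI α, P (bal α i)) →ₗ[H n] F β :=
      q ∘ₗ DirectSum.component (H n) (calI α) (fun i => P (bal α i)) i
    have hf : LinearMap.ker (dHker α) ≤ LinearMap.ker f := fun x hx =>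
      homChar_eq_zero.1 (eq_zero_of_dH_eq_zero (homChar_gen_smul f) x (congrArg Subtype.val hx))
    let e := (dHker α).quotKerEquivOfSurjective (dHker_surjective α)
    refine ⟨(LinearMap.ker (dHker α)).liftQ f hf ∘ₗ e.symm.toLinearMap, ?_⟩
    have he : e.symm (dHker α (incl α i (vecP _ w₀))) =
        Submodule.Quotient.mk (incl α i (vecP _ w₀)) := by
      rw [LinearEquiv.symm_apply_eq]; rfl
    rw [LinearMap.comp_apply, LinearEquiv.coe_coe, he, Submodule.liftQ_apply]
    have : f (incl α i (vecP _ w₀)) = q (vecP _ w₀) :=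
      congrArg q (DirectSum.component.lof_self (M := fun i : calI α => P (bal α i)) (H n) i
        (vecP (bal α i) w₀))
    rw [this]
    exact hq

end

/-! ### The extension spaces -/

open CategoryTheory

section
variable {A B C : Type} [AddCommGroup A] [Module (H n) A] [AddCommGroup B] [Module (H n) B]
  [AddCommGroup C] [Module (H n) C] [Module ℂ C] [IsScalarTower ℂ (H n) C]

/-- The connecting map `Hom(ker f, C) → Ext¹(B, C)` of a surjection `f : A → B`. -/
def connecting (C : Type) [AddCommGroup C] [Module (H n) C] [Module ℂ C] [IsScalarTower ℂ (H n) C]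
    {f : A →ₗ[H n] B} (hf : Function.Surjective f) :
    (LinearMap.ker f →ₗ[H n] C) →ₗ[ℂ] Ext1 n B C where
  toFun h := (LinearMap.shortExact_shortComplexKer hf).extClass.comp
    (Abelian.Ext.mk₀ (ModuleCat.ofHom h)) (add_zero 1)
  map_add' h h' := by rw [ModuleCat.ofHom_add, Abelian.Ext.mk₀_add, Abelian.Ext.comp_add]
  map_smul' c h := by
    rw [RingHom.id_apply, ← Abelian.Ext.comp_smul, ← Abelian.Ext.mk₀_smul]
    congr 2
    -- `ℂ` acts on morphisms of modules through its image in the algebra.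
    exact ModuleCat.hom_ext (LinearMap.ext fun x => (algebraMap_smul (H n) c (h x)).symm)

/-- If the homomorphisms from a projective module `A` to `C` vanish on the kernel of a surjection
`f : A → B`, then `Ext¹(B, C)` is the space of homomorphisms from this kernel to `C`. -/
theorem connecting_bijective [Module.Projective (H n) A] {f : A →ₗ[H n] B}
    (hf : Function.Surjective f) (hC : ∀ (g : A →ₗ[H n] C) (x : A), f x = 0 → g x = 0) :
    Function.Bijective (connecting C hf) := by
  have hS := LinearMap.shortExact_shortComplexKer hf
  have : Projective (ModuleCat.of (H n) A) := (IsProjective.iff_projective A).1 inferInstance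
  constructor
  · rw [← LinearMap.ker_eq_bot, LinearMap.ker_eq_bot']
    intro h h0
    obtain ⟨y, hy⟩ := Abelian.Ext.contravariant_sequence_exact₁ hS _
      (Abelian.Ext.mk₀ (ModuleCat.ofHom h)) (add_zero 1) h0
    obtain ⟨y, rfl⟩ := (Abelian.Ext.mk₀_bijective _ _).2 y
    rw [Abelian.Ext.mk₀_comp_mk₀] at hy
    have e := (Abelian.Ext.mk₀_bijective _ _).1 hy
    refine LinearMap.ext fun x => ?_
    exact (LinearMap.congr_fun (congrArg ModuleCat.Hom.hom e) x).symm.trans (hC y.hom x x.2)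
  · intro y
    obtain ⟨x, hx⟩ := Abelian.Ext.contravariant_sequence_exact₃ hS _ y
      (Abelian.Ext.eq_zero_of_projective _) (add_zero 1)
    obtain ⟨x, rfl⟩ := (Abelian.Ext.mk₀_bijective _ _).2 x
    exact ⟨x.hom, hx⟩

end

section
variable {α β : Composition n}

/-- `Ext¹(V_α, F_β)` is the space of homomorphisms from `Ω(V_α)` to `F_β`. -/
def homEquivExt (α β : Composition n) :
    (LinearMap.ker (PhiH α) →ₗ[H n] F β) ≃ₗ[ℂ] Ext1 n (V α) (F β) :=
  LinearEquiv.ofBijective _ <| connecting_bijective (PhiH_surjective α) fun g x hx =>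
    homChar_eq_zero.1 (eq_zero_of_Phi_eq_zero (homChar_gen_smul g) x hx)

theorem nonempty_ext_equiv (hβ : β ∈ calJ α) : Nonempty (Ext1 n (V α) (F β) ≃ₗ[ℂ] ℂ) := by
  obtain ⟨y₀, hinj, h₁, hh₁⟩ := exists_hom_ker hβ
  let ev : (LinearMap.ker (PhiH α) →ₗ[H n] F β) →ₗ[ℂ] ℂ :=
    { toFun := fun h => F.coord β (h y₀)
      map_add' := fun h h' => map_add _ _ _
      map_smul' := fun c h => map_smul (F.coord β) c (h y₀) }
  refine ⟨(homEquivExt α β).symm.trans (LinearEquiv.ofBijective ev ⟨?_, ?_⟩)⟩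
  · rw [← LinearMap.ker_eq_bot, LinearMap.ker_eq_bot']
    exact fun h h0 => hinj h ((F.coord β).map_eq_zero_iff.1 h0)
  · have h0 : ev h₁ ≠ 0 := fun h0 => hh₁ ((F.coord β).map_eq_zero_iff.1 h0)
    exact LinearMap.surjective fun h => h0 (by rw [h]; rfl)

theorem subsingleton_ext (hβ : β ∉ calJ α) : Subsingleton (Ext1 n (V α) (F β)) := by
  have : Subsingleton (LinearMap.ker (PhiH α) →ₗ[H n] F β) :=
    subsingleton_of_forall_eq 0 (hom_ker_eq_zero hβ)
  exact (homEquivExt α β).symm.toEquiv.subsingleton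

end

end ZeroHecke

end

theorem theorem3p2 (n : ℕ) (α : Composition n) :
    ∃ (Φ : ZeroHecke.P (ZeroHecke.GenComp.single α) →ₗ[ZeroHecke.H n] ZeroHecke.V α)
      (d : (⨁ i : ZeroHecke.calI α, ZeroHecke.P (ZeroHecke.bal α i)) →ₗ[ZeroHecke.H n]
        ZeroHecke.P (ZeroHecke.GenComp.single α)),
      (∀ x, Φ x = ZeroHecke.Phi α x) ∧
      (∀ x, d x = ZeroHecke.partialOne α x) ∧
      LinearMap.range d = LinearMap.ker Φ ∧
      (∃ h : ∀ x, d x ∈ LinearMap.ker Φ,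
        ZeroHecke.IsProjectiveCover (d.codRestrict (LinearMap.ker Φ) h)) ∧
      ZeroHecke.IsMinimalProjectivePresentation d Φ ∧
      ∀ β : Composition n,
        (β ∈ ZeroHecke.calJ α →
          Nonempty (ZeroHecke.Ext1 n (ZeroHecke.V α) (ZeroHecke.F β) ≃ₗ[ℂ] ℂ)) ∧
        (β ∉ ZeroHecke.calJ α →
          Subsingleton (ZeroHecke.Ext1 n (ZeroHecke.V α) (ZeroHecke.F β))) := by
  exact ⟨ZeroHecke.PhiH α, ZeroHecke.dH α, fun _ => rfl, fun _ => rfl, ZeroHecke.range_dH,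
    ⟨ZeroHecke.PhiH_dH, ZeroHecke.isProjectiveCover_dHker α⟩,
    ⟨ZeroHecke.PhiH_surjective α, ZeroHecke.range_dH, ZeroHecke.isProjectiveCover_PhiH α,
      ZeroHecke.isProjectiveCover_dHker α⟩,
    fun _ => ⟨ZeroHecke.nonempty_ext_equiv, ZeroHecke.subsingleton_ext⟩⟩
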